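/- Let $q_1,\dots,q_4=(\pm\frac{\sqrt2}{2},\pm\frac{\sqrt2}{2})$ be the four corners of a square in $\mathbb R^2$, let $q_5=(0,0)$, and let $\psi_i(z)=\frac13(z-q_i)+q_i$ for $1\le i\le5$. The Vicsek set $K$ is the unique non-empty compact set with $K=\bigcup_{i=1}^5\psi_i(K)$. Let $d$ be the geodesic distance on $K$ (the infimum of the lengths of paths in $K$), $B(x,r)$ its open balls, $d_h=\frac{\log5}{\log3}$, and $\mu$ the normalized $d_h$-dimensional Hausdorff measure on $K$ (equivalently, the Borel measure with $\mu(\psi_{i_1}\circ\cdots\circ\psi_{i_n}(K))=5^{-n}$ for all $i_1,\dots,i_n$). For $p\ge1$, $\alpha\ge0$, $r>0$ and $f\in L^p(K,\mu)$ let $$E_{p,\alpha}(f,r)=\int_K\frac1{\mu(B(x,r))}\int_{B(x,r)}\frac{|f(y)-f(x)|^p}{r^{p\alpha}}\,d\mu(y)\,d\mu(x),$$ let $KS^{\alpha,p}(K)=\{f\in L^p(K,\mu):\limsup_{r\to0}E_{p,\alpha}(f,r)<\infty\}$, and let the critical exponent $\alpha_p$ be the supremum of all $\alpha\ge0$ for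 which there is an $f\in L^p(K,\mu)$, not $\mu$-a.e. constant, with $\sup_{r>0}E_{p,\alpha}(f,r)<\infty$. For every $p\ge1$ one has $\alpha_p=1+\frac{d_h-1}{p}$, and the property $\mathcal P(p,\alpha_p)$ holds: $KS^{\alpha_p,p}(K)$ contains functions that are not $\mu$-a.e. constant, and there is a constant $C\ge1$ (depending on $p$) such that for every $f\in KS^{\alpha_p,p}(K)$ $$\sup_{r>0}E_{p,\alpha_p}(f,r)\le C\liminf_{r\to0}E_{p,\alpha_p}(f,r).$$ Let moreover $V_0=\{q_1,\dots,q_5\}$, with $q_5$ joined by an edge to each of $q_1,\dots,q_4$, and let $V_{m+1}=\bigcup_{i}\psi_i(V_m)$, with edges the images under the maps $\psi_i$ of the edges of $V_m$; write $x\sim y$ for adjacent vertices, and for $p>1$ and $f\in C(K)$ let $$\mathcal E_p^m(f)=\frac12\,3^{(p-1)m}\sum_{x,y\in V_m,\ x\sim y}|f(x)-f(y)|^p .$$ Let $p>1$. Then every $f\in KS^{\alpha_p,p}(K)$ has a continuous version, so that $KS^{\alpha_p,p}(K)$ is regarded as a subset of $C(K)$; for every $f\in C(K)$ the limit $\mathcal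 E_p(f)=\lim_{m\to\infty}\mathcal E_p^m(f)$ exists in $[0,\infty]$; and, with $\mathrm{Var}_p(f)=\liminf_{r\to0}E_{p,\alpha_p}(f,r)^{1/p}$, there are constants $c,C>0$ (depending on $p$) such that for every $f\in KS^{\alpha_p,p}(K)\cap C(K)$ $$c\,\mathrm{Var}_p(f)^p\le\mathcal E_p(f)\le C\,\mathrm{Var}_p(f)^p .$$ -/

import Mathlib

open Filter Topology MeasureTheory
open scoped ENNReal NNReal

/-! ### Korevaar-Schoen functionals on a metric measure space

`d` is a distance function with values in `[0, ∞]` on a measurable space `X`, and `μ` is a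
measure on `X`. The distance is kept separate from any instance on `X` because the geodesic
distance below is not the distance inherited from the plane. -/

namespace KorevaarSchoen

section

variable {X : Type*} [MeasurableSpace X]

/-- The open ball `B(x, r) = {y : d(x, y) < r}`. -/
def ball (d : X → X → ℝ≥0∞) (x : X) (r : ℝ) : Set X :=
  {y | d x y < ENNReal.ofReal r}

/-- `E_{p,α}(f, r) = ∫_X (1 / μ(B(x,r))) ∫_{B(x,r)} |f(y) - f(x)|^p / r^{pα} dμ(y) dμ(x)`. -/
noncomputable def energy (d : X → X → ℝ≥0∞) (μ : Measure X) (p α : ℝ) (f : X → ℝ) (r : ℝ) :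
    ℝ≥0∞ :=
  ∫⁻ x, (μ (ball d x r))⁻¹ *
    ∫⁻ y in ball d x r, ENNReal.ofReal (|f y - f x| ^ p / r ^ (p * α)) ∂μ ∂μ

/-- Membership in the Besov-Lipschitz space `B^{α,p}(X)`. -/
def MemBesov (d : X → X → ℝ≥0∞) (μ : Measure X) (p α : ℝ) (f : X → ℝ) : Prop :=
  MemLp f (ENNReal.ofReal p) μ ∧ (⨆ (r : ℝ) (_ : 0 < r), energy d μ p α f r) < ∞

/-- Membership in the Korevaar-Schoen space `KS^{α,p}(X)`. -/
def MemKS (d : X → X → ℝ≥0∞) (μ : Measure X) (p α : ℝ) (f : X → ℝ) : Prop :=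
  MemLp f (ENNReal.ofReal p) μ ∧ limsup (energy d μ p α f) (𝓝[>] 0) < ∞

/-- `f` is constant `μ`-almost everywhere. -/
def IsConstAE (μ : Measure X) (f : X → ℝ) : Prop :=
  ∃ c : ℝ, ∀ᵐ x ∂μ, f x = c

/-- The `L^p` critical Besov exponent: the supremum, in `[0, ∞]`, of the `α ≥ 0` for which
`B^{α,p}(X)` contains non-constant functions. -/
noncomputable def criticalExponent (d : X → X → ℝ≥0∞) (μ : Measure X) (p : ℝ) : ℝ≥0∞ :=
  ⨆ (α : ℝ≥0) (_ : ∃ f : X → ℝ, MemBesov d μ p α f ∧ ¬ IsConstAE μ f), (α : ℝ≥0∞)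

/-- The property `P(p, α)`. -/
def PropertyP (d : X → X → ℝ≥0∞) (μ : Measure X) (p α : ℝ) : Prop :=
  (∃ f : X → ℝ, MemKS d μ p α f ∧ ¬ IsConstAE μ f) ∧
    ∃ C : ℝ, 1 ≤ C ∧ ∀ f : X → ℝ, MemKS d μ p α f →
      (⨆ (r : ℝ) (_ : 0 < r), energy d μ p α f r) ≤
        ENNReal.ofReal C * liminf (energy d μ p α f) (𝓝[>] 0)

/-- `liminf_{r → 0} E_{p,α}(f, r)^{1/p}`, which is `Var_p(f)` when `α` is the critical exponent. -/
noncomputable def variation (d : X → X → ℝ≥0∞) (μ : Measure X) (p α : ℝ) (f : X → ℝ) : ℝ≥0∞ :=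
  liminf (fun r : ℝ => energy d μ p α f r ^ (1 / p)) (𝓝[>] 0)

end

end KorevaarSchoen

/-! ### The Vicsek set -/

namespace Vicsek

/-- The Euclidean plane. -/
abbrev Plane : Type := EuclideanSpace ℝ (Fin 2)

/-- The four corners `q₁, …, q₄` (indices `0, …, 3`) and the center `q₅` (index `4`). -/
noncomputable def q : Fin 5 → Plane :=
  ![!₂[-(√2 / 2), √2 / 2], !₂[√2 / 2, √2 / 2], !₂[√2 / 2, -(√2 / 2)], !₂[-(√2 / 2), -(√2 / 2)],
    !₂[0, 0]]

/-- The contractions `ψ_i(z) = (z - q_i) / 3 + q_i`. -/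
noncomputable def ψ (i : Fin 5) (z : Plane) : Plane :=
  (1 / 3 : ℝ) • (z - q i) + q i

theorem lipschitzWith_ψ (i : Fin 5) : LipschitzWith (1 / 3) (ψ i) := by
  refine LipschitzWith.of_dist_le_mul fun x y => ?_
  have h : ψ i x - ψ i y = (1 / 3 : ℝ) • (x - y) := by
    simp only [ψ, smul_sub]; abel
  rw [dist_eq_norm, h, norm_smul, dist_eq_norm]
  simp

/-- The map `A ↦ ⋃ i, ψ_i(A)` on non-empty compact sets. -/
noncomputable def hutchinson (A : TopologicalSpace.NonemptyCompacts Plane) :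
    TopologicalSpace.NonemptyCompacts Plane where
  carrier := ⋃ i, ψ i '' (A : Set Plane)
  isCompact' := isCompact_iUnion fun i => A.isCompact.image (lipschitzWith_ψ i).continuous
  nonempty' := (A.nonempty.image (ψ 0)).mono (Set.subset_iUnion (fun i => ψ i '' (A : Set Plane)) 0)

theorem exists_edist_le (A B : TopologicalSpace.NonemptyCompacts Plane) (i : Fin 5)
    {x : Plane} (hx : x ∈ ψ i '' (A : Set Plane)) :
    ∃ y ∈ ψ i '' (B : Set Plane), edist x y ≤ ((1 / 3 : ℝ≥0) : ℝ≥0∞) *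
      Metric.hausdorffEDist (A : Set Plane) B := by
  obtain ⟨a, ha, rfl⟩ := hx
  obtain ⟨b, hb, hab⟩ := B.isCompact.exists_infEDist_eq_edist B.nonempty a
  refine ⟨ψ i b, ⟨b, hb, rfl⟩, (lipschitzWith_ψ i a b).trans ?_⟩
  rw [← hab]
  exact mul_le_mul_right (Metric.infEDist_le_hausdorffEDist_of_mem ha) _

theorem contractingWith_hutchinson : ContractingWith (1 / 3) hutchinson := by
  refine ⟨by rw [← NNReal.coe_lt_coe]; norm_num, fun A B => ?_⟩
  change Metric.hausdorffEDist (⋃ i, ψ i '' (A : Set Plane)) (⋃ i, ψ i '' (B : Set Plane)) ≤ _ *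
    Metric.hausdorffEDist (A : Set Plane) B
  refine Metric.hausdorffEDist_iUnion_le.trans (iSup_le fun i => ?_)
  refine Metric.hausdorffEDist_le_of_mem_edist (fun x hx => exists_edist_le A B i hx)
    fun x hx => ?_
  rw [Metric.hausdorffEDist_comm]
  exact exists_edist_le B A i hx

theorem existsUnique_vicsekSet :
    ∃! K : Set Plane, K.Nonempty ∧ IsCompact K ∧ K = ⋃ i, ψ i '' K := by
  have hne : Nonempty (TopologicalSpace.NonemptyCompacts Plane) := inferInstance
  set F := ContractingWith.fixedPoint hutchinson contractingWith_hutchinson with hF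
  have hfix : hutchinson F = F := contractingWith_hutchinson.fixedPoint_isFixedPt
  refine ⟨(F : Set Plane), ⟨F.nonempty, F.isCompact, ?_⟩, ?_⟩
  · exact (congrArg (fun A : TopologicalSpace.NonemptyCompacts Plane => (A : Set Plane)) hfix).symm
  · rintro K ⟨h1, h2, h3⟩
    have hK : hutchinson ⟨⟨K, h2⟩, h1⟩ = ⟨⟨K, h2⟩, h1⟩ :=
      TopologicalSpace.NonemptyCompacts.ext h3.symm
    have h := contractingWith_hutchinson.fixedPoint_unique hK
    exact congrArg (fun A : TopologicalSpace.NonemptyCompacts Plane => (A : Set Plane)) h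

/-- The Vicsek set: the unique non-empty compact set `K` with `K = ⋃ i, ψ_i(K)`. -/
noncomputable def vicsekSet : Set Plane :=
  existsUnique_vicsekSet.choose

theorem vicsekSet_spec :
    vicsekSet.Nonempty ∧ IsCompact vicsekSet ∧ vicsekSet = ⋃ i, ψ i '' vicsekSet :=
  existsUnique_vicsekSet.choose_spec.1

/-- The Vicsek set as a type, with the topology, the Borel sets and the Euclidean distance of the
plane. -/
abbrev K : Type := ↥vicsekSet

/-- The geodesic distance on the Vicsek set: the infimum of the lengths of the continuous paths in
the Vicsek set that join `x` and `y`. -/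
noncomputable def geodesicDist (x y : K) : ℝ≥0∞ :=
  ⨅ γ : Path x y, eVariationOn γ Set.univ

/-- The Hausdorff dimension `d_h = log 5 / log 3`. -/
noncomputable def dh : ℝ := Real.log 5 / Real.log 3

/-- The normalized `d_h`-dimensional Hausdorff measure on the Vicsek set. -/
noncomputable def μ : Measure K :=
  (μH[dh] (Set.univ : Set K))⁻¹ • μH[dh]

/-- The exponent `α_p = 1 + (d_h - 1) / p`. -/
noncomputable def αExp (p : ℝ) : ℝ := 1 + (dh - 1) / p

/-- The vertex sets `V_0 = {q₁, …, q₅}` and `V_{n+1} = ⋃ i, ψ_i(V_n)`. -/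
noncomputable def V : ℕ → Set Plane
  | 0 => Set.range q
  | n + 1 => ⋃ i, ψ i '' V n

/-- Adjacency in the cable systems: in the system of level `0` the center is joined to each of the
four corners, and the edges of the system of level `n + 1` are the images under the maps `ψ_i` of
the edges of the system of level `n`. -/
def Adj : ℕ → Plane → Plane → Prop
  | 0 => fun x y => ∃ i : Fin 5, i ≠ 4 ∧ ((x = q 4 ∧ y = q i) ∨ (x = q i ∧ y = q 4))
  | n + 1 => fun x y => ∃ (i : Fin 5) (x' y' : Plane), Adj n x' y' ∧ x = ψ i x' ∧ y = ψ i y'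

/-- The discrete `p`-energy `(1/2) 3^{(p-1)m} ∑_{x, y ∈ V_m, x ∼ y} |f(x) - f(y)|^p`, where the sum
is over ordered pairs. -/
noncomputable def discreteEnergy (p : ℝ) (m : ℕ) (f : K → ℝ) : ℝ≥0∞ :=
  (1 / 2) * ENNReal.ofReal ((3 : ℝ) ^ ((p - 1) * m)) *
    ∑' e : {e : K × K // (e.1 : Plane) ∈ V m ∧ (e.2 : Plane) ∈ V m ∧ Adj m e.1 e.2},
      ENNReal.ofReal (|f e.1.1 - f e.1.2| ^ p)

/-- The `p`-energy, the limit of the discrete `p`-energies. -/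
noncomputable def pEnergy (p : ℝ) (f : K → ℝ) : ℝ≥0∞ :=
  limUnder atTop (fun m : ℕ => discreteEnergy p m f)

end Vicsek

namespace Vicsek

/-! A cell of level `n` has diameter of order `3⁻ⁿ` and mass `5⁻ⁿ = (3⁻ⁿ)^dh`, and two cells closer
than `3⁻ⁿ` share a point (`touch_of_dist_lt`). Hence `K` is quasiconvex (`curve_dist`), geodesic and
Euclidean distances are comparable, and balls of radius `r ≤ 3` have mass comparable to `r^dh`.

Property `P` comes from chaining. Points at distance `r` are joined by about `r 3^m` touching cells
of level `m`; convexity of the `p`-th power costs `(r 3^m)^(p-1)`, and each touching pair serves at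
most about `(r 3^m)^(2 dh)` pairs of cells (`H_le_touchSum`). The exponents add up to `θ p = dh + p
α_p`, exactly the normalisation of the energy, so the energy at one scale is bounded by a constant
times the energy at any smaller scale (`energy_le_energy`). For `α > α_p` the same bound lets the
oscillation be sent to zero (`isConstAE_of_memBesov`). At `α_p` itself the signed length along a
diagonal, constant on the side branches, has bounded energy (`exists_memBesov`), so `α_p` is
critical.

Every edge is cut into three edges of the next level, so convexity makes the discrete energies
increase (`wordEnergy_mono`), and their limit is self-similar. For `p > 1` a geometric series of
ratio `3^(-(p-1)/p)` bounds the oscillation on a cell by the limit energy of that cell (`morrey`);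
summing over cells bounds the Korevaar-Schoen energy. Conversely, edge differences are bounded by
chaining between fine cells shrinking to the end points, and all powers of the fine scale cancel
(`wordEnergy_le_liminf`). The same ratio makes averages over shrinking balls uniformly Cauchy, which
yields the continuous version (`exists_continuous_version`). -/

/-! ### Coordinates on the plane and the gluing of cells of level one. -/

/-- The signs of the coordinates of the fixed points `q i`. -/
def sgn : Fin 5 → Fin 2 → ℤ :=
  ![![-1, 1], ![1, 1], ![1, -1], ![-1, -1], ![0, 0]]

/-- The involution of the indices that exchanges opposite corners. -/
def opp : Fin 5 → Fin 5 := ![2, 3, 0, 1, 4]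

theorem sgn_opp (i : Fin 5) (k : Fin 2) : sgn (opp i) k = -sgn i k := by
  revert i k; decide

theorem abs_sgn_le (i : Fin 5) (k : Fin 2) : |sgn i k| ≤ 1 := by
  revert i k; decide

theorem sgn_injective : Function.Injective sgn := by
  decide

theorem abs_sgn_eq {i : Fin 5} (hi : i ≠ 4) (k : Fin 2) : |sgn i k| = 1 := by
  revert i k; decide

theorem sqrt_two_mul_q (i : Fin 5) (k : Fin 2) : √2 * q i k = sgn i k := by
  have h : √2 * (√2 / 2) = 1 := by
    rw [← mul_div_assoc, Real.mul_self_sqrt (by norm_num)]; norm_num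
  fin_cases i <;> fin_cases k <;> simp [q, sgn, h]

/-- The normalised coordinates on the plane, in which the corners are `(±1, ±1)`. -/
noncomputable def cx (x : Plane) (k : Fin 2) : ℝ := √2 * x k

theorem cx_q (i : Fin 5) (k : Fin 2) : cx (q i) k = sgn i k := sqrt_two_mul_q i k

theorem cx_ψ (i : Fin 5) (x : Plane) (k : Fin 2) :
    cx (ψ i x) k = (cx x k + 2 * sgn i k) / 3 := by
  rw [← sqrt_two_mul_q i k]
  simp only [cx, ψ, PiLp.add_apply, PiLp.smul_apply, PiLp.sub_apply, smul_eq_mul]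
  ring

theorem cx_injective : Function.Injective cx := by
  intro x y h
  ext k
  have := congrFun h k
  simp only [cx] at this
  exact mul_left_cancel₀ (by positivity) this

theorem dist_sq_eq (x y : Plane) :
    dist x y ^ 2 = ((cx x 0 - cx y 0) ^ 2 + (cx x 1 - cx y 1) ^ 2) / 2 := by
  rw [EuclideanSpace.dist_eq, Real.sq_sqrt (by positivity)]
  have h : (√2) ^ 2 = 2 := Real.sq_sqrt (by norm_num)
  simp only [Fin.sum_univ_two, cx, Real.dist_eq, sq_abs, ← mul_sub, mul_pow, h]
  ring

theorem abs_cx_sub_le (x y : Plane) (k : Fin 2) : |cx x k - cx y k| ≤ 3 / 2 * dist x y := by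
  apply abs_le_of_sq_le_sq _ (by positivity)
  have h := dist_sq_eq x y
  fin_cases k <;> simp only [Fin.zero_eta, Fin.mk_one] <;>
  nlinarith [sq_nonneg (cx x 0 - cx y 0), sq_nonneg (cx x 1 - cx y 1)]

theorem dist_le_of_abs_cx_sub_le {x y : Plane} {t : ℝ} (ht : 0 ≤ t)
    (h : ∀ k, |cx x k - cx y k| ≤ t) : dist x y ≤ t := by
  apply le_of_sq_le_sq _ ht
  rw [dist_sq_eq]
  have h0 := sq_le_sq' (abs_le.1 (h 0)).1 (abs_le.1 (h 0)).2
  have h1 := sq_le_sq' (abs_le.1 (h 1)).1 (abs_le.1 (h 1)).2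
  linarith

theorem dist_ψ (i : Fin 5) (x y : Plane) : dist (ψ i x) (ψ i y) = dist x y / 3 := by
  have h : ψ i x - ψ i y = (1 / 3 : ℝ) • (x - y) := by
    simp only [ψ, smul_sub]; abel
  rw [dist_eq_norm, h, norm_smul, dist_eq_norm]
  norm_num; ring

theorem q_four : q 4 = 0 := by
  apply cx_injective
  ext k
  rw [cx_q]
  fin_cases k <;> simp [sgn, cx]

theorem isCompact_vicsekSet : IsCompact vicsekSet := vicsekSet_spec.2.1

theorem ψ_mem {i : Fin 5} {x : Plane} (hx : x ∈ vicsekSet) : ψ i x ∈ vicsekSet := by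
  rw [vicsekSet_spec.2.2]
  exact Set.mem_iUnion.2 ⟨i, x, hx, rfl⟩

theorem exists_ψ_eq {x : Plane} (hx : x ∈ vicsekSet) : ∃ i, ∃ y ∈ vicsekSet, ψ i y = x := by
  rw [vicsekSet_spec.2.2] at hx
  obtain ⟨i, y, hy, rfl⟩ := Set.mem_iUnion.1 hx
  exact ⟨i, y, hy, rfl⟩

/-- The orbit of any point of the closed set `K` under `ψ i` stays in `K` and converges to the fixed
point of `ψ i`. -/
theorem q_mem (i : Fin 5) : q i ∈ vicsekSet := by
  obtain ⟨x, hx⟩ := vicsekSet_spec.1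
  have h1 : ∀ n : ℕ, (ψ i)^[n] x ∈ vicsekSet := by
    intro n
    induction n with
    | zero => exact hx
    | succ n ih => rw [Function.iterate_succ_apply']; exact ψ_mem ih
  have hq : ψ i (q i) = q i := by simp [ψ]
  have h2 : ∀ n : ℕ, dist ((ψ i)^[n] x) (q i) = dist x (q i) * (1 / 3) ^ n := by
    intro n
    induction n with
    | zero => simp
    | succ n ih =>
      rw [Function.iterate_succ_apply']
      conv_lhs => rw [← hq]
      rw [dist_ψ, ih]; ring
  refine isCompact_vicsekSet.isClosed.mem_of_tendsto (b := atTop) (f := fun n => (ψ i)^[n] x) ?_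
    (Eventually.of_forall h1)
  rw [tendsto_iff_dist_tendsto_zero]
  simp only [h2]
  have := (tendsto_pow_atTop_nhds_zero_of_lt_one (r := (1 / 3 : ℝ)) (by norm_num)
    (by norm_num)).const_mul (dist x (q i))
  simpa using this

theorem continuous_cx (k : Fin 2) : Continuous fun x : Plane => cx x k := by
  unfold cx; fun_prop

/-- The maximum `M` of the coordinate over `K` satisfies `M ≤ (M + 2) / 3` by self-similarity. -/
theorem abs_cx_le {x : Plane} (hx : x ∈ vicsekSet) (k : Fin 2) : |cx x k| ≤ 1 := by
  obtain ⟨z, hz, hmax⟩ := isCompact_vicsekSet.exists_isMaxOn vicsekSet_spec.1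
    (continuous_cx k).abs.continuousOn
  refine (hmax hx).trans ?_
  obtain ⟨i, y, hy, rfl⟩ := exists_ψ_eq hz
  have h1 : |cx y k| ≤ |cx (ψ i y) k| := hmax hy
  have h2 : |cx (ψ i y) k| ≤ (|cx y k| + 2) / 3 := by
    rw [cx_ψ, abs_div, abs_of_pos (by norm_num : (0 : ℝ) < 3)]
    have h3 : |2 * (sgn i k : ℝ)| ≤ 2 := by
      rw [abs_mul, abs_two]
      have : |(sgn i k : ℝ)| ≤ 1 := by exact_mod_cast abs_sgn_le i k
      linarith
    have := abs_add_le (cx y k) (2 * (sgn i k : ℝ))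
    linarith
  linarith

/-- The maps `ψ i`, restricted to the Vicsek set. -/
noncomputable def ψK (i : Fin 5) (x : K) : K := ⟨ψ i x, ψ_mem x.2⟩

/-- The points `q i` of the Vicsek set. -/
noncomputable def qK (i : Fin 5) : K := ⟨q i, q_mem i⟩

theorem exists_ψK_eq (x : K) : ∃ i y, ψK i y = x := by
  obtain ⟨i, y, hy, h⟩ := exists_ψ_eq x.2
  exact ⟨i, ⟨y, hy⟩, Subtype.ext h⟩

theorem ψK_qK (i : Fin 5) : ψK i (qK i) = qK i := Subtype.ext (by simp [ψK, qK, ψ])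

theorem K_ext {x y : K} (h : ∀ k, cx x k = cx y k) : x = y :=
  Subtype.ext (cx_injective (funext h))

/-- Together with `ψK_eq_ψK` this describes every contact between cells of level one: the outer
cells meet only the central one, each in a single corner. -/
theorem ψK_four_qK (i : Fin 5) : ψK 4 (qK i) = ψK i (qK (opp i)) := by
  refine K_ext fun k => ?_
  change cx (ψ 4 (q i)) k = cx (ψ i (q (opp i))) k
  rw [cx_ψ, cx_ψ, cx_q, cx_q, sgn_opp]
  have : sgn 4 k = 0 := by revert k; decide
  rw [this]; push_cast; ring

/-- If two points of distinct cells of level one agree, one of the cells is the central one, and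
the point is the vertex that the cells share. -/
theorem ψK_eq_ψK {i j : Fin 5} (hij : i ≠ j) {x y : K} (h : ψK i x = ψK j y) :
    (i = 4 ∧ x = qK j ∧ y = qK (opp j)) ∨ (j = 4 ∧ y = qK i ∧ x = qK (opp i)) := by
  have hk : ∀ k, cx x k + 2 * sgn i k = cx y k + 2 * sgn j k := by
    intro k
    have := congrArg (fun z : K => cx z k) h
    simp only [ψK, cx_ψ] at this
    linarith
  have hx := fun k => abs_le.1 (abs_cx_le x.2 k)
  have hy := fun k => abs_le.1 (abs_cx_le y.2 k)
  have h2 : ∀ k, |sgn i k - sgn j k| ≤ 1 := by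
    intro k
    have h3 : |((sgn i k - sgn j k : ℤ) : ℝ)| ≤ 1 := by
      push_cast
      rw [abs_le]
      constructor <;> linarith [hk k, (hx k).1, (hx k).2, (hy k).1, (hy k).2]
    exact_mod_cast h3
  -- Two different corners have signs that differ by 2 in some coordinate.
  have h4 : i = 4 ∨ j = 4 := by
    revert h2 hij; clear hk; clear hx hy h
    revert i j; decide
  rcases h4 with rfl | rfl
  · left
    have hj : ∀ k, |sgn j k| = 1 := abs_sgn_eq hij.symm
    have h0 : ∀ k, sgn 4 k = 0 := by decide
    -- Two numbers of `[-1, 1]` whose difference is `±2` are the end points.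
    have key : ∀ k, cx x k = sgn j k ∧ cx y k = -sgn j k := by
      intro k
      have h5 := hk k
      rw [h0 k] at h5
      rcases (abs_eq (by norm_num)).1 (hj k) with h6 | h6 <;> rw [h6] at h5 ⊢ <;> push_cast at h5 ⊢ <;>
        constructor <;> linarith [(hx k).1, (hx k).2, (hy k).1, (hy k).2]
    refine ⟨rfl, K_ext fun k => ?_, K_ext fun k => ?_⟩
    · rw [(key k).1]; exact (cx_q j k).symm
    · rw [(key k).2]
      refine Eq.trans ?_ (cx_q (opp j) k).symm
      rw [sgn_opp]; push_cast; rfl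
  · right
    have hj : ∀ k, |sgn i k| = 1 := abs_sgn_eq hij
    have h0 : ∀ k, sgn 4 k = 0 := by decide
    have key : ∀ k, cx y k = sgn i k ∧ cx x k = -sgn i k := by
      intro k
      have h5 := hk k
      rw [h0 k] at h5
      rcases (abs_eq (by norm_num)).1 (hj k) with h6 | h6 <;> rw [h6] at h5 ⊢ <;> push_cast at h5 ⊢ <;>
        constructor <;> linarith [(hx k).1, (hx k).2, (hy k).1, (hy k).2]
    refine ⟨rfl, K_ext fun k => ?_, K_ext fun k => ?_⟩
    · rw [(key k).1]; exact (cx_q i k).symm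
    · rw [(key k).2]
      refine Eq.trans ?_ (cx_q (opp i) k).symm
      rw [sgn_opp]; push_cast; rfl

/-! ### Words, cells and their positions on a lattice. -/

/-- Words of length `n` in the alphabet of the five maps. -/
def Word : ℕ → Type
  | 0 => Unit
  | n + 1 => Fin 5 × Word n

instance instFintypeWord : (n : ℕ) → Fintype (Word n)
  | 0 => inferInstanceAs (Fintype Unit)
  | n + 1 => @instFintypeProd (Fin 5) (Word n) _ (instFintypeWord n)

/-- The composition `ψ_{w₁} ∘ ⋯ ∘ ψ_{wₙ}` on the Vicsek set. -/
noncomputable def φ : {n : ℕ} → Word n → K → K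
  | 0, _, x => x
  | _ + 1, w, x => ψK w.1 (φ w.2 x)

/-- The position of the cell of a word on the lattice of its level. -/
def pos : {n : ℕ} → Word n → Fin 2 → ℤ
  | 0, _, _ => 0
  | n + 1, w, k => pos w.2 k + 2 * 3 ^ n * sgn w.1 k

/-- The cell `ψ_{w₁} ∘ ⋯ ∘ ψ_{wₙ}(K)`. -/
def cell {n : ℕ} (w : Word n) : Set K := Set.range (φ w)

theorem sum_word_succ {M : Type*} [AddCommMonoid M] {n : ℕ} (g : Word (n + 1) → M) :
    ∑ w, g w = ∑ i : Fin 5, ∑ w : Word n, g (i, w) :=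
  Fintype.sum_prod_type (f := g)

theorem card_word (n : ℕ) : Fintype.card (Word n) = 5 ^ n := by
  induction n with
  | zero => rfl
  | succ n ih =>
    have : Fintype.card (Word (n + 1)) = Fintype.card (Fin 5 × Word n) := rfl
    rw [this, Fintype.card_prod, ih, Fintype.card_fin, pow_succ]; ring

theorem cx_φ {n : ℕ} (w : Word n) (x : K) (k : Fin 2) :
    cx (φ w x) k = (cx x k + pos w k) / 3 ^ n := by
  induction n with
  | zero => simp [φ, pos]
  | succ n ih =>
    change cx (ψ w.1 (φ w.2 x)) k = _
    rw [cx_ψ, ih, pos, pow_succ]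
    push_cast
    field_simp
    ring

theorem dist_φ {n : ℕ} (w : Word n) (x y : K) : dist (φ w x) (φ w y) = dist x y / 3 ^ n := by
  induction n with
  | zero => simp [φ]
  | succ n ih =>
    change dist (ψ w.1 (φ w.2 x)) (ψ w.1 (φ w.2 y)) = _
    rw [dist_ψ]
    have := ih w.2
    rw [Subtype.dist_eq] at this
    rw [this, pow_succ]; ring

theorem continuous_φ {n : ℕ} (w : Word n) : Continuous (φ w) := by
  refine (LipschitzWith.of_dist_le_mul (K := 1) fun x y => ?_).continuous
  rw [dist_φ]
  have : (1 : ℝ) ≤ 3 ^ n := one_le_pow₀ (by norm_num)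
  simpa using div_le_self dist_nonneg this

theorem φ_injective {n : ℕ} (w : Word n) : Function.Injective (φ w) := by
  intro x y h
  have := dist_φ w x y
  rw [h, dist_self, eq_comm, div_eq_zero_iff] at this
  exact dist_eq_zero.1 (this.resolve_right (by positivity))

instance : CompactSpace K := isCompact_iff_compactSpace.1 isCompact_vicsekSet

theorem isCompact_cell {n : ℕ} (w : Word n) : IsCompact (cell w) :=
  isCompact_range (continuous_φ w)

theorem measurableSet_cell {n : ℕ} (w : Word n) : MeasurableSet (cell w) :=
  (isCompact_cell w).isClosed.measurableSet

theorem φ_mem_cell {n : ℕ} (w : Word n) (x : K) : φ w x ∈ cell w := ⟨x, rfl⟩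

theorem exists_mem_cell (n : ℕ) (x : K) : ∃ w : Word n, x ∈ cell w := by
  induction n generalizing x with
  | zero => exact ⟨(), x, rfl⟩
  | succ n ih =>
    obtain ⟨i, y, rfl⟩ := exists_ψK_eq x
    obtain ⟨w, z, rfl⟩ := ih y
    exact ⟨(i, w), z, rfl⟩

theorem dist_le_two (x y : K) : dist x y ≤ 2 := by
  refine dist_le_of_abs_cx_sub_le (by norm_num) fun k => ?_
  have h1 := abs_le.1 (abs_cx_le x.2 k)
  have h2 := abs_le.1 (abs_cx_le y.2 k)
  rw [abs_le]
  constructor <;> linarith [h1.1, h1.2, h2.1, h2.2]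

theorem dist_le_of_mem_cell {n : ℕ} {w : Word n} {x y : K} (hx : x ∈ cell w) (hy : y ∈ cell w) :
    dist x y ≤ 2 / 3 ^ n := by
  obtain ⟨x, rfl⟩ := hx
  obtain ⟨y, rfl⟩ := hy
  rw [dist_φ]
  have := dist_le_two x y
  gcongr

/-- This congruence and `four_dvd_pos_add` place the cells on one colour of a checkerboard, which
rules out neighbours across a side. -/
theorem pos_even {n : ℕ} (w : Word n) (k : Fin 2) : (2 : ℤ) ∣ pos w k := by
  induction n with
  | zero => simp [pos]
  | succ n ih =>
    rw [pos, mul_assoc]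
    exact dvd_add (ih w.2) (dvd_mul_right _ _)

theorem four_dvd_pos_add {n : ℕ} (w : Word n) : (4 : ℤ) ∣ pos w 0 + pos w 1 := by
  induction n with
  | zero => simp [pos]
  | succ n ih =>
    have h1 : (2 : ℤ) ∣ sgn w.1 0 + sgn w.1 1 := by
      generalize w.1 = i
      revert i; decide
    obtain ⟨a, ha⟩ := h1
    obtain ⟨b, hb⟩ := ih w.2
    refine ⟨b + 3 ^ n * a, ?_⟩
    simp only [pos]
    linear_combination hb + 2 * 3 ^ n * ha

theorem abs_pos_lt {n : ℕ} (w : Word n) (k : Fin 2) : |pos w k| < 3 ^ n := by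
  induction n with
  | zero => simp [pos]
  | succ n ih =>
    rw [pos]
    have h1 := abs_lt.1 (ih w.2)
    have h2 := abs_le.1 (abs_sgn_le w.1 k)
    have h3 : (0 : ℤ) < 3 ^ n := by positivity
    rw [abs_lt, pow_succ]
    constructor <;> nlinarith [h1.1, h1.2, h2.1, h2.2]

/-- Uniqueness of a ternary expansion with digits `-1, 0, 1`: the leading term `2 * 3 ^ n * sgn`
dominates the difference of the remainders, which is below `2 * 3 ^ n`. -/
theorem pos_injective {n : ℕ} : Function.Injective (pos : Word n → Fin 2 → ℤ) := by
  induction n with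
  | zero => intro w v _; rfl
  | succ n ih =>
    intro w v h
    have h3 : (0 : ℤ) < 3 ^ n := by positivity
    have key : ∀ k, sgn w.1 k = sgn v.1 k := by
      intro k
      have h0 := congrFun h k
      simp only [pos] at h0
      have h1 := abs_lt.1 (abs_pos_lt w.2 k)
      have h2 := abs_lt.1 (abs_pos_lt v.2 k)
      have h4 : sgn w.1 k - sgn v.1 k < 1 := by
        by_contra hc
        nlinarith [h1.1, h1.2, h2.1, h2.2]
      have h5 : sgn v.1 k - sgn w.1 k < 1 := by
        by_contra hc
        nlinarith [h1.1, h1.2, h2.1, h2.2]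
      omega
    have h1 : w.1 = v.1 := sgn_injective (funext key)
    have h2 : w.2 = v.2 := by
      apply ih
      funext k
      have h0 := congrFun h k
      simp only [pos, key k] at h0
      linarith
    exact Prod.ext h1 h2

/-! ### Touching cells. -/

/-- Two cells of the same level touch if they have a common point. -/
def Touch {n : ℕ} (a b : Word n) : Prop := (cell a ∩ cell b).Nonempty

theorem Touch.refl {n : ℕ} (a : Word n) : Touch a a := ⟨φ a (qK 4), φ_mem_cell _ _, φ_mem_cell _ _⟩

theorem Touch.symm {n : ℕ} {a b : Word n} (h : Touch a b) : Touch b a := by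
  unfold Touch at *; rwa [Set.inter_comm]

/-- In units of `3⁻ⁿ` the two points differ by at most `3/2`, and their coordinates inside the cells
by at most 2. The positions thus differ by less than 4, and they are even. -/
theorem abs_pos_sub_le {n : ℕ} {a b : Word n} {x y : K} (hx : x ∈ cell a) (hy : y ∈ cell b)
    (h : dist x y < 1 / 3 ^ n) (k : Fin 2) : |pos a k - pos b k| ≤ 2 := by
  obtain ⟨x, rfl⟩ := hx
  obtain ⟨y, rfl⟩ := hy
  have h0 : (0 : ℝ) < 3 ^ n := by positivity
  have h1 := (abs_cx_sub_le (φ a x) (φ b y) k)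
  rw [← Subtype.dist_eq, cx_φ, cx_φ, ← sub_div, abs_div, abs_of_pos h0, div_le_iff₀ h0] at h1
  rw [lt_div_iff₀ h0] at h
  have h2 : |cx x k + pos a k - (cx y k + pos b k)| ≤ 3 / 2 := by nlinarith
  have hx := abs_le.1 (abs_cx_le x.2 k)
  have hy := abs_le.1 (abs_cx_le y.2 k)
  have h3 : |((pos a k - pos b k : ℤ) : ℝ)| < 4 := by
    rw [abs_le] at h2
    rw [abs_lt]
    push_cast
    constructor <;> linarith [h2.1, h2.2, hx.1, hx.2, hy.1, hy.2]
  have h4 : |pos a k - pos b k| < 4 := by exact_mod_cast h3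
  obtain ⟨s, hs⟩ := pos_even a k
  obtain ⟨t, ht⟩ := pos_even b k
  rw [abs_lt] at h4
  rw [abs_le]
  omega

/-- After halving, the positions differ by at most 1 in each coordinate and the sum of the
differences is even. The cells therefore coincide or are diagonal neighbours, and the latter share a
corner. -/
theorem touch_of_dist_lt {n : ℕ} {a b : Word n} {x y : K} (hx : x ∈ cell a) (hy : y ∈ cell b)
    (h : dist x y < 1 / 3 ^ n) : Touch a b := by
  have h0 := abs_le.1 (abs_pos_sub_le hx hy h 0)
  have h1 := abs_le.1 (abs_pos_sub_le hx hy h 1)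
  obtain ⟨s0, hs0⟩ := pos_even a 0
  obtain ⟨s1, hs1⟩ := pos_even a 1
  obtain ⟨t0, ht0⟩ := pos_even b 0
  obtain ⟨t1, ht1⟩ := pos_even b 1
  have ha := four_dvd_pos_add a
  have hb := four_dvd_pos_add b
  have key : ∃ i : Fin 5, t0 - s0 = sgn i 0 ∧ t1 - s1 = sgn i 1 := by
    have h2 : (t0 - s0 = 0 ∧ t1 - s1 = 0) ∨ (t0 - s0 = -1 ∧ t1 - s1 = 1) ∨
      (t0 - s0 = 1 ∧ t1 - s1 = 1) ∨ (t0 - s0 = 1 ∧ t1 - s1 = -1) ∨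
      (t0 - s0 = -1 ∧ t1 - s1 = -1) := by omega
    rcases h2 with h | h | h | h | h
    · exact ⟨4, h⟩
    · exact ⟨0, h⟩
    · exact ⟨1, h⟩
    · exact ⟨2, h⟩
    · exact ⟨3, h⟩
  obtain ⟨i, hi0, hi1⟩ := key
  -- The corner of `a` that faces `b` is the opposite corner of `b`; for `i = 4` it is the common
  -- center.
  refine ⟨φ a (qK i), φ_mem_cell _ _, qK (opp i), ?_⟩
  have hi : ∀ k, pos b k - pos a k = 2 * sgn i k := by
    intro k
    fin_cases k
    · simp only [Fin.zero_eta]; omega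
    · simp only [Fin.mk_one]; omega
  refine K_ext fun k => ?_
  rw [cx_φ, cx_φ]
  congr 1
  change cx (q (opp i)) k + _ = cx (q i) k + _
  rw [cx_q, cx_q, sgn_opp]
  have := hi k
  have h3 : ((pos b k - pos a k : ℤ) : ℝ) = ((2 * sgn i k : ℤ) : ℝ) := by rw [this]
  push_cast at h3 ⊢
  linarith

theorem Touch.abs_pos_sub_le {n : ℕ} {a b : Word n} (h : Touch a b) (k : Fin 2) :
    |pos a k - pos b k| ≤ 2 := by
  obtain ⟨x, hx, hy⟩ := h
  exact Vicsek.abs_pos_sub_le hx hy (by rw [dist_self]; positivity) k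

open Classical in
/-- A set of cells whose positions differ by at most two from a given one has at most `25`
elements. -/
theorem card_le_of_abs_pos_sub_le {n : ℕ} (S : Finset (Word n)) (a : Word n)
    (h : ∀ b ∈ S, ∀ k, |pos a k - pos b k| ≤ 2) : S.card ≤ 25 := by
  have h1 : (S.image fun b => (pos b 0, pos b 1)) ⊆
      Finset.Icc (pos a 0 - 2) (pos a 0 + 2) ×ˢ Finset.Icc (pos a 1 - 2) (pos a 1 + 2) := by
    intro z hz
    obtain ⟨b, hb, rfl⟩ := Finset.mem_image.1 hz
    have h0 := abs_le.1 (h b hb 0)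
    have h1 := abs_le.1 (h b hb 1)
    simp only [Finset.mem_product, Finset.mem_Icc]
    omega
  have h2 := Finset.card_le_card h1
  rw [Finset.card_image_of_injective, Finset.card_product, Int.card_Icc, Int.card_Icc] at h2
  · have e0 : (pos a 0 + 2 + 1 - (pos a 0 - 2)).toNat = 5 := by omega
    have e1 : (pos a 1 + 2 + 1 - (pos a 1 - 2)).toNat = 5 := by omega
    rw [e0, e1] at h2
    exact h2
  · intro b c hbc
    apply pos_injective
    funext k
    have := Prod.mk.inj hbc
    fin_cases k
    · exact this.1
    · exact this.2

/-! ### The Hausdorff measure of cells and of small sets. -/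

theorem one_lt_dh : 1 < dh := by
  rw [dh, one_lt_div (Real.log_pos (by norm_num))]
  exact Real.log_lt_log (by norm_num) (by norm_num)

theorem dh_pos : 0 < dh := zero_lt_one.trans one_lt_dh

theorem three_rpow_dh : (3 : ℝ) ^ dh = 5 := by
  rw [dh, Real.rpow_def_of_pos (by norm_num),
    mul_div_cancel₀ _ (Real.log_pos (by norm_num)).ne', Real.exp_log (by norm_num)]

theorem three_pow_rpow_dh (n : ℕ) : ((3 : ℝ) ^ n) ^ dh = 5 ^ n := by
  rw [← Real.rpow_natCast, ← Real.rpow_mul (by norm_num), mul_comm, Real.rpow_mul (by norm_num),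
    three_rpow_dh, Real.rpow_natCast]

theorem exists_scale {δ : ℝ} (h0 : 0 < δ) (h1 : δ < 1) :
    ∃ n : ℕ, 1 / 3 ^ (n + 1) ≤ δ ∧ δ < 1 / 3 ^ n := by
  classical
  have h : ∃ n : ℕ, 1 / 3 ^ n ≤ δ := by
    obtain ⟨n, hn⟩ := exists_pow_lt_of_lt_one h0 (by norm_num : (1 / 3 : ℝ) < 1)
    exact ⟨n, by rw [one_div_pow] at hn; exact hn.le⟩
  have h2 := Nat.find_spec h
  have h3 : Nat.find h ≠ 0 := by
    intro h4
    rw [h4] at h2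
    norm_num at h2; linarith
  obtain ⟨n, hn⟩ := Nat.exists_eq_succ_of_ne_zero h3
  rw [hn] at h2
  refine ⟨n, h2, ?_⟩
  exact not_le.1 (Nat.find_min h (m := n) (by omega))

open Classical in
/-- A set of diameter `δ` meets at most `25` cells of a level `n` with `3⁻ⁿ` comparable to `δ`. -/
theorem exists_cover {U : Set K} {δ : ℝ} (hδ : 0 < δ) (hU : ∀ x ∈ U, ∀ y ∈ U, dist x y ≤ δ) :
    ∃ (n : ℕ) (S : Finset (Word n)), S.card ≤ 25 ∧ (∀ x ∈ U, ∀ w, x ∈ cell w → w ∈ S) ∧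
      ((1 : ℝ) / 5) ^ n ≤ 5 * δ ^ dh := by
  rcases U.eq_empty_or_nonempty with rfl | ⟨x₀, hx₀⟩
  · obtain ⟨n, hn⟩ := exists_pow_lt_of_lt_one (x := 5 * δ ^ dh) (by positivity)
      (by norm_num : (1 / 5 : ℝ) < 1)
    exact ⟨n, ∅, by simp, by simp, hn.le⟩
  rcases le_or_gt 1 δ with h1 | h1
  · refine ⟨0, Finset.univ, ?_, fun _ _ _ _ => Finset.mem_univ _, ?_⟩
    · rw [Finset.card_univ, card_word]; norm_num
    · have := Real.one_le_rpow h1 dh_pos.le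
      simp only [pow_zero]; linarith
  · obtain ⟨n, hn1, hn2⟩ := exists_scale hδ h1
    obtain ⟨a, ha⟩ := exists_mem_cell n x₀
    refine ⟨n, Finset.univ.filter fun w => (cell w ∩ U).Nonempty, ?_, ?_, ?_⟩
    · refine card_le_of_abs_pos_sub_le _ a fun b hb k => ?_
      obtain ⟨y, hy, hyU⟩ := (Finset.mem_filter.1 hb).2
      exact abs_pos_sub_le ha hy ((hU _ hx₀ _ hyU).trans_lt hn2) k
    · exact fun x hx w hw => Finset.mem_filter.2 ⟨Finset.mem_univ _, x, hw, hx⟩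
    -- Since `3 ^ dh = 5`, raising to the power `dh` turns `3⁻ⁿ⁻¹ ≤ δ` into `5⁻ⁿ⁻¹ ≤ δ ^ dh`.
    · have h2 := Real.rpow_le_rpow (by positivity) hn1 dh_pos.le
      rw [Real.div_rpow (by norm_num) (by positivity), three_pow_rpow_dh, Real.one_rpow,
        pow_succ] at h2
      rw [one_div_pow]
      rw [div_le_iff₀ (by positivity)] at h2
      rw [div_le_iff₀ (by positivity)]
      linarith

/-- The point of the plane with a given address. -/
noncomputable def addr (σ : ℕ → Fin 5) : Plane := ∑' k, (2 / 3 ^ (k + 1) : ℝ) • q (σ k)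

theorem norm_q_le (i : Fin 5) : ‖q i‖ ≤ 1 := by
  rw [← dist_zero_right]
  refine dist_le_of_abs_cx_sub_le (by norm_num) fun k => ?_
  rw [cx_q]
  have : |(sgn i k : ℝ)| ≤ 1 := by exact_mod_cast abs_sgn_le i k
  simpa [cx] using this

theorem hasSum_two_div : HasSum (fun k : ℕ => (2 / 3 ^ (k + 1) : ℝ)) 1 := by
  have h := (hasSum_geometric_of_lt_one (r := (1 / 3 : ℝ)) (by norm_num) (by norm_num)).mul_left
    (2 / 3 : ℝ)
  have e1 : (2 / 3 : ℝ) * (1 - 1 / 3)⁻¹ = 1 := by norm_num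
  have e2 : (fun k : ℕ => (2 / 3 ^ (k + 1) : ℝ)) = fun k => 2 / 3 * (1 / 3) ^ k := by
    funext k; rw [pow_succ, one_div_pow]; field_simp
  rwa [e1, ← e2] at h

theorem norm_two_div_smul_le (i : Fin 5) (k : ℕ) :
    ‖(2 / 3 ^ (k + 1) : ℝ) • q i‖ ≤ 2 / 3 ^ (k + 1) := by
  rw [norm_smul, Real.norm_of_nonneg (by positivity)]
  exact mul_le_of_le_one_right (by positivity) (norm_q_le i)

theorem summable_addr (σ : ℕ → Fin 5) : Summable fun k => (2 / 3 ^ (k + 1) : ℝ) • q (σ k) :=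
  Summable.of_norm_bounded hasSum_two_div.summable fun k => norm_two_div_smul_le _ k

theorem norm_addr_le (σ : ℕ → Fin 5) : ‖addr σ‖ ≤ 1 :=
  tsum_of_norm_bounded hasSum_two_div fun k => norm_two_div_smul_le _ k

theorem ψ_eq (i : Fin 5) (x : Plane) : ψ i x = (1 / 3 : ℝ) • x + (2 / 3 : ℝ) • q i := by
  rw [ψ, smul_sub]; module

theorem addr_eq (σ : ℕ → Fin 5) : addr σ = ψ (σ 0) (addr fun k => σ (k + 1)) := by
  rw [addr, (summable_addr σ).tsum_eq_zero_add, ψ_eq, addr, ← tsum_const_smul'' (1 / 3 : ℝ),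
    add_comm]
  congr 1
  · congr 1
    funext k
    rw [smul_smul]
    congr 1
    rw [pow_succ 3 (k + 1)]; field_simp
  · norm_num

/-- This reduces membership in the closed set `K` to an induction, because each `ψ i` divides the
distance to `K` by at least 3. -/
theorem mem_vicsekSet_of_infDist {x : Plane}
    (h : ∀ n : ℕ, Metric.infDist x vicsekSet ≤ 1 / 3 ^ n) : x ∈ vicsekSet := by
  rw [← isCompact_vicsekSet.isClosed.closure_eq,
    Metric.mem_closure_iff_infDist_zero vicsekSet_spec.1]
  refine le_antisymm (le_of_forall_pos_le_add fun ε hε => ?_) Metric.infDist_nonneg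
  obtain ⟨n, hn⟩ := exists_pow_lt_of_lt_one hε (by norm_num : (1 / 3 : ℝ) < 1)
  rw [one_div_pow] at hn
  linarith [h n]

theorem infDist_ψ_le (i : Fin 5) (x : Plane) :
    Metric.infDist (ψ i x) vicsekSet ≤ Metric.infDist x vicsekSet / 3 := by
  obtain ⟨y, hy, h⟩ := isCompact_vicsekSet.exists_infDist_eq_dist vicsekSet_spec.1 x
  rw [h, ← dist_ψ i]
  exact Metric.infDist_le_dist_of_mem (ψ_mem hy)

theorem addr_mem (σ : ℕ → Fin 5) : addr σ ∈ vicsekSet := by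
  refine mem_vicsekSet_of_infDist fun n => ?_
  induction n generalizing σ with
  | zero =>
    refine (Metric.infDist_le_dist_of_mem (q_mem 4)).trans ?_
    rw [q_four, dist_zero_right]
    simpa using norm_addr_le σ
  | succ n ih =>
    rw [addr_eq]
    refine (infDist_ψ_le _ _).trans ?_
    have := ih fun k => σ (k + 1)
    rw [pow_succ, ← div_div]
    gcongr

/-- The point of the Vicsek set with a given address. -/
noncomputable def addrK (σ : ℕ → Fin 5) : K := ⟨addr σ, addr_mem σ⟩

theorem addrK_eq (σ : ℕ → Fin 5) : addrK σ = ψK (σ 0) (addrK fun k => σ (k + 1)) :=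
  Subtype.ext (addr_eq σ)

/-- The letters come from iterating a choice of preimages. After `n` letters the point and the
candidate lie in the same cell of level `n`. -/
theorem exists_addrK_eq (x : K) : ∃ σ, addrK σ = x := by
  choose i y h using exists_ψK_eq
  let z : ℕ → K := fun n => y^[n] x
  refine ⟨fun n => i (z n), ?_⟩
  have key : ∀ n m : ℕ, dist (addrK fun k => i (z (m + k))) (z m) ≤ 2 / 3 ^ n := by
    intro n
    induction n with
    | zero => intro m; simpa using dist_le_two _ _
    | succ n ih =>
      intro m
      have h1 : z m = ψK (i (z m)) (z (m + 1)) := by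
        change _ = ψK _ (y^[m + 1] x)
        rw [Function.iterate_succ_apply']
        exact (h _).symm
      rw [h1, addrK_eq, add_zero]
      change dist (ψ _ _) (ψ _ _) ≤ _
      rw [dist_ψ]
      have := ih (m + 1)
      rw [Subtype.dist_eq] at this
      rw [pow_succ, ← div_div]
      have e : (fun k => i (z (m + (k + 1)))) = fun k => i (z (m + 1 + k)) := by
        funext k; congr 2; ring
      rw [e]
      gcongr
  have h0 : dist (addrK fun k => i (z k)) x = 0 := by
    refine le_antisymm (le_of_forall_pos_le_add fun ε hε => ?_) dist_nonneg
    obtain ⟨n, hn⟩ := exists_pow_lt_of_lt_one (half_pos hε) (by norm_num : (1 / 3 : ℝ) < 1)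
    rw [one_div_pow] at hn
    have := key n 0
    simp only [zero_add] at this
    have e : 2 / (3 : ℝ) ^ n = 2 * (1 / 3 ^ n) := by ring
    rw [e] at this
    change dist _ (z 0) ≤ _
    linarith
  exact dist_eq_zero.1 h0

theorem continuous_addrK : Continuous addrK := by
  refine Continuous.subtype_mk ?_ _
  refine continuous_tsum (fun k => ?_) hasSum_two_div.summable fun k σ => norm_two_div_smul_le _ k
  exact (continuous_of_discreteTopology (f := fun i : Fin 5 => (2 / 3 ^ (k + 1) : ℝ) • q i)).comp
    (continuous_apply k)

/-- The first letters of an address. -/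
def prefixWord : (n : ℕ) → (ℕ → Fin 5) → Word n
  | 0, _ => ()
  | n + 1, σ => (σ 0, prefixWord n fun k => σ (k + 1))

/-- The letters of a word. -/
def letter : {n : ℕ} → Word n → ℕ → Fin 5
  | 0, _, _ => 0
  | _ + 1, w, 0 => w.1
  | _ + 1, w, k + 1 => letter w.2 k

theorem addrK_mem_cell (n : ℕ) (σ : ℕ → Fin 5) : addrK σ ∈ cell (prefixWord n σ) := by
  induction n generalizing σ with
  | zero => exact ⟨addrK σ, rfl⟩
  | succ n ih =>
    obtain ⟨y, hy⟩ := ih fun k => σ (k + 1)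
    exact ⟨y, by rw [addrK_eq, ← hy]; rfl⟩

theorem letter_prefixWord (n : ℕ) (σ : ℕ → Fin 5) {k : ℕ} (hk : k < n) :
    letter (prefixWord n σ) k = σ k := by
  induction n generalizing σ k with
  | zero => omega
  | succ n ih =>
    cases k with
    | zero => rfl
    | succ k => exact ih (fun k => σ (k + 1)) (by omega)

/-- The uniform probability measure on the letters. -/
noncomputable def letterMeasure : Measure (Fin 5) := (5 : ℝ≥0∞)⁻¹ • Measure.count

theorem letterMeasure_singleton (i : Fin 5) : letterMeasure {i} = 5⁻¹ := by
  simp [letterMeasure]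

instance : IsProbabilityMeasure letterMeasure := ⟨by
  simp only [letterMeasure, Measure.smul_apply, smul_eq_mul]
  rw [Measure.count_apply MeasurableSet.univ, Set.encard_univ]
  simpa using ENNReal.inv_mul_cancel (a := 5) (by norm_num) (by norm_num)⟩

/-- The image of the Bernoulli measure under the address map. -/
noncomputable def bernoulli : Measure K :=
  (Measure.infinitePi fun _ : ℕ => letterMeasure).map addrK

theorem measure_prefixWord_le {n : ℕ} (w : Word n) :
    (Measure.infinitePi fun _ : ℕ => letterMeasure) {σ | prefixWord n σ = w} ≤ 5⁻¹ ^ n := by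
  have h1 : {σ | prefixWord n σ = w} ⊆ (Finset.range n : Set ℕ).pi fun k => {letter w k} := by
    rintro σ rfl k hk
    exact (letter_prefixWord n σ (by simpa using hk)).symm
  refine (measure_mono h1).trans ?_
  rw [Measure.infinitePi_pi _ fun _ _ => measurableSet_singleton _]
  simp [letterMeasure_singleton]

theorem bernoulli_univ : bernoulli Set.univ = 1 := by
  rw [bernoulli, Measure.map_apply continuous_addrK.measurable MeasurableSet.univ]
  simp

theorem ofReal_inv_five_pow (n : ℕ) : ENNReal.ofReal ((1 / 5) ^ n) = 5⁻¹ ^ n := by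
  rw [ENNReal.ofReal_pow (by norm_num), one_div, ENNReal.ofReal_inv_of_pos (by norm_num)]
  norm_num

/-- By `exists_cover` the addresses of points of `U` lie in at most 25 cylinders of mass at most
`5⁻ⁿ ≤ 5 δ ^ dh`. -/
theorem bernoulli_le {U : Set K} (hU' : IsClosed U) {δ : ℝ} (hδ : 0 < δ)
    (hU : ∀ x ∈ U, ∀ y ∈ U, dist x y ≤ δ) : bernoulli U ≤ ENNReal.ofReal (125 * δ ^ dh) := by
  obtain ⟨n, S, hS, hS', hn⟩ := exists_cover hδ hU
  rw [bernoulli, Measure.map_apply continuous_addrK.measurable hU'.measurableSet]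
  have h1 : addrK ⁻¹' U ⊆ ⋃ w ∈ S, {σ | prefixWord n σ = w} := fun σ hσ =>
    Set.mem_biUnion (hS' _ hσ _ (addrK_mem_cell n σ)) rfl
  calc _ ≤ ∑ w ∈ S, _ := (measure_mono h1).trans (measure_biUnion_finset_le _ _)
    _ ≤ ∑ w ∈ S, (5⁻¹ : ℝ≥0∞) ^ n := Finset.sum_le_sum fun w _ => measure_prefixWord_le w
    _ = S.card * (5⁻¹ : ℝ≥0∞) ^ n := by rw [Finset.sum_const, nsmul_eq_mul]
    _ ≤ ENNReal.ofReal 25 * ENNReal.ofReal (5 * δ ^ dh) := by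
        gcongr
        · rw [← ENNReal.ofReal_natCast]
          exact ENNReal.ofReal_le_ofReal (by exact_mod_cast hS)
        · rw [← ofReal_inv_five_pow]; exact ENNReal.ofReal_le_ofReal hn
    _ = _ := by rw [← ENNReal.ofReal_mul (by norm_num)]; congr 1; ring

/-- Mass distribution principle: a probability measure that gives sets of diameter `δ` at most `125
δ ^ dh` is bounded by 125 times the Hausdorff measure. -/
theorem hausdorffMeasure_ne_zero : (μH[dh] (Set.univ : Set K)) ≠ 0 := by
  have hle : (125 : ℝ≥0∞)⁻¹ • bernoulli ≤ μH[dh] := by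
    refine Measure.le_hausdorffMeasure dh _ 1 one_pos fun s hs => ?_
    have hfin : Metric.ediam s ≠ ∞ := (hs.trans_lt ENNReal.one_lt_top).ne
    have hclos : ∀ δ : ℝ, 0 < δ → Metric.diam s ≤ δ →
        bernoulli s ≤ ENNReal.ofReal (125 * δ ^ dh) := by
      intro δ hδ hs'
      refine (measure_mono subset_closure).trans (bernoulli_le isClosed_closure hδ ?_)
      intro x hx y hy
      refine le_trans ?_ hs'
      rw [← Metric.diam_closure]
      exact Metric.dist_le_diam_of_mem (by rwa [Metric.isBounded_iff_ediam_ne_top,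
        Metric.ediam_closure]) hx hy
    -- The diameter may be zero, so it is approached from above by positive `δ`.
    have hb : bernoulli s ≤ ENNReal.ofReal (125 * Metric.diam s ^ dh) := by
      have ht : Tendsto (fun δ : ℝ => ENNReal.ofReal (125 * δ ^ dh)) (𝓝[>] (Metric.diam s))
          (𝓝 (ENNReal.ofReal (125 * Metric.diam s ^ dh))) := by
        refine Tendsto.mono_left ?_ nhdsWithin_le_nhds
        refine (ENNReal.continuous_ofReal.tendsto _).comp ?_
        exact ((Real.continuous_rpow_const dh_pos.le).tendsto _).const_mul _
      refine ge_of_tendsto ht ?_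
      filter_upwards [self_mem_nhdsWithin] with δ hδ
      exact hclos δ (Metric.diam_nonneg.trans_lt hδ) (le_of_lt hδ)
    rw [Measure.smul_apply, smul_eq_mul, ENNReal.inv_mul_le_iff (by norm_num) (by norm_num)]
    refine hb.trans ?_
    rw [ENNReal.ofReal_mul (by norm_num), ← ENNReal.ofReal_rpow_of_nonneg Metric.diam_nonneg
      dh_pos.le, Metric.diam, ENNReal.ofReal_toReal hfin]
    norm_num
  intro h0
  have := hle Set.univ
  rw [h0, Measure.smul_apply, bernoulli_univ] at this
  simp at this

theorem lipschitzWith_φ {n : ℕ} (w : Word n) : LipschitzWith ((1 / 3) ^ n) (φ w) := by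
  refine LipschitzWith.of_dist_le_mul fun x y => ?_
  rw [dist_φ]; push_cast; rw [one_div_pow]; apply le_of_eq; ring

theorem antilipschitzWith_φ {n : ℕ} (w : Word n) : AntilipschitzWith (3 ^ n) (φ w) := by
  refine AntilipschitzWith.of_le_mul_dist fun x y => ?_
  rw [dist_φ]; push_cast; apply le_of_eq; field_simp

/-- The cover by the `5 ^ n` cells of level `n` has sum at most `5 ^ n * (2 / 3 ^ n) ^ dh = 2 ^ dh`,
whatever `n` is. -/
theorem hausdorffMeasure_ne_top : (μH[dh] (Set.univ : Set K)) ≠ ∞ := by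
  have h := Measure.hausdorffMeasure_le_liminf_sum (ι := fun n : ℕ => Word n) dh
    (Set.univ : Set K) (l := atTop) (fun n => ENNReal.ofReal (2 / 3 ^ n)) ?_
    (fun n w => cell w) ?_ ?_
  · refine ne_top_of_le_ne_top ?_ h
    have h5 : ∀ n : ℕ, ∑ w : Word n, Metric.ediam (cell w) ^ dh ≤ ENNReal.ofReal (2 ^ dh) := by
      intro n
      calc _ ≤ ∑ w : Word n, ENNReal.ofReal (2 / 3 ^ n) ^ dh := by
            refine Finset.sum_le_sum fun w _ => ENNReal.rpow_le_rpow ?_ dh_pos.le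
            refine Metric.ediam_le fun x hx y hy => ?_
            rw [edist_dist]
            exact ENNReal.ofReal_le_ofReal (dist_le_of_mem_cell hx hy)
        _ = _ := by
            rw [Finset.sum_const, Finset.card_univ, card_word, nsmul_eq_mul,
              ENNReal.ofReal_rpow_of_nonneg (by positivity) dh_pos.le, ← ENNReal.ofReal_natCast,
              ← ENNReal.ofReal_mul (by positivity), Real.div_rpow (by norm_num) (by positivity),
              three_pow_rpow_dh]
            congr 1; push_cast; field_simp
    refine ne_top_of_le_ne_top (b := ENNReal.ofReal (2 ^ dh)) ENNReal.ofReal_ne_top ?_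
    exact (liminf_le_liminf (Eventually.of_forall h5)).trans (by simp)
  · have : Tendsto (fun n : ℕ => (2 : ℝ) / 3 ^ n) atTop (𝓝 0) :=
      tendsto_const_nhds.div_atTop (tendsto_pow_atTop_atTop_of_one_lt (by norm_num))
    have h2 := (ENNReal.continuous_ofReal.tendsto _).comp this
    rwa [ENNReal.ofReal_zero] at h2
  · refine Eventually.of_forall fun n w => Metric.ediam_le fun x hx y hy => ?_
    rw [edist_dist]
    exact ENNReal.ofReal_le_ofReal (dist_le_of_mem_cell hx hy)
  · refine Eventually.of_forall fun n x _ => ?_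
    obtain ⟨w, hw⟩ := exists_mem_cell n x
    exact Set.mem_iUnion.2 ⟨w, hw⟩

instance : IsProbabilityMeasure μ := ⟨by
  rw [μ, Measure.smul_apply, smul_eq_mul]
  exact ENNReal.inv_mul_cancel hausdorffMeasure_ne_zero hausdorffMeasure_ne_top⟩

/-- `φ w` is a similarity: the Lipschitz and the antilipschitz bounds scale the Hausdorff measure by
the same factor `3 ^ (-n dh)`. -/
theorem μ_cell {n : ℕ} (w : Word n) : μ (cell w) = 5⁻¹ ^ n := by
  have e1 : (((1 / 3 : ℝ≥0) ^ n : ℝ≥0) : ℝ≥0∞) ^ dh = 5⁻¹ ^ n := by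
    rw [← ofReal_inv_five_pow, ← ENNReal.ofReal_coe_nnreal,
      ENNReal.ofReal_rpow_of_nonneg (by positivity) dh_pos.le]
    congr 1
    push_cast
    rw [one_div_pow, one_div_pow, Real.div_rpow (by norm_num) (by positivity),
      three_pow_rpow_dh, Real.one_rpow]
  have e2 : (((3 : ℝ≥0) ^ n : ℝ≥0) : ℝ≥0∞) ^ dh = 5 ^ n := by
    rw [← ENNReal.ofReal_coe_nnreal, ENNReal.ofReal_rpow_of_nonneg (by positivity) dh_pos.le]
    push_cast
    rw [three_pow_rpow_dh, ENNReal.ofReal_pow (by norm_num)]; norm_num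
  have h1 := (lipschitzWith_φ w).hausdorffMeasure_image_le dh_pos.le Set.univ
  have h2 := (antilipschitzWith_φ w).le_hausdorffMeasure_image dh_pos.le Set.univ
  rw [Set.image_univ, e1] at h1
  rw [Set.image_univ, e2] at h2
  have h3 : μH[dh] (cell w) = 5⁻¹ ^ n * μH[dh] (Set.univ : Set K) := by
    refine le_antisymm h1 ?_
    rw [← ENNReal.inv_pow, ENNReal.inv_mul_le_iff (by positivity) (by finiteness)]
    exact h2
  rw [μ, Measure.smul_apply, smul_eq_mul, h3, mul_left_comm,
    ENNReal.inv_mul_cancel hausdorffMeasure_ne_zero hausdorffMeasure_ne_top, mul_one]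

/-- The measure of a set of diameter `δ` is at most `125 δ^{d_h}`. -/
theorem μ_le {U : Set K} {δ : ℝ} (hδ : 0 < δ)
    (hU : ∀ x ∈ U, ∀ y ∈ U, dist x y ≤ δ) : μ U ≤ ENNReal.ofReal (125 * δ ^ dh) := by
  obtain ⟨n, S, hS, hS', hn⟩ := exists_cover hδ hU
  have h1 : U ⊆ ⋃ w ∈ S, cell w := fun x hx => by
    obtain ⟨w, hw⟩ := exists_mem_cell n x
    exact Set.mem_biUnion (hS' _ hx _ hw) hw
  calc _ ≤ ∑ w ∈ S, μ (cell w) := (measure_mono h1).trans (measure_biUnion_finset_le _ _)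
    _ = ∑ w ∈ S, (5⁻¹ : ℝ≥0∞) ^ n := Finset.sum_congr rfl fun w _ => μ_cell w
    _ = S.card * (5⁻¹ : ℝ≥0∞) ^ n := by rw [Finset.sum_const, nsmul_eq_mul]
    _ ≤ ENNReal.ofReal 25 * ENNReal.ofReal (5 * δ ^ dh) := by
        gcongr
        · rw [← ENNReal.ofReal_natCast]
          exact ENNReal.ofReal_le_ofReal (by exact_mod_cast hS)
        · rw [← ofReal_inv_five_pow]; exact ENNReal.ofReal_le_ofReal hn
    _ = _ := by rw [← ENNReal.ofReal_mul (by norm_num)]; congr 1; ring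

/-- Every point lies in at most `25` cells of a given level. -/
theorem sum_restrict_cell_le {n : ℕ} (S : Finset (Word n)) :
    ∑ a ∈ S, μ.restrict (cell a) ≤ (25 : ℝ≥0∞) • μ := by
  classical
  refine Measure.le_iff.2 fun s hs => ?_
  rw [Measure.finsetSum_apply]
  have h1 : ∀ a ∈ S, μ.restrict (cell a) s =
      ∫⁻ x in s, (cell a).indicator 1 x ∂μ := by
    intro a _
    rw [lintegral_indicator_one (measurableSet_cell a), Measure.restrict_apply hs,
      Measure.restrict_apply (measurableSet_cell a), Set.inter_comm]
  rw [Finset.sum_congr rfl h1, ← lintegral_finsetSum _ fun a _ =>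
    measurable_one.indicator (measurableSet_cell a)]
  calc _ ≤ ∫⁻ x in s, 25 ∂μ := by
        refine lintegral_mono fun x => ?_
        simp only [Set.indicator_apply, Pi.one_apply]
        rw [← Finset.sum_filter, Finset.sum_const, nsmul_eq_mul, mul_one]
        obtain ⟨a, ha⟩ := exists_mem_cell n x
        have := card_le_of_abs_pos_sub_le (S.filter fun b => x ∈ cell b) a fun b hb k =>
          abs_pos_sub_le ha (Finset.mem_filter.1 hb).2 (by rw [dist_self]; positivity) k
        exact_mod_cast this
    _ = _ := by simp [smul_eq_mul]

/-! ### Curves of finite length and quasiconvexity. -/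

theorem q_opp (i : Fin 5) : q (opp i) = -q i := by
  apply cx_injective
  funext k
  rw [cx_q, sgn_opp]
  have : cx (-q i) k = -cx (q i) k := by simp [cx]
  rw [this, cx_q]; push_cast; rfl

/-- The three thirds of a diagonal are its images under the maps of its two corners and of the
center. -/
theorem exists_smul_q_eq {i : Fin 5} {τ : ℝ} (hτ : |τ| ≤ 1) :
    ∃ j, ∃ τ' : ℝ, |τ'| ≤ 1 ∧ τ • q i = ψ j (τ' • q i) := by
  rw [abs_le] at hτ
  rcases le_or_gt τ (-(1 / 3)) with h1 | h1
  · refine ⟨opp i, 3 * τ + 2, abs_le.2 ⟨by linarith, by linarith⟩, ?_⟩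
    rw [ψ_eq, q_opp]; module
  rcases le_or_gt τ (1 / 3) with h2 | h2
  · refine ⟨4, 3 * τ, abs_le.2 ⟨by linarith, by linarith⟩, ?_⟩
    rw [ψ_eq, q_four]; module
  · refine ⟨i, 3 * τ - 2, abs_le.2 ⟨by linarith, by linarith⟩, ?_⟩
    rw [ψ_eq]; module

/-- The diagonals of the square are contained in the Vicsek set. -/
theorem smul_q_mem {i : Fin 5} {τ : ℝ} (hτ : |τ| ≤ 1) : τ • q i ∈ vicsekSet := by
  refine mem_vicsekSet_of_infDist fun n => ?_
  induction n generalizing τ with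
  | zero =>
    refine (Metric.infDist_le_dist_of_mem (q_mem 4)).trans ?_
    rw [q_four, dist_zero_right, norm_smul]
    simpa using mul_le_one₀ hτ (norm_nonneg _) (norm_q_le i)
  | succ n ih =>
    obtain ⟨j, τ', hτ', h⟩ := exists_smul_q_eq (i := i) hτ
    rw [h]
    refine (infDist_ψ_le _ _).trans ?_
    rw [pow_succ, ← div_div]
    have := ih hτ'
    gcongr

/-- The curve of unit speed from the center through the centers of the cells of levels
`1, …, n` of an address. -/
noncomputable def arc : ℕ → (ℕ → Fin 5) → ℝ → Plane
  | 0, _, _ => 0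
  | n + 1, σ, t => max 0 (min t (2 / 3)) • q (σ 0) +
      (1 / 3 : ℝ) • arc n (fun k => σ (k + 1)) (3 * t - 2)

theorem arc_of_nonpos (n : ℕ) (σ : ℕ → Fin 5) {t : ℝ} (ht : t ≤ 0) : arc n σ t = 0 := by
  induction n generalizing σ t with
  | zero => rfl
  | succ n ih =>
    rw [arc, ih _ (by linarith), max_eq_left (min_le_of_left_le ht)]
    simp

theorem arc_mem (n : ℕ) (σ : ℕ → Fin 5) (t : ℝ) : arc n σ t ∈ vicsekSet := by
  induction n generalizing σ t with
  | zero => rw [arc, ← q_four]; exact q_mem 4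
  | succ n ih =>
    rw [arc]
    rcases le_or_gt t (2 / 3) with h | h
    · rw [arc_of_nonpos _ _ (by linarith), smul_zero, add_zero]
      refine smul_q_mem ?_
      rw [abs_of_nonneg (le_max_left _ _)]
      exact max_le (by norm_num) ((min_le_right _ _).trans (by norm_num))
    · rw [min_eq_right h.le, max_eq_right (by norm_num), add_comm, ← ψ_eq]
      exact ψ_mem (ih _ _)

theorem dist_arc_le (n : ℕ) (σ : ℕ → Fin 5) {s t : ℝ} (hst : s ≤ t) :
    dist (arc n σ s) (arc n σ t) ≤ max t 0 - max s 0 := by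
  induction n generalizing σ s t with
  | zero => simpa [arc] using max_le_max_right 0 hst
  | succ n ih =>
    rw [arc, arc]
    refine (dist_add_add_le _ _ _ _).trans ?_
    have h1 : dist (max 0 (min s (2 / 3)) • q (σ 0)) (max 0 (min t (2 / 3)) • q (σ 0)) ≤
        max 0 (min t (2 / 3)) - max 0 (min s (2 / 3)) := by
      rw [dist_eq_norm, ← sub_smul, norm_smul, Real.norm_eq_abs, abs_sub_comm, abs_of_nonneg]
      · refine mul_le_of_le_one_right ?_ (norm_q_le _)
        rw [sub_nonneg]; gcongr
      · rw [sub_nonneg]; gcongr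
    have h2 : dist ((1 / 3 : ℝ) • arc n (fun k => σ (k + 1)) (3 * s - 2))
        ((1 / 3 : ℝ) • arc n (fun k => σ (k + 1)) (3 * t - 2)) ≤
        1 / 3 * (max (3 * t - 2) 0 - max (3 * s - 2) 0) := by
      rw [dist_smul₀, Real.norm_of_nonneg (by norm_num)]
      have := ih (fun k => σ (k + 1)) (s := 3 * s - 2) (t := 3 * t - 2) (by linarith)
      gcongr
    -- Time up to `2/3` is spent on the straight piece and the rest in the subcell, where a clock
    -- three times faster compensates the factor `1/3`.
    have key : ∀ u : ℝ, max 0 (min u (2 / 3)) + 1 / 3 * max (3 * u - 2) 0 = max u 0 := by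
      intro u
      rcases le_total u 0 with h | h
      · rw [min_eq_left (by linarith), max_eq_left h, max_eq_right (by linarith),
          max_eq_right h]; norm_num
      rcases le_total u (2 / 3) with h' | h'
      · rw [min_eq_left h', max_eq_right h, max_eq_right (by linarith), max_eq_left h]; norm_num
      · rw [min_eq_right h', max_eq_right (by norm_num), max_eq_left (by linarith),
          max_eq_left h]; ring
    have := key s
    have := key t
    linarith

theorem dist_arc_succ_le (n : ℕ) (σ : ℕ → Fin 5) (t : ℝ) :
    dist (arc n σ t) (arc (n + 1) σ t) ≤ 1 * (1 / 3) ^ n := by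
  induction n generalizing σ t with
  | zero =>
    simp only [arc, smul_zero, add_zero, dist_zero_left, norm_smul, pow_zero, mul_one]
    refine mul_le_one₀ ?_ (norm_nonneg _) (norm_q_le _)
    rw [Real.norm_of_nonneg (le_max_left _ _)]
    exact max_le (by norm_num) ((min_le_right _ _).trans (by norm_num))
  | succ n ih =>
    have h := ih (fun k => σ (k + 1)) (3 * t - 2)
    rw [arc, arc, dist_add_left, dist_smul₀, Real.norm_of_nonneg (by norm_num), pow_succ]
    linarith

theorem dist_arc_one_le (n : ℕ) (σ : ℕ → Fin 5) :
    dist (arc n σ 1) (addr σ) ≤ 1 * (1 / 3) ^ n := by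
  induction n generalizing σ with
  | zero => simpa [arc] using norm_addr_le σ
  | succ n ih =>
    have h := ih fun k => σ (k + 1)
    rw [arc, addr_eq, ψ_eq, add_comm, min_eq_right (by norm_num), max_eq_right (by norm_num),
      dist_add_right, dist_smul₀, Real.norm_of_nonneg (by norm_num), pow_succ]
    norm_num at h ⊢
    linarith

/-- `x` and `y` are joined in the Vicsek set by a `1`-Lipschitz curve parametrised by `[0, ℓ]`. -/
def Curve (ℓ : ℝ) (x y : K) : Prop :=
  ∃ γ : ℝ → K, (∀ s t, dist (γ s) (γ t) ≤ dist s t) ∧ γ 0 = x ∧ γ ℓ = y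

/-- The arcs of an address of `x` converge to a `1`-Lipschitz curve in the closed set `K`; the
successive lengths `2 / 3 ^ (k + 1)` add up to 1. -/
theorem curve_center (x : K) : Curve 1 (qK 4) x := by
  obtain ⟨σ, rfl⟩ := exists_addrK_eq x
  have hlim : ∀ t, ∃ z ∈ vicsekSet, Tendsto (fun n => arc n σ t) atTop (𝓝 z) := fun t =>
    cauchySeq_tendsto_of_isComplete isCompact_vicsekSet.isComplete (fun n => arc_mem n σ t)
      (cauchySeq_of_le_geometric (1 / 3) 1 (by norm_num) fun n => dist_arc_succ_le n σ t)
  choose z hz hz' using hlim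
  refine ⟨fun t => ⟨z t, hz t⟩, fun s t => ?_, Subtype.ext ?_, Subtype.ext ?_⟩
  · change dist (z s) (z t) ≤ _
    wlog hst : s ≤ t generalizing s t with H
    · rw [dist_comm, dist_comm s]; exact H _ _ (not_le.1 hst).le
    refine le_of_tendsto ((hz' s).dist (hz' t)) (Eventually.of_forall fun n => ?_)
    refine (dist_arc_le n σ hst).trans ?_
    rw [dist_comm, Real.dist_eq]
    exact (le_abs_self _).trans (abs_max_sub_max_le_abs _ _ _)
  · refine tendsto_nhds_unique (hz' 0) ?_
    simp only [arc_of_nonpos _ _ le_rfl]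
    change Tendsto _ _ (𝓝 (q 4))
    rw [q_four]
    exact tendsto_const_nhds
  · refine tendsto_nhds_unique (hz' 1) ?_
    rw [tendsto_iff_dist_tendsto_zero]
    have h0 : Tendsto (fun n : ℕ => 1 * (1 / 3 : ℝ) ^ n) atTop (𝓝 0) := by
      simpa using tendsto_pow_atTop_nhds_zero_of_lt_one (r := (1 / 3 : ℝ)) (by norm_num)
        (by norm_num)
    exact squeeze_zero (fun _ => dist_nonneg) (fun n => dist_arc_one_le n σ) h0

theorem Curve.refl (x : K) : Curve 0 x x := ⟨fun _ => x, fun _ _ => by simp, rfl, rfl⟩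

theorem Curve.symm {ℓ : ℝ} {x y : K} (h : Curve ℓ x y) : Curve ℓ y x := by
  obtain ⟨γ, h1, rfl, rfl⟩ := h
  exact ⟨fun t => γ (ℓ - t), fun s t => (h1 _ _).trans (by rw [dist_sub_left]), by simp, by simp⟩

theorem Curve.mono {ℓ ℓ' : ℝ} {x y : K} (h : Curve ℓ x y) (h0 : 0 ≤ ℓ) (hl : ℓ ≤ ℓ') :
    Curve ℓ' x y := by
  obtain ⟨γ, h1, rfl, rfl⟩ := h
  refine ⟨fun t => γ (min t ℓ), fun s t => (h1 _ _).trans ?_, ?_, ?_⟩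
  · rw [Real.dist_eq, Real.dist_eq]
    simpa using abs_min_sub_min_le_max s ℓ t ℓ
  · simp [min_eq_left h0]
  · simp [min_eq_right hl]

theorem Curve.trans {ℓ ℓ' : ℝ} {x y z : K} (h : Curve ℓ x y) (h' : Curve ℓ' y z)
    (h0 : 0 ≤ ℓ) (h0' : 0 ≤ ℓ') : Curve (ℓ + ℓ') x z := by
  obtain ⟨γ, h1, rfl, rfl⟩ := h
  obtain ⟨γ', h1', h2, rfl⟩ := h'
  refine ⟨fun t => if t ≤ ℓ then γ t else γ' (t - ℓ), fun s t => ?_, by simp [h0], ?_⟩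
  · wlog hst : s ≤ t generalizing s t with H
    · rw [dist_comm, dist_comm s]; exact H _ _ (not_le.1 hst).le
    by_cases hs : s ≤ ℓ <;> by_cases ht : t ≤ ℓ <;> simp only [hs, ht, if_true, if_false]
    · exact h1 _ _
    · refine (dist_triangle _ (γ ℓ) _).trans ?_
      have e1 := h1 s ℓ
      have e2 := h1' 0 (t - ℓ)
      rw [h2] at e2
      rw [Real.dist_eq, abs_of_nonpos (by linarith)] at e1 e2 ⊢
      linarith
    · linarith
    · simpa using h1' (s - ℓ) (t - ℓ)
  · rcases h0'.eq_or_lt with rfl | h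
    · simp [h2]
    · have h' : ¬ ℓ + ℓ' ≤ ℓ := by linarith
      simp [h']

theorem Curve.φ {ℓ : ℝ} {x y : K} (h : Curve ℓ x y) {n : ℕ} (w : Word n) :
    Curve (ℓ / 3 ^ n) (φ w x) (φ w y) := by
  obtain ⟨γ, h1, rfl, rfl⟩ := h
  refine ⟨fun t => Vicsek.φ w (γ (3 ^ n * t)), fun s t => ?_, by simp, ?_⟩
  · rw [dist_φ, div_le_iff₀ (by positivity)]
    refine (h1 _ _).trans ?_
    rw [Real.dist_eq, ← mul_sub, abs_mul, abs_of_pos (by positivity), Real.dist_eq, mul_comm]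
  · field_simp

theorem curve_of_mem_cell {n : ℕ} {a : Word n} {x y : K} (hx : x ∈ cell a) (hy : y ∈ cell a) :
    Curve (2 / 3 ^ n) x y := by
  obtain ⟨x, rfl⟩ := hx
  obtain ⟨y, rfl⟩ := hy
  have := (curve_center x).symm.trans (curve_center y) zero_le_one zero_le_one
  rw [one_add_one_eq_two] at this
  exact this.φ a

theorem curve_of_touch {n : ℕ} {a b : Word n} (h : Touch a b) {x y : K} (hx : x ∈ cell a)
    (hy : y ∈ cell b) : Curve (4 / 3 ^ n) x y := by
  obtain ⟨z, hz, hz'⟩ := h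
  have := (curve_of_mem_cell hx hz).trans (curve_of_mem_cell hz' hy) (by positivity)
    (by positivity)
  rwa [← add_div, show (2 + 2 : ℝ) = 4 by norm_num] at this

/-- The Vicsek set is quasiconvex. -/
theorem curve_dist (x y : K) : Curve (12 * dist x y) x y := by
  rcases (dist_nonneg (x := x) (y := y)).eq_or_lt with h | h
  · rw [← h, mul_zero, dist_eq_zero.1 h.symm]
    exact Curve.refl y
  rcases le_or_gt 1 (dist x y) with h1 | h1
  · have := curve_of_mem_cell (n := 0) (a := ()) (x := x) (y := y) ⟨x, rfl⟩ ⟨y, rfl⟩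
    exact this.mono (by positivity) (by simp only [pow_zero]; linarith)
  · obtain ⟨n, hn1, hn2⟩ := exists_scale h h1
    obtain ⟨a, ha⟩ := exists_mem_cell n x
    obtain ⟨b, hb⟩ := exists_mem_cell n y
    refine (curve_of_touch (touch_of_dist_lt ha hb hn2) ha hb).mono (by positivity) ?_
    rw [pow_succ, ← div_div] at hn1
    have : (4 : ℝ) / 3 ^ n = 4 * (1 / 3 ^ n) := by ring
    linarith

theorem Curve.geodesicDist_le {ℓ : ℝ} {x y : K} (h : Curve ℓ x y) (h0 : 0 ≤ ℓ) :
    geodesicDist x y ≤ ENNReal.ofReal ℓ := by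
  obtain ⟨γ, h1, h2, h3⟩ := h
  have hL : LipschitzWith (Real.toNNReal ℓ) fun t : unitInterval => γ (ℓ * t) := by
    refine LipschitzWith.of_dist_le_mul fun s t => (h1 _ _).trans ?_
    rw [Real.dist_eq, ← mul_sub, abs_mul, abs_of_nonneg h0, Real.coe_toNNReal _ h0,
      Subtype.dist_eq, Real.dist_eq]
  let p : Path x y :=
    { toFun := fun t => γ (ℓ * t)
      continuous_toFun := hL.continuous
      source' := by simpa using h2
      target' := by simpa using h3 }
  refine (iInf_le _ p).trans ?_
  have h4 := hL.lipschitzOnWith (s := Set.univ) |>.comp_eVariationOn_le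
    (g := id) (s := (Set.univ : Set unitInterval)) fun _ _ => Set.mem_univ _
  have h5 : eVariationOn (id : unitInterval → unitInterval) Set.univ ≤ 1 := by
    have h6 : eVariationOn (id : unitInterval → unitInterval) Set.univ =
        eVariationOn (fun t : unitInterval => (t : ℝ)) Set.univ := by
      unfold eVariationOn; rfl
    rw [h6]
    have h7 : MonotoneOn (fun t : unitInterval => (t : ℝ)) Set.univ := fun _ _ _ _ h => h
    have h8 := h7.eVariationOn_eq (a := 0) (b := 1) (Set.mem_univ _) (Set.mem_univ _)
    have h9 : (Set.univ : Set unitInterval) ∩ Set.Icc 0 1 = Set.univ := by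
      rw [Set.univ_inter]
      exact Set.eq_univ_of_forall fun t => ⟨unitInterval.nonneg', unitInterval.le_one'⟩
    rw [h9] at h8
    rw [h8]
    simp
  calc _ ≤ (Real.toNNReal ℓ : ℝ≥0∞) * eVariationOn (id : unitInterval → unitInterval) Set.univ := h4
    _ ≤ (Real.toNNReal ℓ : ℝ≥0∞) * 1 := by gcongr
    _ = _ := by rw [mul_one]; rfl

theorem edist_le_geodesicDist (x y : K) : edist x y ≤ geodesicDist x y := by
  refine le_iInf fun γ => ?_
  have := eVariationOn.edist_le γ (Set.mem_univ 0) (Set.mem_univ 1)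
  simpa using this

/-! ### The mass of geodesic and Euclidean balls. -/

open KorevaarSchoen

theorem ball_subset (x : K) (r : ℝ) : ball geodesicDist x r ⊆ Metric.ball x r := by
  intro y hy
  have := (edist_le_geodesicDist x y).trans_lt hy
  rw [edist_dist] at this
  rw [Metric.mem_ball']
  exact (ENNReal.ofReal_lt_ofReal_iff_of_nonneg dist_nonneg).1 this

theorem ofReal_le_μ_ball (x : K) {r : ℝ} (h0 : 0 < r) (h3 : r ≤ 3) :
    ENNReal.ofReal (r ^ dh / 125) ≤ μ (ball geodesicDist x r) := by
  obtain ⟨n, hn1, hn2⟩ := exists_scale (δ := r / 4) (by positivity) (by linarith)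
  obtain ⟨a, ha⟩ := exists_mem_cell (n + 1) x
  have h1 : cell a ⊆ ball geodesicDist x r := by
    intro y hy
    refine ((curve_of_mem_cell ha hy).geodesicDist_le (by positivity)).trans_lt ?_
    rw [ENNReal.ofReal_lt_ofReal_iff h0]
    have : (2 : ℝ) / 3 ^ (n + 1) = 2 * (1 / 3 ^ (n + 1)) := by ring
    linarith
  refine le_trans ?_ (measure_mono h1)
  rw [μ_cell, ← ofReal_inv_five_pow]
  refine ENNReal.ofReal_le_ofReal ?_
  -- The factor 4 would be enough; 9 is taken because `9 ^ dh = 25`.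
  have h4 : r ≤ 9 * (1 / 3 ^ n) := by
    have : (0 : ℝ) < 1 / 3 ^ n := by positivity
    linarith
  have h5 := Real.rpow_le_rpow h0.le h4 dh_pos.le
  have h9 : (9 : ℝ) ^ dh = 25 := by
    have := three_pow_rpow_dh 2
    norm_num at this ⊢
    exact this
  rw [Real.mul_rpow (by norm_num) (by positivity), Real.div_rpow (by norm_num) (by positivity),
    three_pow_rpow_dh, h9, Real.one_rpow] at h5
  rw [pow_succ, one_div_pow]
  linarith

theorem μ_ball_le (x : K) {r : ℝ} (h0 : 0 < r) :
    μ (Metric.ball x r) ≤ ENNReal.ofReal (625 * r ^ dh) := by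
  refine (μ_le (δ := 3 * r) (by positivity) fun y hy z hz => ?_).trans ?_
  · have := dist_triangle_right y z x
    rw [Metric.mem_ball] at hy hz
    linarith
  · rw [Real.mul_rpow (by norm_num) h0.le, three_rpow_dh]
    apply le_of_eq; congr 1; ring

/-! ### Chaining of oscillation integrals along cells. -/

/-- Convexity with weights `1 / (l + 1)` and `l / (l + 1)`. They suit `b` being itself a sum of `l`
terms: a factor `l ^ (p - 1)` lost there becomes `(l + 1) ^ (p - 1)`. -/
theorem rpow_add_le_of_pos {p l a b : ℝ} (hp : 1 ≤ p) (hl : 0 < l) (ha : 0 ≤ a) (hb : 0 ≤ b) :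
    (a + b) ^ p ≤ (l + 1) ^ (p - 1) * a ^ p + ((l + 1) / l) ^ (p - 1) * b ^ p := by
  have h := (And.right (convexOn_rpow hp)) (Set.mem_Ici.2 (by positivity : 0 ≤ (l + 1) * a))
    (Set.mem_Ici.2 (by positivity : 0 ≤ (l + 1) / l * b)) (by positivity : 0 ≤ 1 / (l + 1))
    (by positivity : 0 ≤ l / (l + 1)) (by field_simp; ring)
  simp only [smul_eq_mul] at h
  have e1 : 1 / (l + 1) * ((l + 1) * a) + l / (l + 1) * ((l + 1) / l * b) = a + b := by
    field_simp
  rw [e1, Real.mul_rpow (by positivity) ha, Real.mul_rpow (by positivity) hb] at h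
  refine h.trans (le_of_eq ?_)
  rw [Real.rpow_sub_one (by positivity), Real.rpow_sub_one (by positivity)]
  field_simp

/-- The integral of `|f y - f x| ^ p` over a product set. -/
noncomputable def J (p : ℝ) (f : K → ℝ) (A B : Set K) : ℝ≥0∞ :=
  ∫⁻ x in A, ∫⁻ y in B, ENNReal.ofReal (|f y - f x| ^ p) ∂μ ∂μ

/-- The integral of `|f y - f x| ^ p` over the pairs at distance less than `r`. -/
noncomputable def H (p : ℝ) (f : K → ℝ) (r : ℝ) : ℝ≥0∞ :=
  ∫⁻ x, ∫⁻ y in Metric.ball x r, ENNReal.ofReal (|f y - f x| ^ p) ∂μ ∂μ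

section

variable {p : ℝ} {f : K → ℝ}

theorem measurable_diff (hf : Measurable f) :
    Measurable fun z : K × K => ENNReal.ofReal (|f z.2 - f z.1| ^ p) := by
  have h1 : Measurable fun z : K × K => f z.2 - f z.1 :=
    (hf.comp measurable_snd).sub (hf.comp measurable_fst)
  exact ENNReal.measurable_ofReal.comp ((measurable_norm.comp h1).pow_const p)

theorem measurable_diff_right (hf : Measurable f) (x : K) :
    Measurable fun y => ENNReal.ofReal (|f y - f x| ^ p) := by
  have h1 : Measurable fun y => f y - f x := hf.sub_const _
  exact ENNReal.measurable_ofReal.comp ((measurable_norm.comp h1).pow_const p)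

theorem measurable_diff_left (hf : Measurable f) (y : K) :
    Measurable fun x => ENNReal.ofReal (|f y - f x| ^ p) := by
  have h1 : Measurable fun x => f y - f x := hf.const_sub _
  exact ENNReal.measurable_ofReal.comp ((measurable_norm.comp h1).pow_const p)

theorem measurable_inner (hf : Measurable f) (B : Set K) :
    Measurable fun x => ∫⁻ y in B, ENNReal.ofReal (|f y - f x| ^ p) ∂μ :=
  (measurable_diff hf).lintegral_prod_right'

theorem J_comm (hf : Measurable f) (A B : Set K) : J p f A B = J p f B A := by
  unfold J
  rw [lintegral_lintegral_swap (measurable_diff hf).aemeasurable]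
  simp only [abs_sub_comm]

/-- The pointwise inequality is integrated over the intermediate point `z ∈ C`, so no point value of
the merely measurable `f` is singled out. -/
theorem mul_J_le_of_le (hf : Measurable f) (A B C : Set K) {τ₁ τ₂ : ℝ≥0∞}
    (hpt : ∀ x y z, ENNReal.ofReal (|f y - f x| ^ p) ≤
      τ₁ * ENNReal.ofReal (|f z - f x| ^ p) + τ₂ * ENNReal.ofReal (|f y - f z| ^ p)) :
    μ C * J p f A B ≤ τ₁ * (μ B * J p f A C) + τ₂ * (μ A * J p f C B) := by
  have hm1 : ∀ x, Measurable fun y => ENNReal.ofReal (|f y - f x| ^ p) := fun x =>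
    measurable_diff_right hf x
  have hm2 : ∀ y, Measurable fun x => ENNReal.ofReal (|f y - f x| ^ p) := fun y =>
    measurable_diff_left hf y
  have h1 : ∀ x y, μ C * ENNReal.ofReal (|f y - f x| ^ p) ≤
      τ₁ * (∫⁻ z in C, ENNReal.ofReal (|f z - f x| ^ p) ∂μ) +
      τ₂ * ∫⁻ z in C, ENNReal.ofReal (|f y - f z| ^ p) ∂μ := by
    intro x y
    rw [← lintegral_const_mul _ (hm1 x), ← lintegral_const_mul _ (hm2 y),
      ← lintegral_add_left ((hm1 x).const_mul _)]
    refine le_trans (le_of_eq ?_) (lintegral_mono fun z => hpt x y z)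
    rw [lintegral_const, Measure.restrict_apply_univ, mul_comm]
  have hm3 : Measurable fun y => ∫⁻ z in C, ENNReal.ofReal (|f y - f z| ^ p) ∂μ := by
    simpa only [abs_sub_comm] using measurable_inner (p := p) hf C
  have h2 : ∀ x, μ C * ∫⁻ y in B, ENNReal.ofReal (|f y - f x| ^ p) ∂μ ≤
      τ₁ * (μ B * ∫⁻ z in C, ENNReal.ofReal (|f z - f x| ^ p) ∂μ) + τ₂ * J p f C B := by
    intro x
    rw [← lintegral_const_mul _ (hm1 x)]
    refine (lintegral_mono fun y => h1 x y).trans (le_of_eq ?_)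
    rw [lintegral_add_left measurable_const, lintegral_const, Measure.restrict_apply_univ,
      lintegral_const_mul _ hm3, mul_assoc, mul_comm (∫⁻ z in C, _ ∂μ) (μ B)]
    congr 2
    rw [J_comm hf]
    unfold J
    simp only [abs_sub_comm]
  have h3 : μ C * J p f A B = ∫⁻ x in A, μ C * ∫⁻ y in B, ENNReal.ofReal (|f y - f x| ^ p) ∂μ ∂μ :=
    (lintegral_const_mul _ (measurable_inner hf B)).symm
  have h4 : μ B * J p f A C = ∫⁻ x in A, μ B * ∫⁻ z in C, ENNReal.ofReal (|f z - f x| ^ p) ∂μ ∂μ :=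
    (lintegral_const_mul _ (measurable_inner hf C)).symm
  rw [h3, h4, ← lintegral_const_mul _ ((measurable_inner hf C).const_mul _)]
  refine (lintegral_mono fun x => h2 x).trans (le_of_eq ?_)
  rw [lintegral_add_right _ measurable_const, lintegral_const, Measure.restrict_apply_univ,
    mul_assoc τ₂, mul_comm _ (μ A)]

theorem mul_J_le (hp : 1 ≤ p) (hf : Measurable f) {l : ℝ} (hl : 0 < l) (A B C : Set K) :
    μ C * J p f A B ≤ ENNReal.ofReal ((l + 1) ^ (p - 1)) * (μ B * J p f A C) +
      ENNReal.ofReal (((l + 1) / l) ^ (p - 1)) * (μ A * J p f C B) := by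
  refine mul_J_le_of_le hf A B C fun x y z => ?_
  rw [← ENNReal.ofReal_mul (by positivity), ← ENNReal.ofReal_mul (by positivity),
    ← ENNReal.ofReal_add (by positivity) (by positivity)]
  refine ENNReal.ofReal_le_ofReal (le_trans ?_ (rpow_add_le_of_pos hp hl (abs_nonneg (f z - f x))
    (abs_nonneg (f y - f z))))
  refine Real.rpow_le_rpow (abs_nonneg _) ?_ (by linarith)
  have := abs_add_le (f z - f x) (f y - f z)
  simpa using this

theorem J_cell_le (hp : 1 ≤ p) (hf : Measurable f) {l : ℝ} (hl : 0 < l) {n : ℕ}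
    (a b c : Word n) :
    J p f (cell a) (cell b) ≤ ENNReal.ofReal ((l + 1) ^ (p - 1)) * J p f (cell a) (cell c) +
      ENNReal.ofReal (((l + 1) / l) ^ (p - 1)) * J p f (cell c) (cell b) := by
  have h := mul_J_le hp hf hl (cell a) (cell b) (cell c)
  simp only [μ_cell] at h
  have h5 : (5⁻¹ : ℝ≥0∞) ^ n ≠ 0 := pow_ne_zero _ (by simp)
  have h5' : (5⁻¹ : ℝ≥0∞) ^ n ≠ ∞ := by finiteness
  rw [mul_left_comm, mul_left_comm (ENNReal.ofReal _) _ (J p f (cell c) (cell b)), ← mul_add,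
    ENNReal.mul_le_mul_iff_right h5 h5'] at h
  exact h

/-- The graph of the cells of level `n`, in which cells that touch are joined. -/
def touchGraph (n : ℕ) : SimpleGraph (Word n) := SimpleGraph.fromRel Touch

theorem touch_of_adj {n : ℕ} {a b : Word n} (h : (touchGraph n).Adj a b) : Touch a b := by
  rw [touchGraph, SimpleGraph.fromRel_adj] at h
  exact h.2.elim id Touch.symm

/-- Adding one cell at a time with weights adapted to the number of remaining terms gives the sharp
power of the length. Constant weights would give an exponential loss. -/
theorem J_le_of_walk (hp : 1 ≤ p) (hf : Measurable f) {n : ℕ} {a b : Word n}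
    (w : (touchGraph n).Walk a b) :
    J p f (cell a) (cell b) ≤ ENNReal.ofReal (((w.length : ℝ) + 1) ^ (p - 1)) *
      ((w.darts.map fun d => J p f (cell d.fst) (cell d.snd)).sum + J p f (cell b) (cell b)) := by
  induction w with
  | nil => simp
  | @cons a c b h w ih =>
    set l : ℝ := (w.length : ℝ) + 1 with hl
    have hl0 : 0 < l := by positivity
    refine (J_cell_le hp hf hl0 a b c).trans ?_
    rw [SimpleGraph.Walk.length_cons, SimpleGraph.Walk.darts_cons, List.map_cons, List.sum_cons]
    push_cast
    rw [← hl, add_assoc (J p f (cell a) (cell c)), mul_add]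
    refine add_le_add le_rfl ?_
    refine (mul_le_mul_right ih _).trans ?_
    rw [← mul_assoc, ← ENNReal.ofReal_mul (by positivity), ← Real.mul_rpow (by positivity)
      (by positivity), div_mul_cancel₀ _ hl0.ne']

theorem exists_walk_of_seq {n : ℕ} (c : ℕ → Word n) (h : ∀ i, Touch (c i) (c (i + 1))) (N : ℕ) :
    ∃ w : (touchGraph n).Walk (c 0) (c N), w.length ≤ N ∧ ∀ v ∈ w.support, ∃ i ≤ N, v = c i := by
  induction N with
  | zero => exact ⟨.nil, le_rfl, fun v hv => ⟨0, le_rfl, by simpa using hv⟩⟩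
  | succ N ih =>
    obtain ⟨w, h1, h2⟩ := ih
    by_cases hc : c N = c (N + 1)
    · rw [← hc]
      exact ⟨w, by omega, fun v hv => by
        obtain ⟨i, hi, h⟩ := h2 v hv
        exact ⟨i, by omega, h⟩⟩
    · have hadj : (touchGraph n).Adj (c N) (c (N + 1)) := by
        rw [touchGraph, SimpleGraph.fromRel_adj]
        exact ⟨hc, Or.inl (h N)⟩
      refine ⟨w.concat hadj, by simpa using h1, fun v hv => ?_⟩
      rw [SimpleGraph.Walk.support_concat, List.mem_append, List.mem_singleton] at hv
      rcases hv with hv | rfl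
      · obtain ⟨i, hi, h⟩ := h2 v hv
        exact ⟨i, by omega, h⟩
      · exact ⟨N + 1, le_rfl, rfl⟩

/-- The curve is sampled at `N > ℓ 3 ^ n` equal steps; consecutive samples are closer than `3⁻ⁿ`, so
their cells touch. -/
theorem exists_walk_of_curve {n : ℕ} {ℓ : ℝ} (hℓ : 0 ≤ ℓ) {x y : K} (h : Curve ℓ x y)
    {a b : Word n} (ha : x ∈ cell a) (hb : y ∈ cell b) :
    ∃ w : (touchGraph n).Walk a b, (w.length : ℝ) ≤ ℓ * 3 ^ n + 1 ∧
      ∀ v ∈ w.support, ∃ z ∈ cell v, dist x z ≤ ℓ := by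
  obtain ⟨γ, h1, rfl, rfl⟩ := h
  set N : ℕ := ⌊ℓ * 3 ^ n⌋₊ + 1 with hN
  have hN0 : (0 : ℝ) < N := by rw [hN]; positivity
  have hNl : ℓ * 3 ^ n < N := by rw [hN]; push_cast; exact Nat.lt_floor_add_one _
  have hNu : (N : ℝ) ≤ ℓ * 3 ^ n + 1 := by
    rw [hN]; push_cast
    have := Nat.floor_le (a := ℓ * 3 ^ n) (by positivity)
    linarith
  -- A point can lie in several cells, so the cells at both ends are imposed.
  have hstep : ∀ i : ℕ, ∃ c : Word n, γ (ℓ * i / N) ∈ cell c ∧ (i = 0 → c = a) ∧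
      (i = N → c = b) := by
    intro i
    by_cases hi : i = 0
    · subst hi
      exact ⟨a, by simpa using ha, fun _ => rfl, fun h => by omega⟩
    by_cases hi' : i = N
    · subst hi'
      refine ⟨b, ?_, fun h => absurd h hi, fun _ => rfl⟩
      rwa [mul_div_assoc, div_self hN0.ne', mul_one]
    · obtain ⟨c, hc⟩ := exists_mem_cell n (γ (ℓ * i / N))
      exact ⟨c, hc, fun h => absurd h hi, fun h => absurd h hi'⟩
  choose c hc hc0 hcN using hstep
  have htouch : ∀ i, Touch (c i) (c (i + 1)) := fun i => by
    refine touch_of_dist_lt (hc i) (hc (i + 1)) ((h1 _ _).trans_lt ?_)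
    rw [Real.dist_eq, ← sub_div, ← mul_sub, abs_div, abs_mul, abs_of_nonneg hℓ,
      abs_of_pos hN0, div_lt_div_iff₀ hN0 (by positivity)]
    push_cast
    simpa using hNl
  obtain ⟨w, hw1, hw2⟩ := exists_walk_of_seq c htouch N
  rw [← hc0 0 rfl, ← hcN N rfl]
  refine ⟨w, le_trans (by exact_mod_cast hw1) hNu, fun v hv => ?_⟩
  obtain ⟨i, hi, rfl⟩ := hw2 v hv
  refine ⟨_, hc i, (h1 _ _).trans ?_⟩
  rw [Real.dist_eq, zero_sub, abs_neg, abs_of_nonneg (by positivity), div_le_iff₀ hN0]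
  have : (i : ℝ) ≤ N := by exact_mod_cast hi
  gcongr

/-- The center of a cell. -/
noncomputable def ctr {n : ℕ} (a : Word n) : K := φ a (qK 4)

theorem ctr_mem {n : ℕ} (a : Word n) : ctr a ∈ cell a := φ_mem_cell a _

open Classical in
/-- Pairs of touching cells, the first of which is at distance at most `17 r` from `a` and `b`. -/
noncomputable def touchNear {m : ℕ} (r : ℝ) (a b : Word m) : Finset (Word m × Word m) :=
  Finset.univ.filter fun e => Touch e.1 e.2 ∧ dist (ctr a) (ctr e.1) ≤ 17 * r ∧
    dist (ctr b) (ctr e.1) ≤ 17 * r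

open Classical in
/-- Chaining along a curve controls the oscillation between two cells at distance `r` by the
oscillation between touching cells. -/
theorem J_le_sum_touchNear (hp : 1 ≤ p) (hf : Measurable f) {m : ℕ} {r : ℝ}
    (hr : 1 / 3 ^ m ≤ r) {a b : Word m} {x y : K} (hx : x ∈ cell a) (hy : y ∈ cell b)
    (hxy : dist x y ≤ r) :
    J p f (cell a) (cell b) ≤ ENNReal.ofReal (2 * (14 * (r * 3 ^ m)) ^ (p - 1)) *
      ∑ e ∈ touchNear r a b, J p f (cell e.1) (cell e.2) := by
  have h3 : (0 : ℝ) < 3 ^ m := by positivity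
  have hr0 : 0 < r := lt_of_lt_of_le (by positivity) hr
  have hr1 : 1 ≤ r * 3 ^ m := (div_le_iff₀ h3).1 hr
  have hcell : (2 : ℝ) / 3 ^ m ≤ 2 * r := by
    have : (2 : ℝ) / 3 ^ m = 2 * (1 / 3 ^ m) := by ring
    linarith
  obtain ⟨w, hw1, hw2⟩ := exists_walk_of_curve (by positivity)
    ((curve_dist x y).mono (ℓ' := 12 * r) (by positivity) (by linarith)) hx hy
  -- On a path no dart is repeated, so a sum along it is at most a sum over a set of pairs.
  have hpath := w.bypass_isPath
  have hlen : ((w.bypass.length : ℝ) + 1) ≤ 14 * (r * 3 ^ m) := by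
    have : (w.bypass.length : ℝ) ≤ w.length := by exact_mod_cast w.length_bypass_le_length
    nlinarith
  -- The 17 is `12` for the curve, `1` for the passage from `y` to `x`, and `2 + 2` for two cell
  -- diameters.
  have hsupp : ∀ v ∈ w.bypass.support, dist (ctr a) (ctr v) ≤ 17 * r ∧
      dist (ctr b) (ctr v) ≤ 17 * r := by
    intro v hv
    obtain ⟨z, hz, hxz⟩ := hw2 v (w.support_bypass_subset_support hv)
    have d1 := dist_le_of_mem_cell (ctr_mem a) hx
    have d2 := dist_le_of_mem_cell hz (ctr_mem v)
    have d3 := dist_le_of_mem_cell (ctr_mem b) hy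
    have t1 := dist_triangle4 (ctr a) x z (ctr v)
    have t2 := dist_triangle4 (ctr b) y z (ctr v)
    have t3 := dist_triangle y x z
    rw [dist_comm y x] at t3
    constructor <;> linarith
  have hsum : (w.bypass.darts.map fun d => J p f (cell d.fst) (cell d.snd)).sum ≤
      ∑ e ∈ touchNear r a b, J p f (cell e.1) (cell e.2) := by
    have hnd := SimpleGraph.Walk.darts_nodup_of_support_nodup hpath.support_nodup
    have e1 : (w.bypass.darts.map fun d => J p f (cell d.fst) (cell d.snd)).sum =
        ∑ d ∈ w.bypass.darts.toFinset, J p f (cell d.fst) (cell d.snd) :=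
      (List.sum_toFinset _ hnd).symm
    rw [e1, ← Finset.sum_image (s := w.bypass.darts.toFinset) (g := fun d => (d.fst, d.snd))
      (f := fun e : Word m × Word m => J p f (cell e.1) (cell e.2))]
    · refine Finset.sum_le_sum_of_subset fun e he => ?_
      obtain ⟨d, hd, rfl⟩ := Finset.mem_image.1 he
      rw [List.mem_toFinset] at hd
      have := hsupp d.fst (w.bypass.dart_fst_mem_support_of_mem_darts hd)
      exact Finset.mem_filter.2 ⟨Finset.mem_univ _, touch_of_adj d.adj, this.1, this.2⟩
    · intro d _ d' _ h
      exact SimpleGraph.Dart.ext _ _ h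
  -- A cell touches itself, so the final term of `J_le_of_walk` is absorbed at the price of the
  -- factor 2.
  have hbb : J p f (cell b) (cell b) ≤ ∑ e ∈ touchNear r a b, J p f (cell e.1) (cell e.2) := by
    have := hsupp b w.bypass.end_mem_support
    exact Finset.single_le_sum (f := fun e : Word m × Word m => J p f (cell e.1) (cell e.2))
      (fun _ _ => zero_le) (Finset.mem_filter.2
        ⟨Finset.mem_univ (b, b), Touch.refl b, this.1, this.2⟩)
  refine (J_le_of_walk hp hf w.bypass).trans ?_
  calc _ ≤ ENNReal.ofReal ((14 * (r * 3 ^ m)) ^ (p - 1)) *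
        (∑ e ∈ touchNear r a b, J p f (cell e.1) (cell e.2) +
          ∑ e ∈ touchNear r a b, J p f (cell e.1) (cell e.2)) := by
        gcongr
    _ = _ := by
        rw [← two_mul, ← mul_assoc, ENNReal.ofReal_mul (by norm_num), ENNReal.ofReal_ofNat]
        ring

open Classical in
/-- The number of cells of level `m` at distance comparable to `r` from a point. -/
theorem card_near_le {m : ℕ} {r : ℝ} (hr : 1 / 3 ^ m ≤ r) (z : K) :
    ((Finset.univ.filter fun a : Word m => dist (ctr a) z ≤ 17 * r).card : ℝ≥0∞) ≤
      ENNReal.ofReal (5 ^ 9 * (r * 3 ^ m) ^ dh) := by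
  set S := Finset.univ.filter fun a : Word m => dist (ctr a) z ≤ 17 * r with hS
  have hr0 : 0 < r := lt_of_lt_of_le (by positivity) hr
  -- These cells lie within `19 r` of `z`; the radius `27 r` is taken because `27 ^ dh = 125`.
  have h1 : (S.card : ℝ≥0∞) * 5⁻¹ ^ m ≤ 25 * μ (Metric.ball z (27 * r)) := by
    have h2 := sum_restrict_cell_le S (Metric.ball z (27 * r))
    rw [Measure.finsetSum_apply] at h2
    refine le_trans (le_of_eq ?_) h2
    rw [← nsmul_eq_mul, ← Finset.sum_const]
    refine Finset.sum_congr rfl fun a ha => ?_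
    rw [Measure.restrict_apply Metric.isOpen_ball.measurableSet, Set.inter_eq_right.2, μ_cell]
    intro y hy
    have h3 := dist_le_of_mem_cell hy (ctr_mem a)
    have h4 := (Finset.mem_filter.1 ha).2
    have h5 := dist_triangle y (ctr a) z
    have : (2 : ℝ) / 3 ^ m = 2 * (1 / 3 ^ m) := by ring
    rw [Metric.mem_ball]
    linarith
  have h2 := h1.trans (mul_le_mul_right (μ_ball_le z (by positivity : 0 < 27 * r)) 25)
  have h27 : (27 : ℝ) ^ dh = 125 := by
    have := three_pow_rpow_dh 3
    norm_num at this ⊢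
    exact this
  rw [← ENNReal.inv_pow, ← div_eq_mul_inv, ENNReal.div_le_iff_le_mul (by simp) (by simp)] at h2
  refine h2.trans (le_of_eq ?_)
  have e5 : (5 : ℝ≥0∞) ^ m = ENNReal.ofReal (5 ^ m) := by
    rw [ENNReal.ofReal_pow (by norm_num)]; norm_num
  have e25 : (25 : ℝ≥0∞) = ENNReal.ofReal 25 := by norm_num
  rw [e5, e25, ← ENNReal.ofReal_mul (by norm_num), ← ENNReal.ofReal_mul (by positivity),
    Real.mul_rpow (by norm_num) hr0.le, Real.mul_rpow hr0.le (by positivity), three_pow_rpow_dh,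
    h27]
  congr 1; ring

/-! ### Comparison of the energies at different scales. -/

open Classical in
/-- The oscillation between touching cells of level `m`. -/
noncomputable def touchSum (p : ℝ) (f : K → ℝ) (m : ℕ) : ℝ≥0∞ :=
  ∑ e : Word m × Word m with Touch e.1 e.2, J p f (cell e.1) (cell e.2)

theorem restrict_biUnion_finset_le {ι : Type*} (S : Finset ι) (B : ι → Set K) :
    μ.restrict (⋃ b ∈ S, B b) ≤ ∑ b ∈ S, μ.restrict (B b) := by
  classical
  induction S using Finset.induction_on with
  | empty => simp
  | insert a S ha ih =>
    rw [Finset.set_biUnion_insert, Finset.sum_insert ha]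
    exact (Measure.restrict_union_le _ _).trans (by gcongr)

theorem measure_le_sum_restrict (m : ℕ) : μ ≤ ∑ a : Word m, μ.restrict (cell a) := by
  have h := restrict_biUnion_finset_le Finset.univ fun a : Word m => cell a
  have e : (⋃ b ∈ (Finset.univ : Finset (Word m)), cell b) = Set.univ := by
    refine Set.eq_univ_of_forall fun x => ?_
    obtain ⟨w, hw⟩ := exists_mem_cell m x
    exact Set.mem_biUnion (Finset.mem_univ w) hw
  rwa [e, Measure.restrict_univ] at h

open Classical in
theorem H_le_sum (hf : Measurable f) (m : ℕ) (r : ℝ) :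
    H p f r ≤ ∑ e : Word m × Word m with ∃ x ∈ cell e.1, ∃ y ∈ cell e.2, dist x y < r,
      J p f (cell e.1) (cell e.2) := by
  have hpt : ∀ a : Word m, ∀ x ∈ cell a,
      ∫⁻ y in Metric.ball x r, ENNReal.ofReal (|f y - f x| ^ p) ∂μ ≤
      ∑ b : Word m with ∃ x ∈ cell a, ∃ y ∈ cell b, dist x y < r,
        ∫⁻ y in cell b, ENNReal.ofReal (|f y - f x| ^ p) ∂μ := by
    intro a x hx
    rw [← lintegral_finsetSum_measure]
    refine lintegral_mono' ?_ le_rfl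
    refine le_trans (Measure.restrict_mono ?_ le_rfl) (restrict_biUnion_finset_le _ _)
    intro y hy
    obtain ⟨b, hb⟩ := exists_mem_cell m y
    exact Set.mem_biUnion (Finset.mem_coe.2 (Finset.mem_filter.2 ⟨Finset.mem_univ _, x, hx, y, hb,
      Metric.mem_ball'.1 hy⟩)) hb
  calc H p f r ≤ ∑ a : Word m, ∫⁻ x in cell a,
        ∫⁻ y in Metric.ball x r, ENNReal.ofReal (|f y - f x| ^ p) ∂μ ∂μ := by
        rw [← lintegral_finsetSum_measure]
        exact lintegral_mono' (measure_le_sum_restrict m) le_rfl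
    _ ≤ ∑ a : Word m, ∑ b : Word m with ∃ x ∈ cell a, ∃ y ∈ cell b, dist x y < r,
        J p f (cell a) (cell b) := by
        refine Finset.sum_le_sum fun a _ => ?_
        refine (setLIntegral_mono' (measurableSet_cell a) (hpt a)).trans (le_of_eq ?_)
        rw [lintegral_finsetSum _ fun b _ => measurable_inner hf _]
        rfl
    _ = _ := by
        simp only [Finset.sum_filter]
        rw [← Finset.univ_product_univ, Finset.sum_product]

/-- The exponent `2 d_h + p - 1` of the radius in the normalisation of the energy. -/
noncomputable def θ (p : ℝ) : ℝ := 2 * dh + (p - 1)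

theorem θ_pos (hp : 1 ≤ p) : 0 < θ p := by
  have := dh_pos
  unfold θ; linarith

theorem θ_eq (hp : 1 ≤ p) : θ p = dh + p * αExp p := by
  unfold θ αExp
  have : p ≠ 0 := by positivity
  field_simp; ring

-- Double counting: after chaining, a given touching pair occurs for at most `D * D` pairs of cells,
-- `D` being the number of cells within `17 r` of it. The chaining cost `(r 3 ^ m) ^ (p - 1)` and
-- the factor `(r 3 ^ m) ^ (2 dh)` from `D * D` make up `θ p`.
open Classical in
theorem H_le_touchSum (hp : 1 ≤ p) (hf : Measurable f) {m : ℕ} {r : ℝ} (hr : 1 / 3 ^ m ≤ r) :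
    H p f r ≤ ENNReal.ofReal (2 * 14 ^ (p - 1) * 5 ^ 18 * (r * 3 ^ m) ^ θ p) *
      touchSum p f m := by
  have hr0 : 0 < r := lt_of_lt_of_le (by positivity) hr
  set L := ENNReal.ofReal (2 * (14 * (r * 3 ^ m)) ^ (p - 1)) with hL
  set D := ENNReal.ofReal (5 ^ 9 * (r * 3 ^ m) ^ dh) with hD
  calc H p f r ≤ _ := H_le_sum hf m r
    _ ≤ ∑ e : Word m × Word m with ∃ x ∈ cell e.1, ∃ y ∈ cell e.2, dist x y < r,
        L * ∑ e' ∈ touchNear r e.1 e.2, J p f (cell e'.1) (cell e'.2) := by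
        refine Finset.sum_le_sum fun e he => ?_
        obtain ⟨x, hx, y, hy, hxy⟩ := (Finset.mem_filter.1 he).2
        exact J_le_sum_touchNear hp hf hr hx hy hxy.le
    _ ≤ ∑ e : Word m × Word m, L * ∑ e' ∈ touchNear r e.1 e.2, J p f (cell e'.1) (cell e'.2) :=
        Finset.sum_le_sum_of_subset (Finset.filter_subset _ _)
    _ = L * ∑ e' : Word m × Word m with Touch e'.1 e'.2,
        ∑ e : Word m × Word m with dist (ctr e.1) (ctr e'.1) ≤ 17 * r ∧
          dist (ctr e.2) (ctr e'.1) ≤ 17 * r, J p f (cell e'.1) (cell e'.2) := by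
        rw [← Finset.mul_sum]
        congr 1
        refine Finset.sum_comm' fun e e' => ?_
        simp only [touchNear, Finset.mem_filter, Finset.mem_univ, true_and]
        tauto
    _ ≤ L * ∑ e' : Word m × Word m with Touch e'.1 e'.2, D * D * J p f (cell e'.1) (cell e'.2) := by
        gcongr with e' he'
        rw [Finset.sum_const, nsmul_eq_mul]
        gcongr
        have hc := card_near_le hr (ctr e'.1)
        have hprod : (Finset.univ.filter fun e : Word m × Word m =>
            dist (ctr e.1) (ctr e'.1) ≤ 17 * r ∧ dist (ctr e.2) (ctr e'.1) ≤ 17 * r) =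
            (Finset.univ.filter fun a : Word m => dist (ctr a) (ctr e'.1) ≤ 17 * r) ×ˢ
            (Finset.univ.filter fun a : Word m => dist (ctr a) (ctr e'.1) ≤ 17 * r) := by
          ext e; simp
        rw [hprod, Finset.card_product]
        push_cast
        gcongr
    _ = _ := by
        rw [← Finset.mul_sum, ← mul_assoc]
        unfold touchSum
        congr 1
        rw [hL, hD, ← ENNReal.ofReal_mul (by positivity), ← ENNReal.ofReal_mul (by positivity)]
        congr 1
        have e : (r * 3 ^ m) ^ θ p = (r * 3 ^ m) ^ (p - 1) * ((r * 3 ^ m) ^ dh * (r * 3 ^ m) ^ dh) := by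
          rw [← Real.rpow_add (by positivity), ← Real.rpow_add (by positivity)]
          congr 1; unfold θ; ring
        rw [e, Real.mul_rpow (by norm_num) (by positivity)]
        ring

-- Touching cells span geodesic distance at most `4 / 3 ^ m`, so each lies in the ball of radius `s`
-- about any point of the other. The constant is 25 neighbours, times 25 for overlaps, times 625 for
-- the mass of a ball.
open Classical in
theorem touchSum_le_energy (hp : 1 ≤ p) (hf : Measurable f) {m : ℕ} {s : ℝ}
    (hs : 5 / 3 ^ m ≤ s) :
    touchSum p f m ≤ ENNReal.ofReal (5 ^ 8 * s ^ θ p) *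
      energy geodesicDist μ p (αExp p) f s := by
  have hs0 : 0 < s := lt_of_lt_of_le (by positivity) hs
  set G : K → ℝ≥0∞ := fun x =>
    ∫⁻ y in ball geodesicDist x s, ENNReal.ofReal (|f y - f x| ^ p) ∂μ with hG
  have hsub : ∀ a b : Word m, Touch a b → ∀ x ∈ cell a, cell b ⊆ ball geodesicDist x s := by
    intro a b hab x hx y hy
    refine ((curve_of_touch hab hx hy).geodesicDist_le (by positivity)).trans_lt ?_
    rw [ENNReal.ofReal_lt_ofReal_iff hs0]
    refine lt_of_lt_of_le ?_ hs
    gcongr; norm_num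
  have hGle : ∀ x, G x ≤ ENNReal.ofReal (625 * s ^ θ p) * ((μ (ball geodesicDist x s))⁻¹ *
      ∫⁻ y in ball geodesicDist x s, ENNReal.ofReal (|f y - f x| ^ p / s ^ (p * αExp p)) ∂μ) := by
    intro x
    set M := ENNReal.ofReal (625 * s ^ dh) with hM
    have hM0 : M ≠ 0 := by
      rw [hM, Ne, ENNReal.ofReal_eq_zero, not_le]; positivity
    have hμ : μ (ball geodesicDist x s) ≤ M := (measure_mono (ball_subset x s)).trans
      (μ_ball_le x hs0)
    have h1 : G x = ENNReal.ofReal (s ^ (p * αExp p)) * ∫⁻ y in ball geodesicDist x s,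
        ENNReal.ofReal (|f y - f x| ^ p / s ^ (p * αExp p)) ∂μ := by
      rw [← lintegral_const_mul' _ _ ENNReal.ofReal_ne_top]
      refine lintegral_congr fun y => ?_
      rw [← ENNReal.ofReal_mul (by positivity), mul_div_cancel₀]
      positivity
    have e : ENNReal.ofReal (625 * s ^ θ p) = M * ENNReal.ofReal (s ^ (p * αExp p)) := by
      rw [hM, ← ENNReal.ofReal_mul (by positivity), θ_eq hp, Real.rpow_add hs0, mul_assoc]
    rw [h1, e]
    set I := ∫⁻ y in ball geodesicDist x s,
        ENNReal.ofReal (|f y - f x| ^ p / s ^ (p * αExp p)) ∂μ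
    -- The upper bound `M` on the mass of the ball is what introduces the averaging factor.
    calc _ = ENNReal.ofReal (s ^ (p * αExp p)) * ((M * M⁻¹) * I) := by
          rw [ENNReal.mul_inv_cancel hM0 ENNReal.ofReal_ne_top, one_mul]
      _ ≤ ENNReal.ofReal (s ^ (p * αExp p)) * ((M * (μ (ball geodesicDist x s))⁻¹) * I) := by
          gcongr
      _ = _ := by ring
  have hinner : ∀ a : Word m, ∑ b : Word m with Touch a b, J p f (cell a) (cell b) ≤
      25 * ∫⁻ x in cell a, G x ∂μ := by
    intro a
    have e1 : ∑ b : Word m with Touch a b, J p f (cell a) (cell b) = ∫⁻ x in cell a,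
        ∑ b : Word m with Touch a b, ∫⁻ y in cell b, ENNReal.ofReal (|f y - f x| ^ p) ∂μ ∂μ := by
      rw [lintegral_finsetSum _ fun b _ => measurable_inner hf _]
      rfl
    rw [e1, ← lintegral_const_mul' _ _ (by norm_num)]
    refine setLIntegral_mono' (measurableSet_cell a) fun x hx => ?_
    calc _ ≤ ∑ b : Word m with Touch a b, G x := by
          refine Finset.sum_le_sum fun b hb => ?_
          exact lintegral_mono' (Measure.restrict_mono
            (hsub a b (Finset.mem_filter.1 hb).2 x hx) le_rfl) le_rfl
      _ ≤ _ := by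
          rw [Finset.sum_const, nsmul_eq_mul]
          gcongr
          have := card_le_of_abs_pos_sub_le (Finset.univ.filter fun b => Touch a b) a
            fun b hb k => (Finset.mem_filter.1 hb).2.abs_pos_sub_le k
          exact_mod_cast this
  calc touchSum p f m = ∑ a : Word m, ∑ b : Word m with Touch a b, J p f (cell a) (cell b) := by
        unfold touchSum
        simp only [Finset.sum_filter]
        rw [← Finset.univ_product_univ, Finset.sum_product]
    _ ≤ ∑ a : Word m, 25 * ∫⁻ x in cell a, G x ∂μ := Finset.sum_le_sum fun a _ => hinner a
    _ = 25 * ∫⁻ x, G x ∂(∑ a : Word m, μ.restrict (cell a)) := by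
        rw [← Finset.mul_sum, lintegral_finsetSum_measure]
    _ ≤ 25 * ∫⁻ x, G x ∂((25 : ℝ≥0∞) • μ) := by
        gcongr
        exact sum_restrict_cell_le Finset.univ
    _ = 625 * ∫⁻ x, G x ∂μ := by
        rw [lintegral_smul_measure, smul_eq_mul, ← mul_assoc]; norm_num
    _ ≤ 625 * (ENNReal.ofReal (625 * s ^ θ p) * energy geodesicDist μ p (αExp p) f s) := by
        gcongr
        unfold energy
        rw [← lintegral_const_mul' _ _ ENNReal.ofReal_ne_top]
        exact lintegral_mono hGle
    _ = _ := by
        rw [← mul_assoc]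
        congr 1
        have : (625 : ℝ≥0∞) = ENNReal.ofReal 625 := by norm_num
        rw [this, ← ENNReal.ofReal_mul (by norm_num)]
        congr 1; ring

theorem energy_le_H (hp : 1 ≤ p) {r : ℝ} (h0 : 0 < r) (h3 : r ≤ 3) :
    energy geodesicDist μ p (αExp p) f r ≤ ENNReal.ofReal (125 * r ^ (-θ p)) * H p f r := by
  unfold energy H
  rw [← lintegral_const_mul' _ _ ENNReal.ofReal_ne_top]
  refine lintegral_mono fun x => ?_
  have h1 : (μ (ball geodesicDist x r))⁻¹ ≤ ENNReal.ofReal (125 * r ^ (-dh)) := by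
    have := ENNReal.inv_le_inv.2 (ofReal_le_μ_ball x h0 h3)
    rwa [← ENNReal.ofReal_inv_of_pos (by positivity), inv_div, div_eq_mul_inv,
      ← Real.rpow_neg h0.le] at this
  have h2 : ∫⁻ y in ball geodesicDist x r,
      ENNReal.ofReal (|f y - f x| ^ p / r ^ (p * αExp p)) ∂μ ≤ ENNReal.ofReal (r ^ (-(p * αExp p))) *
      ∫⁻ y in Metric.ball x r, ENNReal.ofReal (|f y - f x| ^ p) ∂μ := by
    rw [← lintegral_const_mul' _ _ ENNReal.ofReal_ne_top]
    refine lintegral_mono' (Measure.restrict_mono (ball_subset x r) le_rfl) fun y => ?_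
    rw [← ENNReal.ofReal_mul (by positivity), Real.rpow_neg h0.le, div_eq_inv_mul]
  refine (mul_le_mul' h1 h2).trans (le_of_eq ?_)
  rw [← mul_assoc, ← ENNReal.ofReal_mul (by positivity), mul_assoc 125, ← Real.rpow_add h0,
    θ_eq hp, neg_add]

/-- The constant of `H_le_energy`. -/
noncomputable def constH (p : ℝ) : ℝ := 2 * 14 ^ (p - 1) * 5 ^ 26 * 15 ^ θ p

theorem constH_pos (p : ℝ) : 0 < constH p := by unfold constH; positivity

/-- At a level `m` with `5 / 3 ^ m ≤ s < 15 / 3 ^ m` the bounds by and of `touchSum` combine, and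
`(r 3 ^ m) ^ θ * s ^ θ ≤ 15 ^ θ * r ^ θ` no longer depends on `s`. -/
theorem H_le_energy (hp : 1 ≤ p) (hf : Measurable f) {r s : ℝ} (hs0 : 0 < s) (hs1 : s ≤ 1)
    (hsr : s ≤ r) :
    H p f r ≤ ENNReal.ofReal (constH p * r ^ θ p) * energy geodesicDist μ p (αExp p) f s := by
  obtain ⟨n, hn1, hn2⟩ := exists_scale (δ := s / 5) (by positivity) (by linarith)
  have hr0 : 0 < r := hs0.trans_le hsr
  have h1 : (5 : ℝ) / 3 ^ (n + 1) ≤ s := by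
    have : (5 : ℝ) / 3 ^ (n + 1) = 5 * (1 / 3 ^ (n + 1)) := by ring
    linarith
  have h2 : (3 : ℝ) ^ (n + 1) * s ≤ 15 := by
    rw [lt_div_iff₀ (by positivity)] at hn2
    rw [pow_succ]; linarith
  refine (H_le_touchSum hp hf (m := n + 1) (by linarith)).trans ?_
  refine (mul_le_mul_right (touchSum_le_energy hp hf h1) _).trans ?_
  rw [← mul_assoc, ← ENNReal.ofReal_mul (by positivity)]
  refine mul_le_mul_left (ENNReal.ofReal_le_ofReal ?_) _
  have e : 2 * 14 ^ (p - 1) * 5 ^ 18 * (r * 3 ^ (n + 1)) ^ θ p * (5 ^ 8 * s ^ θ p) =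
      2 * 14 ^ (p - 1) * 5 ^ 26 * ((3 ^ (n + 1) * s) ^ θ p * r ^ θ p) := by
    rw [Real.mul_rpow hr0.le (by positivity), Real.mul_rpow (by positivity) hs0.le]
    ring
  rw [e, constH, mul_assoc _ (15 ^ θ p)]
  have := (θ_pos hp).le
  gcongr

theorem ball_eq_univ (x : K) {r : ℝ} (hr : 3 ≤ r) : ball geodesicDist x r = Set.univ := by
  refine Set.eq_univ_of_forall fun y => ?_
  have := curve_of_mem_cell (n := 0) (a := ()) (x := x) (y := y) ⟨x, rfl⟩ ⟨y, rfl⟩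
  refine (this.geodesicDist_le (by norm_num)).trans_lt ?_
  rw [ENNReal.ofReal_lt_ofReal_iff (by linarith)]
  norm_num; linarith

theorem αExp_pos (hp : 1 ≤ p) : 0 < αExp p := by
  have := one_lt_dh
  have : 0 ≤ (dh - 1) / p := div_nonneg (by linarith) (by linarith)
  unfold αExp; linarith

theorem energy_le_energy_three (hp : 1 ≤ p) {r : ℝ} (hr : 3 ≤ r) :
    energy geodesicDist μ p (αExp p) f r ≤ energy geodesicDist μ p (αExp p) f 3 := by
  unfold energy
  refine lintegral_mono fun x => ?_
  rw [ball_eq_univ x hr, ball_eq_univ x le_rfl]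
  gcongr
  have := αExp_pos hp
  positivity

/-- The energy at a scale is controlled by the energy at every smaller scale. -/
theorem energy_le_energy (hp : 1 ≤ p) (hf : Measurable f) {r s : ℝ} (hs0 : 0 < s) (hs1 : s ≤ 1)
    (hsr : s ≤ r) :
    energy geodesicDist μ p (αExp p) f r ≤ ENNReal.ofReal (125 * constH p) *
      energy geodesicDist μ p (αExp p) f s := by
  -- Beyond radius 3 the balls are all of `K` and only the denominator grows.
  wlog hr : r ≤ 3 generalizing r with h
  · exact (energy_le_energy_three hp (not_le.1 hr).le).trans (h (by linarith) le_rfl)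
  have hr0 : 0 < r := hs0.trans_le hsr
  refine (energy_le_H hp hr0 hr).trans ?_
  refine (mul_le_mul_right (H_le_energy hp hf hs0 hs1 hsr) _).trans (le_of_eq ?_)
  rw [← mul_assoc, ← ENNReal.ofReal_mul (by positivity)]
  congr 2
  have : r ^ (-θ p) * r ^ θ p = 1 := by rw [← Real.rpow_add hr0]; simp
  linear_combination 125 * constH p * this

end

/-! ### Energy bounds from oscillations, and rigidity above the exponent `α_p`. -/

theorem energy_congr {p α : ℝ} {f g : K → ℝ} (h : f =ᵐ[μ] g) :
    energy geodesicDist μ p α f = energy geodesicDist μ p α g := by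
  funext r
  refine lintegral_congr_ae ?_
  filter_upwards [h] with x hx
  congr 1
  refine lintegral_congr_ae (ae_restrict_of_ae ?_)
  filter_upwards [h] with y hy
  rw [hx, hy]

section

variable {p : ℝ} {f : K → ℝ}

theorem ofReal_rpow_triangle (hp : 1 ≤ p) (u v w : ℝ) :
    ENNReal.ofReal (|w - u| ^ p) ≤ ENNReal.ofReal (2 ^ (p - 1)) *
      (ENNReal.ofReal (|v - u| ^ p) + ENNReal.ofReal (|w - v| ^ p)) := by
  rw [← ENNReal.ofReal_add (by positivity) (by positivity), ← ENNReal.ofReal_mul (by positivity)]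
  refine ENNReal.ofReal_le_ofReal ?_
  have h := rpow_add_le_of_pos hp one_pos (abs_nonneg (v - u)) (abs_nonneg (w - v))
  rw [div_one, one_add_one_eq_two, ← mul_add] at h
  refine le_trans (Real.rpow_le_rpow (abs_nonneg _) ?_ (by linarith)) h
  have := abs_add_le (v - u) (w - v)
  simpa using this

theorem J_le_of_le {A B : Set K} (hA : MeasurableSet A) (hB : MeasurableSet B) {c : ℝ≥0∞}
    (h : ∀ x ∈ A, ∀ y ∈ B, ENNReal.ofReal (|f y - f x| ^ p) ≤ c) :
    J p f A B ≤ c * μ B * μ A := by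
  unfold J
  calc _ ≤ ∫⁻ x in A, c * μ B ∂μ := by
        refine setLIntegral_mono' hA fun x hx => ?_
        refine (setLIntegral_mono' hB (h x hx)).trans (le_of_eq ?_)
        rw [lintegral_const, Measure.restrict_apply_univ]
    _ = _ := by rw [lintegral_const, Measure.restrict_apply_univ]

/-- The constant of `energy_le_of_osc`. -/
noncomputable def constO (p : ℝ) : ℝ := 125 * 3 ^ θ p * 2 ^ (p - 1) * 50

theorem constO_pos (p : ℝ) : 0 < constO p := by unfold constO; positivity

open Classical in
theorem sum_touch_add_le {m : ℕ} (O : Word m → ℝ≥0∞) :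
    ∑ e : Word m × Word m with Touch e.1 e.2, (O e.1 + O e.2) ≤ 50 * ∑ a, O a := by
  have hcard : ∀ a : Word m, ((Finset.univ.filter fun b => Touch a b).card : ℝ≥0∞) ≤ 25 := by
    intro a
    have := card_le_of_abs_pos_sub_le (Finset.univ.filter fun b => Touch a b) a
      fun b hb k => (Finset.mem_filter.1 hb).2.abs_pos_sub_le k
    exact_mod_cast this
  have h1 : ∑ e : Word m × Word m with Touch e.1 e.2, O e.1 ≤ 25 * ∑ a, O a := by
    simp only [Finset.sum_filter]
    rw [← Finset.univ_product_univ, Finset.sum_product, Finset.mul_sum]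
    refine Finset.sum_le_sum fun a _ => ?_
    simp only [← Finset.sum_filter]
    rw [Finset.sum_const, nsmul_eq_mul]
    gcongr
    exact hcard a
  have h2 : ∑ e : Word m × Word m with Touch e.1 e.2, O e.2 ≤ 25 * ∑ a, O a := by
    simp only [Finset.sum_filter]
    rw [← Finset.univ_product_univ, Finset.sum_product_right, Finset.mul_sum]
    refine Finset.sum_le_sum fun a _ => ?_
    simp only [← Finset.sum_filter]
    rw [Finset.sum_const, nsmul_eq_mul]
    gcongr
    have e : (Finset.univ.filter fun b => Touch b a) = Finset.univ.filter fun b => Touch a b :=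
      Finset.filter_congr fun b _ => ⟨Touch.symm, Touch.symm⟩
    rw [e]
    exact hcard a
  rw [Finset.sum_add_distrib]
  refine (add_le_add h1 h2).trans (le_of_eq ?_)
  rw [← add_mul]; norm_num

open Classical in
/-- A bound of the energy by the oscillations on the cells of the corresponding level. -/
theorem energy_le_of_osc (hp : 1 ≤ p) (hf : Measurable f) {m : ℕ} (O : Word m → ℝ≥0∞)
    (hO : ∀ a, ∀ x ∈ cell a, ∀ y ∈ cell a, ENNReal.ofReal (|f y - f x| ^ p) ≤ O a) {r : ℝ}
    (hr1 : 1 / 3 ^ (m + 1) ≤ r) (hr2 : r < 1 / 3 ^ m) :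
    energy geodesicDist μ p (αExp p) f r ≤
      ENNReal.ofReal (constO p * (3 ^ m) ^ (p - 1)) * ∑ a, O a := by
  have hr0 : 0 < r := lt_of_lt_of_le (by positivity) hr1
  have hr3 : r ≤ 3 := by
    have : (1 : ℝ) / 3 ^ m ≤ 1 := by
      rw [div_le_one (by positivity)]
      exact one_le_pow₀ (by norm_num)
    linarith
  -- The triangle inequality goes through a common point of the two cells.
  have hJ : ∀ e : Word m × Word m, Touch e.1 e.2 → J p f (cell e.1) (cell e.2) ≤
      ENNReal.ofReal (2 ^ (p - 1) * (1 / 5) ^ m * (1 / 5) ^ m) * (O e.1 + O e.2) := by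
    intro e he
    obtain ⟨z, hz1, hz2⟩ := he
    refine (J_le_of_le (measurableSet_cell _) (measurableSet_cell _)
      (c := ENNReal.ofReal (2 ^ (p - 1)) * (O e.1 + O e.2)) fun x hx y hy => ?_).trans
        (le_of_eq ?_)
    · refine (ofReal_rpow_triangle hp (f x) (f z) (f y)).trans ?_
      gcongr
      · exact hO _ _ hx _ hz1
      · exact hO _ _ hz2 _ hy
    · rw [μ_cell, μ_cell, ENNReal.ofReal_mul (by positivity), ENNReal.ofReal_mul (by positivity),
        ofReal_inv_five_pow]
      ring
  have hH : H p f r ≤ ENNReal.ofReal (2 ^ (p - 1) * (1 / 5) ^ m * (1 / 5) ^ m) *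
      (50 * ∑ a, O a) := by
    refine (H_le_sum hf m r).trans ?_
    calc _ ≤ ∑ e : Word m × Word m with Touch e.1 e.2, J p f (cell e.1) (cell e.2) := by
          refine Finset.sum_le_sum_of_subset fun e he => ?_
          obtain ⟨x, hx, y, hy, hxy⟩ := (Finset.mem_filter.1 he).2
          exact Finset.mem_filter.2 ⟨Finset.mem_univ _, touch_of_dist_lt hx hy (hxy.trans hr2)⟩
      _ ≤ ∑ e : Word m × Word m with Touch e.1 e.2,
          ENNReal.ofReal (2 ^ (p - 1) * (1 / 5) ^ m * (1 / 5) ^ m) * (O e.1 + O e.2) :=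
          Finset.sum_le_sum fun e he => hJ e (Finset.mem_filter.1 he).2
      _ ≤ _ := by
          rw [← Finset.mul_sum]
          gcongr
          exact sum_touch_add_le O
  refine (energy_le_H hp hr0 hr3).trans ((mul_le_mul_right hH _).trans ?_)
  have h50 : (50 : ℝ≥0∞) = ENNReal.ofReal 50 := by norm_num
  rw [h50, ← mul_assoc (ENNReal.ofReal (2 ^ (p - 1) * _ * _)), ← ENNReal.ofReal_mul (by positivity),
    ← mul_assoc, ← ENNReal.ofReal_mul (by positivity)]
  refine mul_le_mul_left (ENNReal.ofReal_le_ofReal ?_) _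
  have h1 : r ^ (-θ p) ≤ 3 ^ θ p * (5 ^ m * 5 ^ m * (3 ^ m) ^ (p - 1)) := by
    rw [Real.rpow_neg hr0.le, ← Real.inv_rpow hr0.le]
    have h2 : r⁻¹ ≤ 3 * 3 ^ m := by
      rw [inv_le_comm₀ hr0 (by positivity), ← one_div, mul_comm, ← pow_succ]
      exact hr1
    refine (Real.rpow_le_rpow (by positivity) h2 (θ_pos hp).le).trans (le_of_eq ?_)
    rw [Real.mul_rpow (by norm_num) (by positivity)]
    congr 1
    rw [θ, Real.rpow_add (by positivity), two_mul, Real.rpow_add (by positivity),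
      three_pow_rpow_dh]
  have h5 : (5 : ℝ) ^ m * (1 / 5) ^ m = 1 := by rw [← mul_pow]; norm_num
  calc _ ≤ (125 : ℝ) * (3 ^ θ p * (5 ^ m * 5 ^ m * (3 ^ m) ^ (p - 1))) *
        (2 ^ (p - 1) * (1 / 5) ^ m * (1 / 5) ^ m * 50) := by gcongr
    _ = 125 * 3 ^ θ p * (3 ^ m) ^ (p - 1) * 2 ^ (p - 1) * 50 * (5 ^ m * (1 / 5) ^ m) *
        (5 ^ m * (1 / 5) ^ m) := by ring
    _ = _ := by rw [h5, constO]; ring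

/-- The bound `energy_le_energy` holds for all small `s` at once, hence passes to the lower limit;
it is applied to a measurable representative. -/
theorem iSup_energy_le (hp : 1 ≤ p) (hf : AEMeasurable f μ) :
    (⨆ (r : ℝ) (_ : 0 < r), energy geodesicDist μ p (αExp p) f r) ≤
      ENNReal.ofReal (125 * constH p) *
        liminf (energy geodesicDist μ p (αExp p) f) (𝓝[>] 0) := by
  rw [energy_congr hf.ae_eq_mk]
  have hg := hf.measurable_mk
  generalize hf.mk f = g at hg
  refine iSup₂_le fun r hr => ?_
  have hC : 0 < 125 * constH p := by have := constH_pos p; positivity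
  have hC0 : ENNReal.ofReal (125 * constH p) ≠ 0 := by
    rwa [Ne, ENNReal.ofReal_eq_zero, not_le]
  have h1 : (ENNReal.ofReal (125 * constH p))⁻¹ * energy geodesicDist μ p (αExp p) g r ≤
      liminf (energy geodesicDist μ p (αExp p) g) (𝓝[>] 0) := by
    refine le_liminf_of_le (by isBoundedDefault) ?_
    have h2 : Set.Ioo 0 (min r 1) ∈ 𝓝[>] (0 : ℝ) :=
      Ioo_mem_nhdsGT (lt_min hr one_pos)
    filter_upwards [h2] with s hs
    rw [ENNReal.inv_mul_le_iff hC0 ENNReal.ofReal_ne_top]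
    exact energy_le_energy hp hg hs.1 (hs.2.le.trans (min_le_right _ _))
      (hs.2.le.trans (min_le_left _ _))
  rwa [ENNReal.inv_mul_le_iff hC0 ENNReal.ofReal_ne_top] at h1

theorem energy_eq_rpow_mul_energy (α β : ℝ) {s : ℝ} (hs : 0 < s) :
    energy geodesicDist μ p β f s =
      ENNReal.ofReal (s ^ (p * (α - β))) * energy geodesicDist μ p α f s := by
  unfold energy
  rw [← lintegral_const_mul' _ _ ENNReal.ofReal_ne_top]
  refine lintegral_congr fun x => ?_
  rw [mul_left_comm, ← lintegral_const_mul' _ _ ENNReal.ofReal_ne_top]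
  congr 1
  refine lintegral_congr fun y => ?_
  rw [← ENNReal.ofReal_mul (by positivity), mul_sub, Real.rpow_sub hs]
  congr 1
  field_simp

theorem isConstAE_of_H_eq_zero (hf : Measurable f) (h : H p f 3 = 0) :
    IsConstAE μ f := by
  have hb : ∀ x : K, Metric.ball x 3 = Set.univ := fun x =>
    Set.eq_univ_of_forall fun y => by
      rw [Metric.mem_ball]
      linarith [dist_le_two y x]
  unfold H at h
  simp only [hb, Measure.restrict_univ] at h
  have hm := measurable_inner (p := p) hf Set.univ
  rw [Measure.restrict_univ] at hm
  rw [lintegral_eq_zero_iff hm] at h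
  obtain ⟨x, hx⟩ := h.exists
  have hx' := (lintegral_eq_zero_iff (measurable_diff_right hf x)).1 hx
  refine ⟨f x, ?_⟩
  filter_upwards [hx'] with y hy
  have h1 : |f y - f x| ^ p ≤ 0 := ENNReal.ofReal_eq_zero.1 hy
  have h2 : |f y - f x| = 0 := by
    by_contra hc
    have : 0 < |f y - f x| ^ p := Real.rpow_pos_of_pos (lt_of_le_of_ne (abs_nonneg _)
      (Ne.symm hc)) _
    linarith
  linarith [abs_eq_zero.1 h2]

/-- Above the exponent `α_p` the Besov-Lipschitz spaces are trivial. -/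
theorem isConstAE_of_memBesov (hp : 1 ≤ p) {α : ℝ} (hα : αExp p < α)
    (hf : MemBesov geodesicDist μ p α f) : IsConstAE μ f := by
  obtain ⟨hLp, hM⟩ := hf
  have hae := hLp.aestronglyMeasurable.aemeasurable
  rw [energy_congr hae.ae_eq_mk] at hM
  have hg := hae.measurable_mk
  have hfg := hae.ae_eq_mk
  generalize hae.mk f = g at hg hfg hM
  set M := ⨆ (r : ℝ) (_ : 0 < r), energy geodesicDist μ p α g r
  -- Radius 3 sees all pairs of points, while the energy at `α_p` and scale `s` is a positive power
  -- of `s` times a bounded quantity.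
  have hle : ∀ s : ℝ, 0 < s → s ≤ 1 → H p g 3 ≤ ENNReal.ofReal (constH p * 3 ^ θ p) *
      (ENNReal.ofReal (s ^ (p * (α - αExp p))) * M) := by
    intro s hs0 hs1
    refine (H_le_energy hp hg hs0 hs1 (by linarith : s ≤ 3)).trans ?_
    rw [energy_eq_rpow_mul_energy α (αExp p) hs0]
    gcongr
    exact le_iSup₂ (f := fun (r : ℝ) (_ : 0 < r) => energy geodesicDist μ p α g r) s hs0
  have hexp : 0 < p * (α - αExp p) := mul_pos (by linarith) (by linarith)
  have ht : Tendsto (fun s : ℝ => ENNReal.ofReal (constH p * 3 ^ θ p) *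
      (ENNReal.ofReal (s ^ (p * (α - αExp p))) * M)) (𝓝[>] 0) (𝓝 0) := by
    have h1 : Tendsto (fun s : ℝ => ENNReal.ofReal (s ^ (p * (α - αExp p)))) (𝓝[>] 0) (𝓝 0) := by
      have h2 : Tendsto (fun s : ℝ => s ^ (p * (α - αExp p))) (𝓝 0) (𝓝 0) := by
        have := (Real.continuous_rpow_const hexp.le).tendsto 0
        rwa [Real.zero_rpow hexp.ne'] at this
      have h3 := (ENNReal.continuous_ofReal.tendsto _).comp
        (h2.mono_left (nhdsWithin_le_nhds (s := Set.Ioi 0)))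
      rwa [ENNReal.ofReal_zero] at h3
    have h2 := ENNReal.Tendsto.mul_const h1 (Or.inr hM.ne)
    have h3 := ENNReal.Tendsto.const_mul h2
      (Or.inr (ENNReal.ofReal_ne_top (r := constH p * 3 ^ θ p)))
    simpa using h3
  have h0 : H p g 3 = 0 := by
    refine le_antisymm (ge_of_tendsto ht ?_) zero_le
    filter_upwards [Ioo_mem_nhdsGT (zero_lt_one (α := ℝ))] with s hs
    exact hle s hs.1 hs.2.le
  obtain ⟨c, hc⟩ := isConstAE_of_H_eq_zero hg h0
  exact ⟨c, by filter_upwards [hfg, hc] with x h1 h2; rw [h1, h2]⟩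

end

/-- Full support makes almost everywhere equality of continuous functions an equality, and makes
averages over balls meaningful. -/
instance : Measure.IsOpenPosMeasure μ := ⟨fun U hU ⟨x, hx⟩ h0 => by
  obtain ⟨ε, hε, hball⟩ := Metric.isOpen_iff.1 hU x hx
  have h1 : (0 : ℝ) < min ε 3 := lt_min hε (by norm_num)
  have h2 := ofReal_le_μ_ball x h1 (min_le_right _ _)
  have h3 : μ (KorevaarSchoen.ball geodesicDist x (min ε 3)) ≤ μ U :=
    measure_mono ((ball_subset x _).trans
      ((Metric.ball_subset_ball (min_le_left _ _)).trans hball))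
  rw [h0] at h3
  have h4 := ENNReal.ofReal_eq_zero.1 (le_antisymm (h2.trans h3) zero_le)
  have : 0 < min ε 3 ^ dh / 125 := by positivity
  linarith⟩

/-! ### The coordinate along a diagonal -/

/-- The slopes of the self-similarity of the diagonal coordinate. -/
noncomputable def slope : Fin 5 → ℝ := ![1 / 3, 0, 1 / 3, 0, 1 / 3]

/-- The offsets of the self-similarity of the diagonal coordinate. -/
noncomputable def offset : Fin 5 → ℝ := ![-(2 / 3), 0, 2 / 3, 0, 0]

/-- The values of the diagonal coordinate at the points `q i`. -/
def vertexValue : Fin 5 → ℝ := ![-1, 0, 1, 0, 0]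

theorem slope_vertexValue (i : Fin 5) :
    slope i * vertexValue i + offset i = vertexValue i := by
  fin_cases i <;> norm_num [slope, vertexValue, offset]

theorem slope_four_vertexValue (i : Fin 5) :
    slope 4 * vertexValue i + offset 4 = slope i * vertexValue (opp i) + offset i := by
  have h4 : slope 4 = 1 / 3 ∧ offset 4 = 0 := ⟨rfl, rfl⟩
  rw [h4.1, h4.2]
  fin_cases i
  · change 1 / 3 * (-1 : ℝ) + 0 = 1 / 3 * 1 + -(2 / 3); norm_num
  · change 1 / 3 * (0 : ℝ) + 0 = 0 * 0 + 0; norm_num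
  · change 1 / 3 * (1 : ℝ) + 0 = 1 / 3 * -1 + 2 / 3; norm_num
  · change 1 / 3 * (0 : ℝ) + 0 = 0 * 0 + 0; norm_num
  · change 1 / 3 * (0 : ℝ) + 0 = 1 / 3 * 0 + 0; norm_num

theorem abs_slope_mul_add_le (i : Fin 5) {t : ℝ} (ht : |t| ≤ 1) :
    |slope i * t + offset i| ≤ 1 := by
  rw [abs_le] at *
  fin_cases i <;> norm_num [slope, offset] <;> constructor <;> linarith

theorem abs_slope_mul_le (i : Fin 5) (t : ℝ) : |slope i * t| ≤ |t| / 3 := by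
  have h : 0 ≤ |t| := abs_nonneg t
  rw [abs_mul]
  fin_cases i <;> norm_num [slope] <;> linarith

/-- One step of the iteration that constructs the diagonal coordinate. -/
noncomputable def diagStep (g : K → ℝ) (x : K) : ℝ :=
  slope (exists_ψK_eq x).choose * g (exists_ψK_eq x).choose_spec.choose +
    offset (exists_ψK_eq x).choose

/-- The address chosen in `diagStep` is ambiguous only at a vertex shared by two cells, where the
prescribed vertex values make both affine formulas agree. -/
theorem diagStep_ψK {g : K → ℝ} (hg : ∀ i, g (qK i) = vertexValue i) (i : Fin 5) (x : K) :
    diagStep g (ψK i x) = slope i * g x + offset i := by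
  unfold diagStep
  have h := (exists_ψK_eq (ψK i x)).choose_spec.choose_spec
  generalize (exists_ψK_eq (ψK i x)).choose_spec.choose = y at *
  generalize (exists_ψK_eq (ψK i x)).choose = j at *
  by_cases hij : j = i
  · subst hij
    have : y = x := by
      have := φ_injective (n := 1) (j, ()) (a₁ := y) (a₂ := x) h
      exact this
    rw [this]
  · rcases ψK_eq_ψK hij h with ⟨rfl, rfl, rfl⟩ | ⟨rfl, rfl, rfl⟩
    · rw [hg, hg]; exact slope_four_vertexValue i
    · rw [hg, hg]; exact (slope_four_vertexValue j).symm

/-- The approximations of the diagonal coordinate. -/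
noncomputable def diagApprox : ℕ → K → ℝ
  | 0, x => (cx x 0 - cx x 1) / 2
  | n + 1, x => diagStep (diagApprox n) x

theorem diagApprox_qK (n : ℕ) (i : Fin 5) : diagApprox n (qK i) = vertexValue i := by
  induction n generalizing i with
  | zero =>
    change (cx (q i) 0 - cx (q i) 1) / 2 = _
    rw [cx_q, cx_q]
    fin_cases i <;> norm_num [sgn, vertexValue]
  | succ n ih =>
    rw [diagApprox, ← ψK_qK i, diagStep_ψK ih, ih, slope_vertexValue]

theorem abs_diagApprox_le (n : ℕ) (x : K) : |diagApprox n x| ≤ 1 := by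
  induction n generalizing x with
  | zero =>
    have h0 := abs_le.1 (abs_cx_le x.2 0)
    have h1 := abs_le.1 (abs_cx_le x.2 1)
    rw [diagApprox, abs_le]
    constructor <;> linarith [h0.1, h0.2, h1.1, h1.2]
  | succ n ih => exact abs_slope_mul_add_le _ (ih _)

theorem dist_diagApprox_le (n : ℕ) (x : K) :
    dist (diagApprox n x) (diagApprox (n + 1) x) ≤ 2 * (1 / 3) ^ n := by
  induction n generalizing x with
  | zero =>
    have h0 := abs_diagApprox_le 0 x
    have h1 := abs_diagApprox_le 1 x
    rw [abs_le] at h0 h1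
    rw [Real.dist_eq, abs_le]
    simp only [pow_zero]
    constructor <;> linarith [h0.1, h0.2, h1.1, h1.2]
  | succ n ih =>
    rw [diagApprox, diagApprox, diagStep, diagStep, dist_add_right, Real.dist_eq, ← mul_sub]
    refine (abs_slope_mul_le _ _).trans ?_
    rw [← Real.dist_eq, pow_succ]
    have := ih (exists_ψK_eq x).choose_spec.choose
    linarith

/-- Slopes of at most `1/3` make the iteration a contraction. The limit is the signed length along
the diagonal of the corners of index `0` and `2`, with every side branch collapsed to its foot. -/
theorem exists_diag : ∃ f : K → ℝ, (∀ i x, f (ψK i x) = slope i * f x + offset i) ∧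
    (∀ x, |f x| ≤ 1) ∧ ∀ i, f (qK i) = vertexValue i := by
  have hlim : ∀ x, ∃ z, Tendsto (fun n => diagApprox n x) atTop (𝓝 z) := fun x =>
    cauchySeq_tendsto_of_complete
      (cauchySeq_of_le_geometric (1 / 3) 2 (by norm_num) fun n => dist_diagApprox_le n x)
  choose f hf using hlim
  refine ⟨f, fun i x => ?_, fun x => ?_, fun i => ?_⟩
  · refine tendsto_nhds_unique ((tendsto_add_atTop_iff_nat 1).2 (hf (ψK i x))) ?_
    have h1 : (fun n => diagApprox (n + 1) (ψK i x)) =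
        fun n => slope i * diagApprox n x + offset i := by
      funext n
      exact diagStep_ψK (diagApprox_qK n) i x
    rw [h1]
    exact ((hf x).const_mul _).add_const _
  · exact le_of_tendsto (hf x).abs (Eventually.of_forall fun n => abs_diagApprox_le n x)
  · refine tendsto_nhds_unique (hf (qK i)) ?_
    simp only [diagApprox_qK]
    exact tendsto_const_nhds

/-- The slope of the diagonal coordinate on a cell. -/
noncomputable def wordSlope : {n : ℕ} → Word n → ℝ
  | 0, _ => 1
  | _ + 1, w => slope w.1 * wordSlope w.2

theorem slope_nonneg (i : Fin 5) : 0 ≤ slope i := by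
  fin_cases i <;> norm_num [slope]

theorem wordSlope_nonneg {n : ℕ} (w : Word n) : 0 ≤ wordSlope w := by
  induction n with
  | zero => exact zero_le_one
  | succ n ih => exact mul_nonneg (slope_nonneg _) (ih _)

theorem wordSlope_le {n : ℕ} (w : Word n) : wordSlope w ≤ 1 / 3 ^ n := by
  induction n with
  | zero => simp [wordSlope]
  | succ n ih =>
    have h1 : slope w.1 ≤ 1 / 3 := by
      generalize w.1 = i
      fin_cases i <;> norm_num [slope]
    have h2 := mul_le_mul h1 (ih w.2) (wordSlope_nonneg _) (by norm_num)
    refine h2.trans (le_of_eq ?_)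
    rw [pow_succ]; field_simp

/-- Only the three cells along the diagonal contribute at each step, each with slope `1/3`. -/
theorem sum_wordSlope_rpow {p : ℝ} (hp : 1 ≤ p) (n : ℕ) :
    ∑ w : Word n, wordSlope w ^ p = (3 * (1 / 3) ^ p) ^ n := by
  have hp0 : p ≠ 0 := by positivity
  induction n with
  | zero =>
    rw [pow_zero]
    have : ∀ w : Word 0, wordSlope w ^ p = 1 := fun w => by simp [wordSlope]
    simp only [this, Finset.sum_const, Finset.card_univ, card_word]
    simp
  | succ n ih =>
    rw [sum_word_succ]
    have h : ∀ i : Fin 5, ∑ w : Word n, wordSlope (n := n + 1) (i, w) ^ p =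
        slope i ^ p * (3 * (1 / 3) ^ p) ^ n := by
      intro i
      rw [← ih, Finset.mul_sum]
      refine Finset.sum_congr rfl fun w _ => ?_
      exact Real.mul_rpow (slope_nonneg i) (wordSlope_nonneg w)
    simp only [h, ← Finset.sum_mul, Fin.sum_univ_five]
    have h2 : slope 0 ^ p + slope 1 ^ p + slope 2 ^ p + slope 3 ^ p + slope 4 ^ p =
        3 * (1 / 3) ^ p := by
      simp [slope, Real.zero_rpow hp0]; ring
    rw [h2, pow_succ]; ring

/-- A continuous function that is not constant and has finite energy at the critical exponent for
every `p`. -/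
theorem exists_memBesov : ∃ f : K → ℝ, ¬ IsConstAE μ f ∧
    ∀ p : ℝ, 1 ≤ p → MemBesov geodesicDist μ p (αExp p) f := by
  obtain ⟨f, hf1, hf2, hf3⟩ := exists_diag
  have hslope : ∀ (n : ℕ) (w : Word n) (x y : K),
      f (φ w x) - f (φ w y) = wordSlope w * (f x - f y) := by
    intro n
    induction n with
    | zero => intro w x y; simp [φ, wordSlope]
    | succ n ih =>
      intro w x y
      rw [φ, φ, hf1, hf1, wordSlope, mul_assoc, ← ih]; ring
  have hosc : ∀ (n : ℕ) (w : Word n), ∀ x ∈ cell w, ∀ y ∈ cell w,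
      |f y - f x| ≤ 2 * wordSlope w := by
    rintro n w _ ⟨x, rfl⟩ _ ⟨y, rfl⟩
    rw [hslope, abs_mul, abs_of_nonneg (wordSlope_nonneg w), mul_comm]
    have h1 := abs_le.1 (hf2 x)
    have h2 := abs_le.1 (hf2 y)
    refine mul_le_mul_of_nonneg_right ?_ (wordSlope_nonneg w)
    rw [abs_le]
    constructor <;> linarith [h1.1, h1.2, h2.1, h2.2]
  have hcont : Continuous f := by
    rw [Metric.continuous_iff]
    intro x ε hε
    obtain ⟨n, hn⟩ := exists_pow_lt_of_lt_one (by positivity : 0 < ε / 4)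
      (by norm_num : (1 / 3 : ℝ) < 1)
    rw [one_div_pow] at hn
    refine ⟨1 / 3 ^ n, by positivity, fun y hy => ?_⟩
    obtain ⟨a, ha⟩ := exists_mem_cell n x
    obtain ⟨b, hb⟩ := exists_mem_cell n y
    obtain ⟨z, hz1, hz2⟩ := touch_of_dist_lt hb ha hy
    have h1 := hosc n a x ha z hz2
    have h2 := hosc n b z hz1 y hb
    have h3 := wordSlope_le a
    have h4 := wordSlope_le b
    rw [Real.dist_eq]
    have := abs_add_le (f z - f x) (f y - f z)
    rw [sub_add_sub_cancel'] at this
    linarith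
  refine ⟨f, ?_, fun p hp => ⟨?_, ?_⟩⟩
  · rintro ⟨c, hc⟩
    have h := (hcont.ae_eq_iff_eq μ (continuous_const (y := c))).1 hc
    have h0 := congrFun h (qK 0)
    have h2 := congrFun h (qK 2)
    rw [hf3] at h0 h2
    change (-1 : ℝ) = c at h0
    change (1 : ℝ) = c at h2
    linarith
  · exact MemLp.of_bound hcont.aestronglyMeasurable 1 (Eventually.of_forall hf2)
  · have hsmall : ∀ r : ℝ, 0 < r → r < 1 → energy geodesicDist μ p (αExp p) f r ≤
        ENNReal.ofReal (constO p * 2 ^ p) := by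
      intro r hr0 hr1
      obtain ⟨n, hn1, hn2⟩ := exists_scale hr0 hr1
      refine (energy_le_of_osc hp hcont.measurable
        (fun w : Word n => ENNReal.ofReal ((2 * wordSlope w) ^ p)) (fun w x hx y hy => ?_)
        hn1 hn2).trans ?_
      · exact ENNReal.ofReal_le_ofReal (Real.rpow_le_rpow (abs_nonneg _) (hosc n w x hx y hy)
          (by linarith))
      · rw [← ENNReal.ofReal_sum_of_nonneg fun w _ => Real.rpow_nonneg
          (mul_nonneg zero_le_two (wordSlope_nonneg w)) _]
        have hC := constO_pos p
        rw [← ENNReal.ofReal_mul (by positivity)]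
        refine ENNReal.ofReal_le_ofReal (le_of_eq ?_)
        have e1 : ∑ w : Word n, (2 * wordSlope w) ^ p = 2 ^ p * (3 * (1 / 3) ^ p) ^ n := by
          rw [← sum_wordSlope_rpow hp, Finset.mul_sum]
          exact Finset.sum_congr rfl fun w _ => Real.mul_rpow (by norm_num) (wordSlope_nonneg w)
        -- The normalisation is exact: `3 ^ n` active cells of slope `3⁻ⁿ` give an energy bound free
        -- of `n`.
        have e2 : ((3 : ℝ) ^ n) ^ (p - 1) * (3 * (1 / 3) ^ p) ^ n = 1 := by
          have e3 : ((3 : ℝ) ^ n) ^ (p - 1) = (3 ^ (p - 1)) ^ n := by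
            rw [← Real.rpow_natCast, ← Real.rpow_natCast, ← Real.rpow_mul (by norm_num),
              ← Real.rpow_mul (by norm_num), mul_comm]
          rw [e3, ← mul_pow, Real.div_rpow (by norm_num) (by norm_num),
            Real.rpow_sub_one (by norm_num), Real.one_rpow]
          have : (3 : ℝ) ^ p ≠ 0 := by positivity
          field_simp
          simp
        rw [e1]
        linear_combination constO p * 2 ^ p * e2
    have hall : ∀ r : ℝ, 0 < r → energy geodesicDist μ p (αExp p) f r ≤
        max (ENNReal.ofReal (constO p * 2 ^ p))
          (ENNReal.ofReal (125 * constH p) * ENNReal.ofReal (constO p * 2 ^ p)) := by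
      intro r hr
      rcases lt_or_ge r 1 with h1 | h1
      · exact (hsmall r hr h1).trans (le_max_left _ _)
      · refine le_trans ?_ (le_max_right _ _)
        refine (energy_le_energy hp hcont.measurable (s := 1 / 2) (by norm_num) (by norm_num)
          (by linarith)).trans ?_
        gcongr
        exact hsmall _ (by norm_num) (by norm_num)
    refine (iSup₂_le hall).trans_lt (max_lt ENNReal.ofReal_lt_top ?_)
    exact ENNReal.mul_lt_top ENNReal.ofReal_lt_top ENNReal.ofReal_lt_top

/-! ### The critical exponent and property `P`. -/

theorem criticalExponent_eq {p : ℝ} (hp : 1 ≤ p) :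
    criticalExponent geodesicDist μ p = ENNReal.ofReal (αExp p) := by
  refine le_antisymm (iSup₂_le fun α ⟨f, hf, hc⟩ => ?_) ?_
  · by_contra h
    refine hc (isConstAE_of_memBesov hp (α := α) ?_ hf)
    rw [not_le, ← ENNReal.ofReal_coe_nnreal] at h
    exact (ENNReal.ofReal_lt_ofReal_iff_of_nonneg (αExp_pos hp).le).1 h
  · obtain ⟨f, hc, hf⟩ := exists_memBesov
    refine le_iSup₂_of_le (Real.toNNReal (αExp p)) ⟨f, ?_, hc⟩ le_rfl
    rw [Real.coe_toNNReal _ (αExp_pos hp).le]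
    exact hf p hp

theorem memKS_of_memBesov {p α : ℝ} {f : K → ℝ} (hf : MemBesov geodesicDist μ p α f) :
    MemKS geodesicDist μ p α f := by
  refine ⟨hf.1, lt_of_le_of_lt ?_ hf.2⟩
  refine limsup_le_of_le (by isBoundedDefault) ?_
  filter_upwards [self_mem_nhdsWithin] with r hr
  exact le_iSup₂ (f := fun (r : ℝ) (_ : 0 < r) => energy geodesicDist μ p α f r) r hr

theorem propertyP {p : ℝ} (hp : 1 ≤ p) : PropertyP geodesicDist μ p (αExp p) := by
  obtain ⟨f, hc, hf⟩ := exists_memBesov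
  refine ⟨⟨f, memKS_of_memBesov (hf p hp), hc⟩, max 1 (125 * constH p), le_max_left _ _, fun g hg => ?_⟩
  refine (iSup_energy_le hp hg.1.aestronglyMeasurable.aemeasurable).trans ?_
  gcongr
  exact le_max_right _ _

/-! ### Discrete energies: edges, monotonicity and self-similarity of the limit. -/

theorem φ_mem_V {n : ℕ} (w : Word n) (i : Fin 5) : (φ w (qK i) : Plane) ∈ V n := by
  induction n with
  | zero => exact ⟨i, rfl⟩
  | succ n ih => exact Set.mem_iUnion.2 ⟨w.1, _, ih w.2, rfl⟩

theorem adj_iff {n : ℕ} {x y : Plane} : Adj n x y ↔ ∃ (w : Word n) (i : Fin 5), i ≠ 4 ∧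
    ((x = φ w (qK 4) ∧ y = φ w (qK i)) ∨ (x = φ w (qK i) ∧ y = φ w (qK 4))) := by
  induction n generalizing x y with
  | zero =>
    constructor
    · rintro ⟨i, hi, h⟩
      exact ⟨(), i, hi, h⟩
    · rintro ⟨_, i, hi, h⟩
      exact ⟨i, hi, h⟩
  | succ n ih =>
    constructor
    · rintro ⟨j, x', y', h, rfl, rfl⟩
      obtain ⟨w, i, hi, h⟩ := ih.1 h
      refine ⟨(j, w), i, hi, ?_⟩
      rcases h with ⟨rfl, rfl⟩ | ⟨rfl, rfl⟩
      · exact Or.inl ⟨rfl, rfl⟩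
      · exact Or.inr ⟨rfl, rfl⟩
    · rintro ⟨w, i, hi, h⟩
      rcases h with ⟨rfl, rfl⟩ | ⟨rfl, rfl⟩
      · exact ⟨w.1, _, _, ih.2 ⟨w.2, i, hi, Or.inl ⟨rfl, rfl⟩⟩, rfl, rfl⟩
      · exact ⟨w.1, _, _, ih.2 ⟨w.2, i, hi, Or.inr ⟨rfl, rfl⟩⟩, rfl, rfl⟩

theorem pos_add_sgn_eq {n : ℕ} {w v : Word n} {i j : Fin 5}
    (h : φ w (qK i) = φ v (qK j)) (k : Fin 2) : pos w k + sgn i k = pos v k + sgn j k := by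
  have h1 := congrArg (fun z : K => cx z k) h
  simp only [cx_φ] at h1
  rw [div_left_inj' (by positivity)] at h1
  change cx (q i) k + _ = cx (q j) k + _ at h1
  rw [cx_q, cx_q] at h1
  have h2 : sgn i k + pos w k = sgn j k + pos v k := by exact_mod_cast h1
  linarith

theorem sgn_four (k : Fin 2) : sgn 4 k = 0 := by revert k; decide

theorem φ_center_injective {n : ℕ} {w v : Word n} (h : φ w (qK 4) = φ v (qK 4)) : w = v :=
  pos_injective (funext fun k => by
    have := pos_add_sgn_eq h k
    linarith)

/-- Parity: on the lattice of level `n` centers have even coordinates and corners odd ones. -/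
theorem φ_center_ne {n : ℕ} {w v : Word n} {i : Fin 5} (hi : i ≠ 4) :
    φ w (qK 4) ≠ φ v (qK i) := by
  intro h
  have h1 := pos_add_sgn_eq h 0
  rw [sgn_four] at h1
  have h2 := (abs_eq (by norm_num)).1 (abs_sgn_eq hi 0)
  have h3 := pos_even w 0
  have h4 := pos_even v 0
  omega

theorem φ_vertex_injective {n : ℕ} {w : Word n} {i j : Fin 5}
    (h : φ w (qK i) = φ w (qK j)) : i = j :=
  sgn_injective (funext fun k => by
    have := pos_add_sgn_eq h k
    linarith)

/-- The sum of `|f x - f y| ^ p` over the unordered edges of level `m`. -/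
noncomputable def edgeSum (p : ℝ) (m : ℕ) (f : K → ℝ) : ℝ≥0∞ :=
  ∑ w : Word m, ∑ i : Fin 5, ENNReal.ofReal (|f (φ w (qK 4)) - f (φ w (qK i))| ^ p)

/-- The oriented edges of level `m`. -/
noncomputable def edge {m : ℕ} (t : Word m × {i : Fin 5 // i ≠ 4} × Bool) : K × K :=
  if t.2.2 then (φ t.1 (qK 4), φ t.1 (qK t.2.1)) else (φ t.1 (qK t.2.1), φ t.1 (qK 4))

theorem edge_injective {m : ℕ} : Function.Injective (edge (m := m)) := by
  rintro ⟨w, ⟨i, hi⟩, b⟩ ⟨v, ⟨j, hj⟩, c⟩ h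
  cases b <;> cases c <;> simp only [edge, if_true, if_false, Bool.false_eq_true, Prod.mk.injEq] at h
  · obtain rfl := φ_center_injective h.2
    obtain rfl := φ_vertex_injective h.1
    rfl
  · exact absurd h.2 (φ_center_ne hj)
  · exact absurd h.1 (φ_center_ne hj)
  · obtain rfl := φ_center_injective h.1
    obtain rfl := φ_vertex_injective h.2
    rfl

theorem edge_mem {m : ℕ} (t : Word m × {i : Fin 5 // i ≠ 4} × Bool) :
    ((edge t).1 : Plane) ∈ V m ∧ ((edge t).2 : Plane) ∈ V m ∧ Adj m (edge t).1 (edge t).2 := by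
  obtain ⟨w, ⟨i, hi⟩, b⟩ := t
  cases b
  · exact ⟨φ_mem_V _ _, φ_mem_V _ _, adj_iff.2 ⟨w, i, hi, Or.inr ⟨rfl, rfl⟩⟩⟩
  · exact ⟨φ_mem_V _ _, φ_mem_V _ _, adj_iff.2 ⟨w, i, hi, Or.inl ⟨rfl, rfl⟩⟩⟩

/-- Every ordered edge comes from exactly one word, corner and orientation; the two orientations
cancel the factor `1/2`. -/
theorem discreteEnergy_eq {p : ℝ} (hp : 1 ≤ p) (m : ℕ) (f : K → ℝ) :
    discreteEnergy p m f = ENNReal.ofReal ((3 ^ m) ^ (p - 1)) * edgeSum p m f := by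
  have hp0 : p ≠ 0 := by positivity
  let g : Word m × {i : Fin 5 // i ≠ 4} × Bool →
      {e : K × K // (e.1 : Plane) ∈ V m ∧ (e.2 : Plane) ∈ V m ∧ Adj m e.1 e.2} :=
    fun t => ⟨edge t, edge_mem t⟩
  have hg : Function.Bijective g := by
    refine ⟨fun s t h => edge_injective (congrArg Subtype.val h), ?_⟩
    rintro ⟨⟨x, y⟩, hx, hy, h⟩
    obtain ⟨w, i, hi, h⟩ := adj_iff.1 h
    rcases h with ⟨h1, h2⟩ | ⟨h1, h2⟩
    · exact ⟨(w, ⟨i, hi⟩, true), Subtype.ext (Prod.ext (Subtype.ext h1.symm) (Subtype.ext h2.symm))⟩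
    · exact ⟨(w, ⟨i, hi⟩, false), Subtype.ext (Prod.ext (Subtype.ext h1.symm) (Subtype.ext h2.symm))⟩
  have hsum : ∑' e : {e : K × K // (e.1 : Plane) ∈ V m ∧ (e.2 : Plane) ∈ V m ∧ Adj m e.1 e.2},
      ENNReal.ofReal (|f e.1.1 - f e.1.2| ^ p) = 2 * edgeSum p m f := by
    rw [← (Equiv.ofBijective g hg).tsum_eq, tsum_fintype, Fintype.sum_prod_type, edgeSum,
      Finset.mul_sum]
    refine Finset.sum_congr rfl fun w _ => ?_
    set h : Fin 5 → ℝ≥0∞ := fun i => ENNReal.ofReal (|f (φ w (qK 4)) - f (φ w (qK i))| ^ p) with hh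
    -- The center paired with itself contributes nothing, so sums may run over all five letters.
    have h4 : h 4 = 0 := by
      simp only [hh, sub_self, abs_zero, Real.zero_rpow hp0, ENNReal.ofReal_zero]
    have e1 : ∑ i : {i : Fin 5 // i ≠ 4}, h i = ∑ i, h i := by
      rw [← Finset.sum_subtype (Finset.univ.filter fun i : Fin 5 => i ≠ 4) (by simp) h]
      refine Finset.sum_subset (Finset.subset_univ _) fun i _ hi => ?_
      have : i = 4 := by simpa using hi
      rw [this, h4]
    rw [Fintype.sum_prod_type, ← e1, Finset.mul_sum]
    refine Finset.sum_congr rfl fun i _ => ?_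
    rw [Fintype.sum_bool, two_mul]
    congr 1
    change ENNReal.ofReal (|f (φ w (qK i)) - f (φ w (qK 4))| ^ p) = _
    rw [abs_sub_comm]
  unfold discreteEnergy
  rw [hsum]
  have h2 : (1 / 2 : ℝ≥0∞) * 2 = 1 := by
    rw [one_div]; exact ENNReal.inv_mul_cancel (by norm_num) (by norm_num)
  have h3 : (3 : ℝ) ^ ((p - 1) * m) = (3 ^ m) ^ (p - 1) := by
    rw [← Real.rpow_natCast, ← Real.rpow_mul (by norm_num), mul_comm]
  rw [h3, mul_mul_mul_comm, h2, one_mul]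

theorem edgeSum_succ (p : ℝ) (m : ℕ) (f : K → ℝ) :
    edgeSum p (m + 1) f = ∑ i, edgeSum p m (f ∘ ψK i) :=
  sum_word_succ _

theorem edgeSum_zero (p : ℝ) (f : K → ℝ) :
    edgeSum p 0 f = ∑ i : Fin 5, ENNReal.ofReal (|f (qK 4) - f (qK i)| ^ p) :=
  Fintype.sum_unique (ι := Unit) _

/-- The discrete `p`-energy as a sum over words. -/
noncomputable def wordEnergy (p : ℝ) (m : ℕ) (f : K → ℝ) : ℝ≥0∞ :=
  ENNReal.ofReal ((3 ^ m) ^ (p - 1)) * edgeSum p m f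

theorem wordEnergy_succ (p : ℝ) (m : ℕ) (f : K → ℝ) :
    wordEnergy p (m + 1) f = ENNReal.ofReal (3 ^ (p - 1)) * ∑ i, wordEnergy p m (f ∘ ψK i) := by
  simp only [wordEnergy]
  rw [edgeSum_succ, ← Finset.mul_sum, ← mul_assoc, ← ENNReal.ofReal_mul (by positivity), pow_succ,
    Real.mul_rpow (by positivity) (by norm_num), mul_comm (3 ^ (p - 1) : ℝ)]

theorem add_three_rpow_le {p a b c : ℝ} (hp : 1 ≤ p) (ha : 0 ≤ a) (hb : 0 ≤ b) (hc : 0 ≤ c) :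
    (a + (b + c)) ^ p ≤ 3 ^ (p - 1) * (a ^ p + (b ^ p + c ^ p)) := by
  have h1 := rpow_add_le_of_pos hp (by norm_num : (0 : ℝ) < 2) ha (add_nonneg hb hc)
  have h2 := rpow_add_le_of_pos hp one_pos hb hc
  rw [div_one, one_add_one_eq_two, ← mul_add] at h2
  have h3 : ((2 + 1) / 2 : ℝ) ^ (p - 1) * (b + c) ^ p ≤ 3 ^ (p - 1) * (b ^ p + c ^ p) := by
    refine (mul_le_mul_of_nonneg_left h2 (by positivity)).trans (le_of_eq ?_)
    rw [← mul_assoc, ← Real.mul_rpow (by norm_num) (by norm_num)]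
    norm_num
  have h4 : (2 + 1 : ℝ) = 3 := by norm_num
  rw [h4] at h1 h3
  linarith

/-- The edge from the center to corner `j` splits into three finer edges: one in the central cell,
then the two halves of a diagonal of cell `j`. Convexity costs `3 ^ (p - 1)`. -/
theorem edge_le_refined {p : ℝ} (hp : 1 ≤ p) (f : K → ℝ) (j : Fin 5) :
    ENNReal.ofReal (|f (qK 4) - f (qK j)| ^ p) ≤ ENNReal.ofReal (3 ^ (p - 1)) *
      (ENNReal.ofReal (|f (ψK 4 (qK 4)) - f (ψK 4 (qK j))| ^ p) +
        if j = 4 then 0 else ∑ k, ENNReal.ofReal (|f (ψK j (qK 4)) - f (ψK j (qK k))| ^ p)) := by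
  by_cases hj : j = 4
  · subst hj
    rw [sub_self, abs_zero, Real.zero_rpow (by positivity), ENNReal.ofReal_zero]
    exact zero_le
  rw [if_neg hj]
  have hpair : ENNReal.ofReal (|f (ψK j (qK 4)) - f (ψK j (qK (opp j)))| ^ p) +
      ENNReal.ofReal (|f (ψK j (qK 4)) - f (ψK j (qK j))| ^ p) ≤
      ∑ k, ENNReal.ofReal (|f (ψK j (qK 4)) - f (ψK j (qK k))| ^ p) := by
    have hne : opp j ≠ j := by revert j; decide
    rw [← Finset.sum_pair hne
      (f := fun k => ENNReal.ofReal (|f (ψK j (qK 4)) - f (ψK j (qK k))| ^ p))]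
    exact Finset.sum_le_sum_of_subset (Finset.subset_univ _)
  refine le_trans ?_ (mul_le_mul_right (add_le_add_right hpair _) _)
  rw [← ENNReal.ofReal_add (by positivity) (by positivity),
    ← ENNReal.ofReal_add (by positivity) (by positivity), ← ENNReal.ofReal_mul (by positivity)]
  refine ENNReal.ofReal_le_ofReal (le_trans ?_ (add_three_rpow_le hp (abs_nonneg _) (abs_nonneg _)
    (abs_nonneg _)))
  refine Real.rpow_le_rpow (abs_nonneg _) ?_ (by linarith)
  rw [ψK_qK, ψK_qK, ψK_four_qK, abs_sub_comm (f (ψK j (qK 4))) (f (ψK j (qK (opp j))))]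
  refine le_trans (le_of_eq ?_) ((abs_add_le _ _).trans (add_le_add_right (abs_add_le _ _) _))
  congr 1; ring

/-- The four coarse edges use disjoint sets of fine edges, so the refined bounds add up without
repetition. -/
theorem wordEnergy_zero_le {p : ℝ} (hp : 1 ≤ p) (f : K → ℝ) :
    wordEnergy p 0 f ≤ wordEnergy p 1 f := by
  rw [wordEnergy_succ]
  simp only [wordEnergy, pow_zero, Real.one_rpow, ENNReal.ofReal_one, one_mul, edgeSum_zero,
    Function.comp]
  refine (Finset.sum_le_sum fun j _ => edge_le_refined hp f j).trans (le_of_eq ?_)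
  rw [← Finset.mul_sum, Finset.sum_add_distrib]
  congr 1
  rw [Fin.sum_univ_five (f := fun i => ∑ k, ENNReal.ofReal (|f (ψK i (qK 4)) - f (ψK i (qK k))| ^ p)),
    Fin.sum_univ_five (f := fun j => if j = 4 then 0 else _)]
  have h0 : (0 : Fin 5) ≠ 4 := by decide
  have h1 : (1 : Fin 5) ≠ 4 := by decide
  have h2 : (2 : Fin 5) ≠ 4 := by decide
  have h3 : (3 : Fin 5) ≠ 4 := by decide
  simp only [h0, h1, h2, h3, if_true, if_false]
  ring

theorem wordEnergy_mono {p : ℝ} (hp : 1 ≤ p) (f : K → ℝ) :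
    Monotone fun m => wordEnergy p m f := by
  refine monotone_nat_of_le_succ fun m => ?_
  induction m generalizing f with
  | zero => exact wordEnergy_zero_le hp f
  | succ m ih =>
    rw [wordEnergy_succ, wordEnergy_succ]
    gcongr
    exact ih _

/-- The limit of the discrete energies. -/
noncomputable def limEnergy (p : ℝ) (f : K → ℝ) : ℝ≥0∞ := ⨆ m, wordEnergy p m f

theorem tendsto_discreteEnergy {p : ℝ} (hp : 1 ≤ p) (f : K → ℝ) :
    Tendsto (fun m => discreteEnergy p m f) atTop (𝓝 (limEnergy p f)) := by
  simp only [discreteEnergy_eq hp]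
  exact tendsto_atTop_iSup (wordEnergy_mono hp f)

theorem pEnergy_eq {p : ℝ} (hp : 1 ≤ p) (f : K → ℝ) : pEnergy p f = limEnergy p f :=
  (tendsto_discreteEnergy hp f).limUnder_eq

/-- The recursion `wordEnergy_succ` passes to the monotone limit. -/
theorem limEnergy_eq_sum {p : ℝ} (hp : 1 ≤ p) (f : K → ℝ) :
    limEnergy p f = ENNReal.ofReal (3 ^ (p - 1)) * ∑ i, limEnergy p (f ∘ ψK i) := by
  refine tendsto_nhds_unique
    ((tendsto_add_atTop_iff_nat 1).2 (tendsto_atTop_iSup (wordEnergy_mono hp f))) ?_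
  simp only [wordEnergy_succ]
  refine ENNReal.Tendsto.const_mul (tendsto_finsetSum _ fun i _ => ?_)
    (Or.inr ENNReal.ofReal_ne_top)
  exact tendsto_atTop_iSup (wordEnergy_mono hp _)

theorem limEnergy_eq_sum_word {p : ℝ} (hp : 1 ≤ p) (m : ℕ) (f : K → ℝ) :
    limEnergy p f = ENNReal.ofReal ((3 ^ m) ^ (p - 1)) * ∑ w : Word m, limEnergy p (f ∘ φ w) := by
  induction m generalizing f with
  | zero =>
    rw [pow_zero, Real.one_rpow, ENNReal.ofReal_one, one_mul]
    exact (Fintype.sum_unique (ι := Unit) fun _ => limEnergy p f).symm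
  | succ m ih =>
    rw [limEnergy_eq_sum hp, sum_word_succ]
    rw [Finset.sum_congr rfl fun i _ => ih (f ∘ ψK i), ← Finset.mul_sum, ← mul_assoc, ← ENNReal.ofReal_mul (by positivity), pow_succ,
      Real.mul_rpow (by positivity) (by norm_num), mul_comm (3 ^ (p - 1) : ℝ)]
    rfl

theorem limEnergy_comp_le {p : ℝ} (hp : 1 ≤ p) (f : K → ℝ) (i : Fin 5) :
    limEnergy p (f ∘ ψK i) ≤ ENNReal.ofReal (3 ^ (-(p - 1))) * limEnergy p f := by
  rw [limEnergy_eq_sum hp f, ← mul_assoc, ← ENNReal.ofReal_mul (by positivity),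
    ← Real.rpow_add (by norm_num), neg_add_cancel, Real.rpow_zero, ENNReal.ofReal_one, one_mul]
  exact Finset.single_le_sum (f := fun i => limEnergy p (f ∘ ψK i)) (fun _ _ => zero_le)
    (Finset.mem_univ i)

theorem edge_le_limEnergy {p : ℝ} (hp : 1 ≤ p) (f : K → ℝ) (i : Fin 5) :
    ENNReal.ofReal |f (qK 4) - f (qK i)| ≤ limEnergy p f ^ (1 / p) := by
  have h1 : ENNReal.ofReal (|f (qK 4) - f (qK i)| ^ p) ≤ limEnergy p f := by
    refine le_trans ?_ (le_iSup (fun m => wordEnergy p m f) 0)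
    simp only [wordEnergy, pow_zero, Real.one_rpow, ENNReal.ofReal_one, one_mul, edgeSum_zero]
    exact Finset.single_le_sum
      (f := fun i => ENNReal.ofReal (|f (qK 4) - f (qK i)| ^ p)) (fun _ _ => zero_le)
      (Finset.mem_univ i)
  rw [one_div, ENNReal.le_rpow_inv_iff (by linarith), ENNReal.ofReal_rpow_of_nonneg (abs_nonneg _)
    (by linarith)]
  exact h1

/-! ### The Morrey inequality and the upper bound of the Korevaar-Schoen energy. -/

/-- The ratio of the geometric series in the Morrey inequality. -/
noncomputable def ratio (p : ℝ) : ℝ := 3 ^ (-(p - 1) / p)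

theorem ratio_pos (p : ℝ) : 0 < ratio p := by unfold ratio; positivity

theorem ratio_lt_one {p : ℝ} (hp : 1 < p) : ratio p < 1 := by
  refine Real.rpow_lt_one_of_one_lt_of_neg (by norm_num) ?_
  exact div_neg_of_neg_of_pos (by linarith) (by linarith)

theorem limEnergy_comp_rpow_le {p : ℝ} (hp : 1 ≤ p) (f : K → ℝ) (i : Fin 5) :
    limEnergy p (f ∘ ψK i) ^ (1 / p) ≤ ENNReal.ofReal (ratio p) * limEnergy p f ^ (1 / p) := by
  have hp' : 0 ≤ 1 / p := by positivity
  refine (ENNReal.rpow_le_rpow (limEnergy_comp_le hp f i) hp').trans (le_of_eq ?_)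
  rw [ENNReal.mul_rpow_of_nonneg _ _ hp', ENNReal.ofReal_rpow_of_nonneg (by positivity) hp',
    ← Real.rpow_mul (by norm_num), mul_one_div, ratio]

theorem ofReal_abs_sub_le (a b c : ℝ) :
    ENNReal.ofReal |a - c| ≤ ENNReal.ofReal |a - b| + ENNReal.ofReal |b - c| := by
  rw [← ENNReal.ofReal_add (abs_nonneg _) (abs_nonneg _)]
  exact ENNReal.ofReal_le_ofReal (abs_sub_le a b c)

/-- For an outer cell, two edges of level one join its center to the center of `K`, through the
vertex it shares with the central cell. -/
theorem center_sub_le {p : ℝ} (hp : 1 ≤ p) (f : K → ℝ) (i : Fin 5) :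
    ENNReal.ofReal |f (ψK i (qK 4)) - f (qK 4)| ≤ ENNReal.ofReal 2 * limEnergy p f ^ (1 / p) := by
  by_cases hi : i = 4
  · subst hi
    rw [ψK_qK, sub_self, abs_zero, ENNReal.ofReal_zero]
    exact zero_le
  have hr : ENNReal.ofReal (ratio p) ≤ 1 := by
    rw [← ENNReal.ofReal_one]
    refine ENNReal.ofReal_le_ofReal (Real.rpow_le_one_of_one_le_of_nonpos (by norm_num) ?_)
    exact div_nonpos_of_nonpos_of_nonneg (by linarith) (by linarith)
  have hcomp : ∀ j, limEnergy p (f ∘ ψK j) ^ (1 / p) ≤ limEnergy p f ^ (1 / p) := fun j =>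
    (limEnergy_comp_rpow_le hp f j).trans (mul_le_of_le_one_left' hr)
  have h1 := (edge_le_limEnergy hp (f ∘ ψK i) (opp i)).trans (hcomp i)
  have h2 := (edge_le_limEnergy hp (f ∘ ψK 4) i).trans (hcomp 4)
  simp only [Function.comp] at h1 h2
  rw [ψK_qK, ψK_four_qK i, abs_sub_comm] at h2
  refine (ofReal_abs_sub_le _ (f (ψK i (qK (opp i)))) _).trans ((add_le_add h1 h2).trans
    (le_of_eq ?_))
  rw [← two_mul]; norm_num

/-- The constant of the Morrey inequality. -/
noncomputable def constM (p : ℝ) : ℝ := 2 / (1 - ratio p)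

theorem constM_pos {p : ℝ} (hp : 1 < p) : 0 < constM p :=
  div_pos two_pos (by linarith [ratio_lt_one hp])

/-- Passing to a subcell multiplies the `p`-th root of the limit energy by at most `ratio p < 1`.
The constant is the solution of `M * ratio p + 2 = M`. -/
theorem morrey_center {p : ℝ} (hp : 1 < p) {n : ℕ} (w : Word n) (f : K → ℝ) :
    ENNReal.ofReal |f (φ w (qK 4)) - f (qK 4)| ≤
      ENNReal.ofReal (constM p) * limEnergy p f ^ (1 / p) := by
  induction n generalizing f with
  | zero => simp [φ]
  | succ n ih =>
    have h1 := (ih w.2 (f ∘ ψK w.1)).trans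
      (mul_le_mul_right (limEnergy_comp_rpow_le hp.le f w.1) _)
    have h2 := center_sub_le hp.le f w.1
    refine (ofReal_abs_sub_le _ (f (ψK w.1 (qK 4))) _).trans ((add_le_add h1 h2).trans
      (le_of_eq ?_))
    have hM := constM_pos hp
    have hr := ratio_pos p
    rw [← mul_assoc, ← add_mul, ← ENNReal.ofReal_mul hM.le, ← ENNReal.ofReal_add (by positivity)
      (by norm_num)]
    congr 2
    have : 1 - ratio p ≠ 0 := by linarith [ratio_lt_one hp]
    unfold constM
    field_simp
    ring

theorem exists_tendsto_cell (x : K) : ∃ w : (n : ℕ) → Word n, ∀ n, x ∈ cell (w n) :=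
  ⟨fun n => (exists_mem_cell n x).choose, fun n => (exists_mem_cell n x).choose_spec⟩

theorem tendsto_of_mem_cell {x : K} {w : (n : ℕ) → Word n} (hw : ∀ n, x ∈ cell (w n))
    {z : ℕ → K} (hz : ∀ n, z n ∈ cell (w n)) : Tendsto z atTop (𝓝 x) := by
  rw [tendsto_iff_dist_tendsto_zero]
  have : Tendsto (fun n : ℕ => (2 : ℝ) / 3 ^ n) atTop (𝓝 0) :=
    tendsto_const_nhds.div_atTop (tendsto_pow_atTop_atTop_of_one_lt (by norm_num))
  exact squeeze_zero (fun _ => dist_nonneg) (fun n => dist_le_of_mem_cell (hz n) (hw n)) this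

/-- The Morrey inequality. -/
theorem morrey {p : ℝ} (hp : 1 < p) {f : K → ℝ} (hf : Continuous f) (x : K) :
    ENNReal.ofReal (|f x - f (qK 4)| ^ p) ≤ ENNReal.ofReal (constM p ^ p) * limEnergy p f := by
  obtain ⟨w, hw⟩ := exists_tendsto_cell x
  have ht := tendsto_of_mem_cell hw fun n => ctr_mem (w n)
  have h1 : ENNReal.ofReal |f x - f (qK 4)| ≤
      ENNReal.ofReal (constM p) * limEnergy p f ^ (1 / p) := by
    refine le_of_tendsto ((ENNReal.continuous_ofReal.tendsto _).comp
      ((((hf.tendsto x).comp ht).sub_const _).abs)) (Eventually.of_forall fun n => ?_)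
    exact morrey_center hp (w n) f
  have hp0 : 0 ≤ p := by linarith
  have h2 := ENNReal.rpow_le_rpow h1 hp0
  rwa [ENNReal.mul_rpow_of_nonneg _ _ hp0, ENNReal.ofReal_rpow_of_nonneg (abs_nonneg _) hp0,
    ENNReal.ofReal_rpow_of_nonneg (constM_pos hp).le hp0, ← ENNReal.rpow_mul,
    one_div_mul_cancel (by linarith), ENNReal.rpow_one] at h2

/-- The energy at small scales is bounded by the `p`-energy. -/
theorem energy_le_limEnergy {p : ℝ} (hp : 1 < p) {f : K → ℝ} (hf : Continuous f) {r : ℝ}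
    (hr0 : 0 < r) (hr1 : r < 1) : energy geodesicDist μ p (αExp p) f r ≤
      ENNReal.ofReal (constO p * (2 ^ p * constM p ^ p)) * limEnergy p f := by
  obtain ⟨m, hm1, hm2⟩ := exists_scale hr0 hr1
  have hM := constM_pos hp
  have hO := constO_pos p
  refine (energy_le_of_osc hp.le hf.measurable
    (fun w : Word m => ENNReal.ofReal (2 ^ p * constM p ^ p) * limEnergy p (f ∘ φ w))
    ?_ hm1 hm2).trans (le_of_eq ?_)
  · rintro w _ ⟨x, rfl⟩ _ ⟨y, rfl⟩
    have hfw : Continuous (f ∘ φ w) := hf.comp (continuous_φ w)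
    refine (ofReal_rpow_triangle hp.le _ (f (φ w (qK 4))) _).trans ?_
    rw [abs_sub_comm (f (φ w (qK 4)))]
    refine (mul_le_mul_right (add_le_add (morrey hp hfw x) (morrey hp hfw y)) _).trans
      (le_of_eq ?_)
    have h2 : (2 : ℝ) ^ p = 2 ^ (p - 1) * 2 := by
      rw [Real.rpow_sub_one (by norm_num)]; ring
    rw [← two_mul, ← mul_assoc, ← mul_assoc, h2, ENNReal.ofReal_mul (by positivity),
      ENNReal.ofReal_mul (by positivity), ENNReal.ofReal_ofNat]
  -- Self-similarity supplies exactly the factor `(3 ^ m) ^ (p - 1)` present in `energy_le_of_osc`.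
  · rw [limEnergy_eq_sum_word hp.le m f, ← Finset.mul_sum, ← mul_assoc, ← mul_assoc,
      ← ENNReal.ofReal_mul (by positivity), ← ENNReal.ofReal_mul (by positivity)]
    congr 2
    ring

/-! ### The discrete energies bounded by the lower limit of the energies. -/

/-- A minimiser over the compact product of the cells is below the mean value. -/
theorem exists_le_J {p : ℝ} (hp : 1 ≤ p) {f : K → ℝ} (hf : Continuous f) {m : ℕ} (a b : Word m) :
    ∃ x ∈ cell a, ∃ y ∈ cell b, ENNReal.ofReal (|f y - f x| ^ p) ≤
      ENNReal.ofReal (5 ^ m * 5 ^ m) * J p f (cell a) (cell b) := by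
  obtain ⟨z, hz, hmin⟩ := ((isCompact_cell a).prod (isCompact_cell b)).exists_isMinOn
    ⟨(ctr a, ctr b), ctr_mem a, ctr_mem b⟩
    (f := fun z : K × K => |f z.2 - f z.1|) (by fun_prop)
  refine ⟨z.1, hz.1, z.2, hz.2, ?_⟩
  set c := ENNReal.ofReal (|f z.2 - f z.1| ^ p)
  have h1 : c * (5⁻¹ ^ m * 5⁻¹ ^ m) ≤ J p f (cell a) (cell b) := by
    unfold J
    calc c * (5⁻¹ ^ m * 5⁻¹ ^ m) = ∫⁻ x in cell a, c * 5⁻¹ ^ m ∂μ := by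
          rw [lintegral_const, Measure.restrict_apply_univ, μ_cell, mul_assoc]
      _ ≤ _ := by
          refine setLIntegral_mono' (measurableSet_cell a) fun x hx => ?_
          calc c * 5⁻¹ ^ m = ∫⁻ y in cell b, c ∂μ := by
                rw [lintegral_const, Measure.restrict_apply_univ, μ_cell]
            _ ≤ _ := by
                refine setLIntegral_mono' (measurableSet_cell b) fun y hy => ?_
                refine ENNReal.ofReal_le_ofReal (Real.rpow_le_rpow (abs_nonneg _) ?_ (by linarith))
                exact hmin (Set.mk_mem_prod hx hy)
  have h5 : ENNReal.ofReal (5 ^ m * 5 ^ m) * (5⁻¹ ^ m * 5⁻¹ ^ m) = 1 := by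
    rw [← ofReal_inv_five_pow, ← ENNReal.ofReal_mul (by positivity),
      ← ENNReal.ofReal_mul (by positivity), mul_mul_mul_comm, ← mul_pow]
    norm_num
  calc c = ENNReal.ofReal (5 ^ m * 5 ^ m) * (c * (5⁻¹ ^ m * 5⁻¹ ^ m)) := by
        rw [mul_left_comm, h5, mul_one]
    _ ≤ _ := by gcongr

theorem dist_qK_le (i : Fin 5) : dist (qK 4) (qK i) ≤ 1 := by
  change dist (q 4) (q i) ≤ 1
  rw [q_four, dist_zero_left]
  exact norm_q_le i

open Classical in
/-- The sum over the edges of a level of the oscillations between finer cells that contain their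
end points. -/
theorem sum_edge_J_le {p : ℝ} (hp : 1 ≤ p) {f : K → ℝ} (hf : Measurable f) {n m : ℕ}
    (hnm : n ≤ m) (a : Word n → Word m) (b : Word n × Fin 5 → Word m)
    (ha : ∀ w, φ w (qK 4) ∈ cell (a w)) (hb : ∀ t, φ t.1 (qK t.2) ∈ cell (b t)) :
    ∑ t : Word n × Fin 5, J p f (cell (a t.1)) (cell (b t)) ≤
      ENNReal.ofReal (2 * (14 * (1 / 3 ^ n * 3 ^ m)) ^ (p - 1) * 5 ^ 11) * touchSum p f m := by
  set r : ℝ := 1 / 3 ^ n with hr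
  have hr0 : 0 < r := by positivity
  have hrm : 1 / 3 ^ m ≤ r := by
    rw [hr]; gcongr; norm_num
  set L := ENNReal.ofReal (2 * (14 * (r * 3 ^ m)) ^ (p - 1)) with hL
  calc _ ≤ ∑ t : Word n × Fin 5, L * ∑ e ∈ touchNear r (a t.1) (b t),
        J p f (cell e.1) (cell e.2) := by
        refine Finset.sum_le_sum fun t _ => ?_
        refine J_le_sum_touchNear hp hf hrm (ha t.1) (hb t) ?_
        rw [dist_φ, hr]
        have := dist_qK_le t.2
        gcongr
    _ ≤ L * ∑ t : Word n × Fin 5, ∑ e : Word m × Word m with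
        Touch e.1 e.2 ∧ dist (ctr (a t.1)) (ctr e.1) ≤ 17 * r, J p f (cell e.1) (cell e.2) := by
        rw [Finset.mul_sum]
        gcongr with t _
        unfold touchNear
        intro e he
        have := (Finset.mem_filter.1 he).2
        exact Finset.mem_filter.2 ⟨Finset.mem_univ _, this.1, this.2.1⟩
    _ = L * ∑ e : Word m × Word m with Touch e.1 e.2,
        ∑ t : Word n × Fin 5 with dist (ctr (a t.1)) (ctr e.1) ≤ 17 * r,
          J p f (cell e.1) (cell e.2) := by
        congr 1
        refine Finset.sum_comm' fun t e => ?_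
        simp only [Finset.mem_filter, Finset.mem_univ, true_and]
        tauto
    _ ≤ L * ∑ e : Word m × Word m with Touch e.1 e.2,
        ENNReal.ofReal (5 ^ 11) * J p f (cell e.1) (cell e.2) := by
        gcongr with e he
        rw [Finset.sum_const, nsmul_eq_mul]
        gcongr
        -- Passing from `ctr (a t.1)` to `ctr t.1` is absorbed by doubling the radius; the count is
        -- then at most `5 ^ 9 * 2 ^ dh * 5 ≤ 5 ^ 11`.
        have hsub : (Finset.univ.filter fun t : Word n × Fin 5 =>
            dist (ctr (a t.1)) (ctr e.1) ≤ 17 * r) ⊆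
            (Finset.univ.filter fun w : Word n => dist (ctr w) (ctr e.1) ≤ 17 * (2 * r)) ×ˢ
              Finset.univ := by
          intro t ht
          have h1 := (Finset.mem_filter.1 ht).2
          have h2 := dist_le_of_mem_cell (ha t.1) (ctr_mem (a t.1))
          have h3 := dist_triangle (ctr t.1) (ctr (a t.1)) (ctr e.1)
          have h4 : (2 : ℝ) / 3 ^ m = 2 * (1 / 3 ^ m) := by ring
          rw [Finset.mem_product]
          refine ⟨Finset.mem_filter.2 ⟨Finset.mem_univ _, ?_⟩, Finset.mem_univ _⟩
          change dist (ctr t.1) (ctr (a t.1)) ≤ _ at h2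
          linarith
        have hcard := card_near_le (m := n) (r := 2 * r) (by rw [← hr]; linarith) (ctr e.1)
        have h2r : 2 * r * 3 ^ n = 2 := by rw [hr]; field_simp
        rw [h2r] at hcard
        have h2 : (2 : ℝ) ^ dh ≤ 5 := by
          rw [← three_rpow_dh]
          exact Real.rpow_le_rpow (by norm_num) (by norm_num) dh_pos.le
        have h6 := Finset.card_le_card hsub
        rw [Finset.card_product, Finset.card_univ, Fintype.card_fin] at h6
        have h7 : ((Finset.univ.filter fun t : Word n × Fin 5 =>
            dist (ctr (a t.1)) (ctr e.1) ≤ 17 * r).card : ℝ≥0∞) ≤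
            (Finset.univ.filter fun w : Word n => dist (ctr w) (ctr e.1) ≤ 17 * (2 * r)).card *
              (5 : ℝ≥0∞) := by exact_mod_cast h6
        refine h7.trans ((mul_le_mul_left hcard _).trans ?_)
        have h8 : (5 : ℝ≥0∞) = ENNReal.ofReal 5 := by norm_num
        rw [h8, ← ENNReal.ofReal_mul (by positivity)]
        refine ENNReal.ofReal_le_ofReal ?_
        nlinarith
    _ = _ := by
        rw [← Finset.mul_sum, ← mul_assoc, hL, ← ENNReal.ofReal_mul (by positivity)]
        rfl

/-- The constant of `wordEnergy_le_liminf`. -/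
noncomputable def constE (p : ℝ) : ℝ :=
  2 * 14 ^ (p - 1) * 5 ^ 19 * 5 ^ θ p * (125 * constH p)

theorem constE_pos (p : ℝ) : 0 < constE p := by
  have := constH_pos p
  unfold constE; positivity

/-- With `n` fixed, each edge difference is the limit, as `m → ∞`, of differences between points of
cells of level `m` around its end points. Chaining at level `m` bounds these by the energy at scale
`5 / 3 ^ m`, with a constant independent of `m` and `n`. -/
theorem wordEnergy_le_liminf {p : ℝ} (hp : 1 ≤ p) {f : K → ℝ} (hf : Continuous f) (n : ℕ) :
    wordEnergy p n f ≤ ENNReal.ofReal (constE p) *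
      liminf (energy geodesicDist μ p (αExp p) f) (𝓝[>] 0) := by
  set Λ := liminf (energy geodesicDist μ p (αExp p) f) (𝓝[>] 0)
  have hE : ∀ r : ℝ, 0 < r → energy geodesicDist μ p (αExp p) f r ≤
      ENNReal.ofReal (125 * constH p) * Λ := fun r hr =>
    (le_iSup₂ (f := fun (r : ℝ) (_ : 0 < r) => energy geodesicDist μ p (αExp p) f r) r hr).trans
      (iSup_energy_le hp hf.aemeasurable)
  have hH := constH_pos p
  choose A hA using fun w : Word n => exists_tendsto_cell (φ w (qK 4))
  choose B hB using fun t : Word n × Fin 5 => exists_tendsto_cell (φ t.1 (qK t.2))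
  choose x hx y hy hxy using fun (t : Word n × Fin 5) (m : ℕ) =>
    exists_le_J hp hf (A t.1 m) (B t m)
  have hlim : Tendsto (fun m => ENNReal.ofReal ((3 ^ n) ^ (p - 1)) * ∑ t : Word n × Fin 5,
      ENNReal.ofReal (|f (y t m) - f (x t m)| ^ p)) atTop (𝓝 (wordEnergy p n f)) := by
    have e : edgeSum p n f = ∑ t : Word n × Fin 5,
        ENNReal.ofReal (|f (φ t.1 (qK t.2)) - f (φ t.1 (qK 4))| ^ p) := by
      rw [Fintype.sum_prod_type, edgeSum]
      simp only [abs_sub_comm]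
    rw [wordEnergy, e]
    refine ENNReal.Tendsto.const_mul (tendsto_finsetSum _ fun t _ => ?_)
      (Or.inr ENNReal.ofReal_ne_top)
    have h1 := (hf.tendsto _).comp (tendsto_of_mem_cell (hA t.1) (hx t))
    have h2 := (hf.tendsto _).comp (tendsto_of_mem_cell (hB t) (hy t))
    have h3 := ((h2.sub h1).abs.rpow_const (p := p) (Or.inr (by linarith)))
    exact (ENNReal.continuous_ofReal.tendsto _).comp h3
  refine le_of_tendsto hlim ?_
  filter_upwards [eventually_ge_atTop n] with m hm
  have h3 : (0 : ℝ) < 3 ^ m := by positivity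
  calc _ ≤ ENNReal.ofReal ((3 ^ n) ^ (p - 1)) * ∑ t : Word n × Fin 5,
        ENNReal.ofReal (5 ^ m * 5 ^ m) * J p f (cell (A t.1 m)) (cell (B t m)) := by
        gcongr with t _
        exact hxy t m
    _ ≤ ENNReal.ofReal ((3 ^ n) ^ (p - 1)) * (ENNReal.ofReal (5 ^ m * 5 ^ m) *
        (ENNReal.ofReal (2 * (14 * (1 / 3 ^ n * 3 ^ m)) ^ (p - 1) * 5 ^ 11) *
        (ENNReal.ofReal (5 ^ 8 * (5 / 3 ^ m) ^ θ p) * (ENNReal.ofReal (125 * constH p) * Λ)))) := by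
        rw [← Finset.mul_sum]
        gcongr
        refine (sum_edge_J_le hp hf.measurable hm (fun w => A w m) (fun t => B t m)
          (fun w => hA w m) (fun t => hB t m)).trans ?_
        gcongr
        refine (touchSum_le_energy hp hf.measurable le_rfl).trans ?_
        gcongr
        exact hE _ (by positivity)
    _ = _ := by
        rw [← mul_assoc, ← mul_assoc, ← mul_assoc, ← mul_assoc, ← ENNReal.ofReal_mul (by positivity),
          ← ENNReal.ofReal_mul (by positivity), ← ENNReal.ofReal_mul (by positivity),
          ← ENNReal.ofReal_mul (by positivity)]
        congr 2
        -- The chaining cost, the cell masses and the normalisation of the energy cancel in all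
        -- powers of `3 ^ m`, `5 ^ m` and `3 ^ n`.
        have e1 : (14 * (1 / 3 ^ n * 3 ^ m) : ℝ) ^ (p - 1) =
            14 ^ (p - 1) * ((3 ^ m) ^ (p - 1) / (3 ^ n) ^ (p - 1)) := by
          rw [Real.mul_rpow (by norm_num) (by positivity), one_div_mul_eq_div,
            Real.div_rpow (by positivity) (by positivity)]
        have e2 : (5 / 3 ^ m : ℝ) ^ θ p = 5 ^ θ p / (5 ^ m * 5 ^ m * (3 ^ m) ^ (p - 1)) := by
          rw [Real.div_rpow (by norm_num) (by positivity)]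
          congr 1
          rw [θ, Real.rpow_add (by positivity), two_mul, Real.rpow_add (by positivity),
            three_pow_rpow_dh]
        rw [e1, e2, constE]
        have h4 : ((3 : ℝ) ^ m) ^ (p - 1) ≠ 0 := by positivity
        have h5 : ((3 : ℝ) ^ n) ^ (p - 1) ≠ 0 := by positivity
        field_simp

theorem limEnergy_le_liminf {p : ℝ} (hp : 1 ≤ p) {f : K → ℝ} (hf : Continuous f) :
    limEnergy p f ≤ ENNReal.ofReal (constE p) *
      liminf (energy geodesicDist μ p (αExp p) f) (𝓝[>] 0) :=
  iSup_le fun n => wordEnergy_le_liminf hp hf n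

theorem liminf_le_limEnergy {p : ℝ} (hp : 1 < p) {f : K → ℝ} (hf : Continuous f) :
    liminf (energy geodesicDist μ p (αExp p) f) (𝓝[>] 0) ≤
      ENNReal.ofReal (constO p * (2 ^ p * constM p ^ p)) * limEnergy p f := by
  refine liminf_le_of_frequently_le' (Eventually.frequently ?_)
  filter_upwards [Ioo_mem_nhdsGT (zero_lt_one (α := ℝ))] with r hr
  exact energy_le_limEnergy hp hf hr.1 hr.2

/-- The power `1 / p` is an order isomorphism of `[0, ∞]`, hence commutes with the lower limit. -/
theorem variation_rpow {p : ℝ} (hp : 1 ≤ p) (f : K → ℝ) :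
    variation geodesicDist μ p (αExp p) f ^ p =
      liminf (energy geodesicDist μ p (αExp p) f) (𝓝[>] 0) := by
  have hp0 : 0 < 1 / p := by positivity
  have h := (ENNReal.orderIsoRpow (1 / p) hp0).liminf_apply
    (f := (𝓝[>] (0 : ℝ))) (u := energy geodesicDist μ p (αExp p) f)
  simp only [ENNReal.orderIsoRpow_apply] at h
  rw [variation, ← h, ← ENNReal.rpow_mul, one_div_mul_cancel (by linarith), ENNReal.rpow_one]

theorem limEnergy_equiv {p : ℝ} (hp : 1 < p) : ∃ c C : ℝ, 0 < c ∧ 0 < C ∧ ∀ f : C(K, ℝ),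
    ENNReal.ofReal c * variation geodesicDist μ p (αExp p) f ^ p ≤ pEnergy p f ∧
      pEnergy p f ≤ ENNReal.ofReal C * variation geodesicDist μ p (αExp p) f ^ p := by
  have hM := constM_pos hp
  have hO := constO_pos p
  have hpos : 0 < constO p * (2 ^ p * constM p ^ p) := by positivity
  refine ⟨(constO p * (2 ^ p * constM p ^ p))⁻¹, constE p, inv_pos.2 hpos, constE_pos p,
    fun f => ?_⟩
  rw [variation_rpow hp.le, pEnergy_eq hp.le]
  refine ⟨?_, limEnergy_le_liminf hp.le f.continuous⟩
  rw [ENNReal.ofReal_inv_of_pos hpos, ENNReal.inv_mul_le_iff _ ENNReal.ofReal_ne_top]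
  · exact liminf_le_limEnergy hp f.continuous
  · rwa [Ne, ENNReal.ofReal_eq_zero, not_le]

/-! ### Averages over balls and continuous versions. -/

theorem convexOn_abs_sub_rpow {p : ℝ} (hp : 1 ≤ p) (c : ℝ) :
    ConvexOn ℝ Set.univ fun t : ℝ => |t - c| ^ p := by
  refine ⟨convex_univ, fun x _ y _ a b ha hb hab => ?_⟩
  refine le_trans ?_ ((convexOn_rpow hp).2 (abs_nonneg (x - c)) (abs_nonneg (y - c)) ha hb hab)
  refine Real.rpow_le_rpow (abs_nonneg _) ?_ (by linarith)
  simp only [smul_eq_mul]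
  have h1 : a * x + b * y - c = a * (x - c) + b * (y - c) := by
    linear_combination c * hab
  rw [h1]
  refine (abs_add_le _ _).trans ?_
  rw [abs_mul, abs_mul, abs_of_nonneg ha, abs_of_nonneg hb]

/-- Jensen's inequality for `t ↦ |t - c| ^ p`, freed of the division by `μ A`. -/
theorem ofReal_abs_average_sub_mul_le {p : ℝ} (hp : 1 ≤ p) {g : K → ℝ}
    (hg : MemLp g (ENNReal.ofReal p) μ) {A : Set K} (hA : μ A ≠ 0) (c : ℝ) :
    ENNReal.ofReal (|(⨍ y in A, g y ∂μ) - c| ^ p) * μ A ≤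
      ∫⁻ y in A, ENNReal.ofReal (|g y - c| ^ p) ∂μ := by
  have hA' : μ A ≠ ∞ := measure_ne_top μ A
  have hp1 : 1 ≤ ENNReal.ofReal p := by
    rw [← ENNReal.ofReal_one]; exact ENNReal.ofReal_le_ofReal hp
  have hint : Integrable (fun y => |g y - c| ^ p) μ := by
    have h1 : MemLp (fun y => g y - c) (ENNReal.ofReal p) μ := hg.sub (memLp_const c)
    have h2 := h1.integrable_norm_rpow (by positivity) ENNReal.ofReal_ne_top
    rwa [ENNReal.toReal_ofReal (by linarith)] at h2
  have hcont : Continuous fun t : ℝ => |t - c| ^ p :=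
    (continuous_id.sub continuous_const).abs.rpow_const fun _ => Or.inr (by linarith)
  have hJ := (convexOn_abs_sub_rpow hp c).map_set_average_le hcont.continuousOn isClosed_univ
    hA hA' (f := g) (by simp) (hg.integrable hp1).integrableOn hint.integrableOn
  have e : ENNReal.ofReal (⨍ y in A, |g y - c| ^ p ∂μ) * μ A =
      ∫⁻ y in A, ENNReal.ofReal (|g y - c| ^ p) ∂μ := by
    rw [← ofReal_integral_eq_lintegral_ofReal hint.integrableOn
      (Eventually.of_forall fun _ => by positivity), setAverage_eq, smul_eq_mul,
      ← ENNReal.ofReal_toReal hA', ← ENNReal.ofReal_mul' ENNReal.toReal_nonneg]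
    congr 1
    rw [Measure.real, mul_right_comm,
      inv_mul_cancel₀ (ENNReal.toReal_ne_zero.2 ⟨hA, hA'⟩), one_mul]
  rw [← e]
  gcongr

theorem ofReal_abs_average_sub_average_mul_le {p : ℝ} (hp : 1 ≤ p) {g : K → ℝ}
    (hg : MemLp g (ENNReal.ofReal p) μ) {A B : Set K} (hA : μ A ≠ 0) (hB : μ B ≠ 0) :
    ENNReal.ofReal (|(⨍ y in B, g y ∂μ) - ⨍ x in A, g x ∂μ| ^ p) * (μ A * μ B) ≤
      J p g A B := by
  rw [abs_sub_comm, ← mul_assoc]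
  refine (mul_le_mul_left (ofReal_abs_average_sub_mul_le hp hg hA _) _).trans ?_
  rw [← lintegral_mul_const' _ _ (measure_ne_top μ B)]
  refine lintegral_mono fun x => ?_
  rw [abs_sub_comm]
  exact ofReal_abs_average_sub_mul_le hp hg hB _

theorem ofReal_le_μ_metricBall (x : K) (n : ℕ) :
    ENNReal.ofReal ((125 * 5 ^ n)⁻¹) ≤ μ (Metric.ball x (1 / 3 ^ n)) := by
  have h1 : (1 : ℝ) / 3 ^ n ≤ 3 := by
    rw [div_le_iff₀ (by positivity)]
    have : (1 : ℝ) ≤ 3 ^ n := one_le_pow₀ (by norm_num)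
    linarith
  refine le_trans (le_of_eq ?_) ((ofReal_le_μ_ball x (by positivity) h1).trans
    (measure_mono (ball_subset x _)))
  rw [Real.div_rpow (by norm_num) (by positivity), three_pow_rpow_dh, Real.one_rpow]
  congr 1
  field_simp

theorem μ_metricBall_ne_zero (x : K) (n : ℕ) : μ (Metric.ball x (1 / 3 ^ n)) ≠ 0 :=
  (Metric.measure_ball_pos μ x (by positivity)).ne'

theorem J_le_H {p : ℝ} {g : K → ℝ} {A B : Set K} {r : ℝ} (hA : MeasurableSet A)
    (h : ∀ x ∈ A, B ⊆ Metric.ball x r) : J p g A B ≤ H p g r := by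
  calc J p g A B ≤ ∫⁻ x in A, ∫⁻ y in Metric.ball x r, ENNReal.ofReal (|g y - g x| ^ p) ∂μ ∂μ :=
        setLIntegral_mono' hA fun x hx =>
          lintegral_mono' (Measure.restrict_mono (h x hx) le_rfl) le_rfl
    _ ≤ _ := setLIntegral_le_lintegral _ _

theorem three_pow_rpow_eq_ratio {p : ℝ} (hp : 1 ≤ p) (n : ℕ) :
    (1 / 3 ^ n : ℝ) ^ (p - 1) = (ratio p ^ n) ^ p := by
  have hp0 : p ≠ 0 := by positivity
  rw [ratio, ← Real.rpow_natCast, ← Real.rpow_natCast, ← Real.rpow_mul (by positivity),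
    ← Real.rpow_mul (by positivity), one_div, ← Real.rpow_neg (by norm_num),
    ← Real.rpow_mul (by norm_num)]
  congr 1
  field_simp

theorem one_div_pow_rpow_θ {p : ℝ} (hp : 1 ≤ p) (n : ℕ) :
    (1 / 3 ^ n : ℝ) ^ θ p = (ratio p ^ n) ^ p / (5 ^ n * 5 ^ n) := by
  rw [← three_pow_rpow_eq_ratio hp, θ, Real.rpow_add (by positivity), two_mul,
    Real.rpow_add (by positivity), Real.div_rpow (by norm_num) (by positivity) dh,
    three_pow_rpow_dh, Real.one_rpow]
  field_simp

/-- The constant of `abs_average_sub_average_le`. -/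
noncomputable def constA (p : ℝ) : ℝ := 125 * 125 * 5 * constH p * 3 ^ θ p

theorem constA_pos (p : ℝ) : 0 < constA p := by
  have := constH_pos p
  unfold constA; positivity

/-- The averages over nearby balls of comparable radii are close to each other. -/
theorem abs_average_sub_average_le {p : ℝ} (hp : 1 ≤ p) {g : K → ℝ} (hg : Measurable g)
    (hLp : MemLp g (ENNReal.ofReal p) μ) {M : ℝ} (hM : 0 ≤ M)
    (hE : ∀ r : ℝ, 0 < r → energy geodesicDist μ p (αExp p) g r ≤ ENNReal.ofReal M)
    {n k : ℕ} (hnk : n ≤ k) (hkn : k ≤ n + 1) {x y : K} (hxy : dist x y ≤ 1 / 3 ^ n) :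
    |(⨍ z in Metric.ball y (1 / 3 ^ k), g z ∂μ) - ⨍ z in Metric.ball x (1 / 3 ^ n), g z ∂μ| ≤
      (constA p * M) ^ (1 / p) * ratio p ^ n := by
  have hp0 : 0 < p := by linarith
  have hr := ratio_pos p
  have hC := constA_pos p
  have hH := constH_pos p
  set A := Metric.ball x (1 / 3 ^ n)
  set B := Metric.ball y (1 / 3 ^ k)
  set t := |(⨍ z in B, g z ∂μ) - ⨍ z in A, g z ∂μ|
  have h1 := ofReal_abs_average_sub_average_mul_le hp hLp (μ_metricBall_ne_zero x n)
    (μ_metricBall_ne_zero y k)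
  -- The three lengths are two radii and the distance of the centers.
  have hsub : ∀ u ∈ A, B ⊆ Metric.ball u (3 * (1 / 3 ^ n)) := by
    intro u hu v hv
    rw [Metric.mem_ball] at hu hv ⊢
    have h2 := dist_triangle4 v y x u
    rw [dist_comm y x, dist_comm x u] at h2
    have h3 : (1 : ℝ) / 3 ^ k ≤ 1 / 3 ^ n := by gcongr; norm_num
    linarith
  have hle1 : (1 : ℝ) / 3 ^ n ≤ 1 := by
    rw [div_le_one (by positivity)]
    exact one_le_pow₀ (by norm_num)
  have h0 : (0 : ℝ) < 1 / 3 ^ n := by positivity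
  have h2 := h1.trans (J_le_H Metric.isOpen_ball.measurableSet hsub)
  have h3 := h2.trans (H_le_energy hp hg h0 hle1 (by linarith))
  have h4 := h3.trans (mul_le_mul_right (hE _ h0) _)
  have h5 : ENNReal.ofReal (t ^ p) * (ENNReal.ofReal ((125 * 5 ^ n)⁻¹) *
      ENNReal.ofReal ((125 * 5 ^ k)⁻¹)) ≤ _ :=
    (mul_le_mul_right (mul_le_mul' (ofReal_le_μ_metricBall x n) (ofReal_le_μ_metricBall y k))
      _).trans h4
  rw [← ENNReal.ofReal_mul (by positivity), ← ENNReal.ofReal_mul (by positivity),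
    ← ENNReal.ofReal_mul (by positivity), ENNReal.ofReal_le_ofReal_iff (by positivity),
    Real.mul_rpow (by norm_num) h0.le, one_div_pow_rpow_θ hp] at h5
  have h6 : t ^ p ≤ constA p * M * (ratio p ^ n) ^ p := by
    have h7 : (5 : ℝ) ^ k ≤ 5 ^ n * 5 := by
      rw [← pow_succ]; exact pow_le_pow_right₀ (by norm_num) hkn
    rw [← mul_inv, ← div_eq_mul_inv, div_le_iff₀ (by positivity)] at h5
    refine h5.trans ?_
    calc _ ≤ constH p * (3 ^ θ p * ((ratio p ^ n) ^ p / (5 ^ n * 5 ^ n))) * M *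
          (125 * 5 ^ n * (125 * (5 ^ n * 5))) := by gcongr
      _ = _ := by rw [constA]; field_simp
  have h8 := Real.rpow_le_rpow (by positivity) h6 (by positivity : 0 ≤ 1 / p)
  rwa [← Real.rpow_mul (abs_nonneg _), mul_one_div_cancel hp0.ne', Real.rpow_one,
    Real.mul_rpow (by positivity) (by positivity), ← Real.rpow_mul (by positivity),
    mul_one_div_cancel hp0.ne', Real.rpow_one] at h8

/-- Functions of finite energy at the critical exponent have a continuous version for `p > 1`. -/
theorem exists_continuous_version {p : ℝ} (hp : 1 < p) {g : K → ℝ} (hg : Measurable g)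
    (hLp : MemLp g (ENNReal.ofReal p) μ) {M : ℝ} (hM : 0 ≤ M)
    (hE : ∀ r : ℝ, 0 < r → energy geodesicDist μ p (αExp p) g r ≤ ENNReal.ofReal M) :
    ∃ G : C(K, ℝ), g =ᵐ[μ] G := by
  have hr0 := ratio_pos p
  have hr1 := ratio_lt_one hp
  have hC := constA_pos p
  have hH := constH_pos p
  set D := (constA p * M) ^ (1 / p) with hD
  have hD0 : 0 ≤ D := by positivity
  let h : ℕ → K → ℝ := fun n x => ⨍ z in Metric.ball x (1 / 3 ^ n), g z ∂μ
  have hstep : ∀ x n, dist (h n x) (h (n + 1) x) ≤ D * ratio p ^ n := fun x n => by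
    rw [dist_comm]
    exact abs_average_sub_average_le hp.le hg hLp hM hE (Nat.le_succ n) le_rfl
      (by rw [dist_self]; positivity)
  choose G hG using fun x => cauchySeq_tendsto_of_complete
    (cauchySeq_of_le_geometric (ratio p) D hr1 (hstep x))
  have hGh : ∀ x n, dist (h n x) (G x) ≤ D * ratio p ^ n / (1 - ratio p) := fun x n =>
    dist_le_of_le_geometric_of_tendsto (ratio p) D hr1 (hstep x) (hG x) n
  have hpow : Tendsto (fun n => ratio p ^ n) atTop (𝓝 0) :=
    tendsto_pow_atTop_nhds_zero_of_lt_one hr0.le hr1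
  -- The averages `h n` need not be continuous: it is enough that `h n x` and `h n y` are close when
  -- `dist x y ≤ 3⁻ⁿ`, uniformly in `x` and `y`.
  have hcont : Continuous G := by
    rw [Metric.continuous_iff]
    intro x ε hε
    have ht : Tendsto (fun n => (2 * (D / (1 - ratio p)) + D) * ratio p ^ n) atTop (𝓝 0) := by
      simpa using hpow.const_mul (2 * (D / (1 - ratio p)) + D)
    obtain ⟨n, hn⟩ := (ht.eventually_lt_const hε).exists
    refine ⟨1 / 3 ^ n, by positivity, fun y hy => ?_⟩
    have h1 := hGh x n
    have h2 := hGh y n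
    have h3 : dist (h n x) (h n y) ≤ D * ratio p ^ n :=
      abs_average_sub_average_le hp.le hg hLp hM hE le_rfl (Nat.le_succ n) hy.le
    have h4 := dist_triangle4 (G y) (h n y) (h n x) (G x)
    rw [dist_comm (G y) (h n y), dist_comm (h n y) (h n x)] at h4
    have e : (2 * (D / (1 - ratio p)) + D) * ratio p ^ n =
      2 * (D * ratio p ^ n / (1 - ratio p)) + D * ratio p ^ n := by ring
    rw [e] at hn
    linarith
  refine ⟨⟨G, hcont⟩, ?_⟩
  set D' := D / (1 - ratio p) with hD'
  have hD'0 : 0 ≤ D' := div_nonneg hD0 (by linarith)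
  set W : ℝ := 2 ^ (p - 1) * (125 * constH p * M + D' ^ p) with hW
  -- `G` is compared with `h n` pointwise and `h n` with `g` in the mean. Dividing by the mass of
  -- balls leaves a spare `5⁻ⁿ`, which is dropped.
  have hbound : ∀ n : ℕ, ∫⁻ x, ENNReal.ofReal (|G x - g x| ^ p) ∂μ ≤
      ENNReal.ofReal (W * (ratio p ^ n) ^ p) := by
    intro n
    have hpt : ∀ x, ENNReal.ofReal (|G x - g x| ^ p) ≤ ENNReal.ofReal (2 ^ (p - 1)) *
        (ENNReal.ofReal (125 * 5 ^ n) * (∫⁻ y in Metric.ball x (1 / 3 ^ n),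
          ENNReal.ofReal (|g y - g x| ^ p) ∂μ) + ENNReal.ofReal ((D' * ratio p ^ n) ^ p)) := by
      intro x
      refine (ofReal_rpow_triangle hp.le (g x) (h n x) (G x)).trans ?_
      gcongr
      · have h1 := ofReal_abs_average_sub_mul_le hp.le hLp (μ_metricBall_ne_zero x n) (g x)
        have h2 := (mul_le_mul_right (ofReal_le_μ_metricBall x n)
          (ENNReal.ofReal (|h n x - g x| ^ p))).trans h1
        rw [ENNReal.ofReal_inv_of_pos (by positivity), ← div_eq_mul_inv,
          ENNReal.div_le_iff_le_mul (Or.inl (ENNReal.ofReal_pos.2 (by positivity)).ne')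
            (Or.inl ENNReal.ofReal_ne_top)] at h2
        · rwa [mul_comm]
      · have h1 := hGh x n
        rw [dist_comm, Real.dist_eq] at h1
        refine h1.trans (le_of_eq ?_)
        rw [hD']; ring
    refine (lintegral_mono hpt).trans ?_
    rw [lintegral_const_mul' _ _ ENNReal.ofReal_ne_top, lintegral_add_right _ measurable_const,
      lintegral_const_mul' _ _ ENNReal.ofReal_ne_top, lintegral_const, measure_univ, mul_one]
    have h0 : (0 : ℝ) < 1 / 3 ^ n := by positivity
    have hle1 : (1 : ℝ) / 3 ^ n ≤ 1 := by
      rw [div_le_one (by positivity)]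
      exact one_le_pow₀ (by norm_num)
    have h1 := (H_le_energy hp.le hg h0 hle1 le_rfl).trans (mul_le_mul_right (hE _ h0) _)
    refine (mul_le_mul_right (add_le_add (mul_le_mul_right h1 _) le_rfl) _).trans ?_
    rw [← ENNReal.ofReal_mul (by positivity), ← ENNReal.ofReal_mul (by positivity),
      ← ENNReal.ofReal_add (by positivity) (by positivity), ← ENNReal.ofReal_mul (by positivity)]
    refine ENNReal.ofReal_le_ofReal ?_
    rw [one_div_pow_rpow_θ hp.le, Real.mul_rpow hD'0 (by positivity), hW,
      mul_assoc ((2 : ℝ) ^ (p - 1))]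
    refine mul_le_mul_of_nonneg_left ?_ (by positivity)
    rw [add_mul]
    refine add_le_add ?_ le_rfl
    have h5 : (1 : ℝ) ≤ 5 ^ n := one_le_pow₀ (by norm_num)
    calc _ = 125 * constH p * M * (ratio p ^ n) ^ p / 5 ^ n := by field_simp
      _ ≤ _ := div_le_self (by positivity) h5
  have hzero : ∫⁻ x, ENNReal.ofReal (|G x - g x| ^ p) ∂μ = 0 := by
    have ht : Tendsto (fun n => ENNReal.ofReal (W * (ratio p ^ n) ^ p)) atTop (𝓝 0) := by
      have h1 := (hpow.rpow_const (p := p) (Or.inr (by linarith))).const_mul W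
      rw [Real.zero_rpow (by linarith), mul_zero] at h1
      have h2 := (ENNReal.continuous_ofReal.tendsto _).comp h1
      rwa [ENNReal.ofReal_zero] at h2
    exact le_antisymm (ge_of_tendsto' ht hbound) zero_le
  have hmeas : Measurable fun x => ENNReal.ofReal (|G x - g x| ^ p) := by
    have h1 : Measurable fun x => G x - g x := hcont.measurable.sub hg
    exact ENNReal.measurable_ofReal.comp ((measurable_norm.comp h1).pow_const p)
  rw [lintegral_eq_zero_iff hmeas] at hzero
  filter_upwards [hzero] with x hx
  have h1 : |G x - g x| ^ p ≤ 0 := ENNReal.ofReal_eq_zero.1 hx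
  have h2 : |G x - g x| = 0 := by
    by_contra hc
    have : 0 < |G x - g x| ^ p := Real.rpow_pos_of_pos (lt_of_le_of_ne (abs_nonneg _)
      (Ne.symm hc)) _
    linarith
  have h3 := abs_eq_zero.1 h2
  change g x = G x
  linarith

/-- Property `P` upgrades the finite upper limit to a bound at all radii, which
`exists_continuous_version` needs. -/
theorem exists_continuous_version_of_memKS {p : ℝ} (hp : 1 < p) {f : K → ℝ}
    (hf : MemKS geodesicDist μ p (αExp p) f) : ∃ g : C(K, ℝ), f =ᵐ[μ] g := by
  obtain ⟨hLp, hlim⟩ := hf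
  have hae := hLp.aestronglyMeasurable.aemeasurable
  have hfin : (⨆ (r : ℝ) (_ : 0 < r), energy geodesicDist μ p (αExp p) f r) < ∞ := by
    refine (iSup_energy_le hp.le hae).trans_lt (ENNReal.mul_lt_top ENNReal.ofReal_lt_top ?_)
    exact (liminf_le_limsup (by isBoundedDefault) (by isBoundedDefault)).trans_lt hlim
  have hfg := hae.ae_eq_mk
  rw [energy_congr hfg] at hfin
  obtain ⟨G, hG⟩ := exists_continuous_version hp hae.measurable_mk (hLp.ae_eq hfg)
    (M := ENNReal.toReal _) ENNReal.toReal_nonneg fun r hr => by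
      rw [ENNReal.ofReal_toReal hfin.ne]
      exact le_iSup₂ (f := fun (r : ℝ) (_ : 0 < r) =>
        energy geodesicDist μ p (αExp p) (hae.mk f) r) r hr
  exact ⟨G, hfg.trans hG⟩

end Vicsek

theorem theoremP :
    (∀ p : ℝ, 1 ≤ p →
      KorevaarSchoen.criticalExponent Vicsek.geodesicDist Vicsek.μ p =
          ENNReal.ofReal (Vicsek.αExp p) ∧
        KorevaarSchoen.PropertyP Vicsek.geodesicDist Vicsek.μ p (Vicsek.αExp p)) ∧
    (∀ p : ℝ, 1 < p →
      (∀ f : Vicsek.K → ℝ,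
        KorevaarSchoen.MemKS Vicsek.geodesicDist Vicsek.μ p (Vicsek.αExp p) f →
          ∃ g : C(Vicsek.K, ℝ), f =ᵐ[Vicsek.μ] g) ∧
      (∀ f : C(Vicsek.K, ℝ),
        Tendsto (fun m : ℕ => Vicsek.discreteEnergy p m f) atTop (𝓝 (Vicsek.pEnergy p f))) ∧
      ∃ c C : ℝ, 0 < c ∧ 0 < C ∧ ∀ f : C(Vicsek.K, ℝ),
        KorevaarSchoen.MemKS Vicsek.geodesicDist Vicsek.μ p (Vicsek.αExp p) f →
          ENNReal.ofReal c *
              KorevaarSchoen.variation Vicsek.geodesicDist Vicsek.μ p (Vicsek.αExp p) f ^ p ≤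
            Vicsek.pEnergy p f ∧
          Vicsek.pEnergy p f ≤ ENNReal.ofReal C *
              KorevaarSchoen.variation Vicsek.geodesicDist Vicsek.μ p (Vicsek.αExp p) f ^ p) := by
  refine ⟨fun p hp => ⟨Vicsek.criticalExponent_eq hp, Vicsek.propertyP hp⟩, fun p hp =>
    ⟨fun f hf => Vicsek.exists_continuous_version_of_memKS hp hf, fun f => ?_, ?_⟩⟩
  · rw [Vicsek.pEnergy_eq hp.le]
    exact Vicsek.tendsto_discreteEnergy hp.le f
  · obtain ⟨c, C, hc, hC, h⟩ := Vicsek.limEnergy_equiv hp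
    exact ⟨c, C, hc, hC, fun f _ => h f⟩
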